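/- **Setting.** Let $n\ge 2$ and let $U\subset\mathbb R^n$ be a nonempty bounded open set with $C^2$ boundary $\partial U=\Gamma_e\cup\Gamma_i$, where $\Gamma_e,\Gamma_i$ are disjoint and Borel; $N$ is the outward unit normal and $|U|$ the volume of $U$. Let $g(s)=\sum_{j=0}^k a_js^{\alpha_j}$ with $k\ge0$, $a_0,\dots,a_k>0$ and real exponents $0=\alpha_0<\alpha_1<\dots<\alpha_k$; put $G(s)=s\,g(s)$ for $s\ge 0$ and $K(\xi)=1/g(G^{-1}(\xi))$ for $\xi\ge0$. IBVP-I: let $p(x,t)$ be a classical solution of $$\frac{\partial p}{\partial t}=\nabla\cdot\big(K(|\nabla p|)\nabla p\big)\ \text{ in } U\times(0,\infty),\qquad -\int_{\Gamma_i}K(|\nabla p|)\nabla p\cdot N\,ds=Q(t)\ \ (t>0),$$ $$\frac{\partial p}{\partial N}=0\ \text{ on }\Gamma_e\times(0,\infty),\qquad p(x,0)=p_0(x)\ \text{ in } U,$$ whose trace on the well is $p|_{\Gamma_i}=\gamma(t)+\psi(x,t)$ with $\int_{\Gamma_i}\psi(x,t)\,ds=0$ for $t>0$ (the function $\gamma$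 is not prescribed). "Classical" means: $p(\cdot,t)\in C^2(U)$ for each $t>0$; $p$, $p_t$ and $\nabla p$ are continuous on $\overline U\times(0,\infty)$; $p$ is continuous on $U\times[0,\infty)$. Let $\Psi(x,t)$ be an extension of $\psi$ to $U$, i.e. $\Psi=\psi$ on $\Gamma_i\times(0,\infty)$, with $\Psi,\Psi_t$ continuous on $\overline U\times(0,\infty)$ and of class $C^1$ in $U\times(0,\infty)$. Let $Q_s\in\mathbb R$, $A=Q_s/|U|$, $\Delta_Q(t)=Q(t)-Q_s$, $\Delta_\gamma(t)=\gamma(t)+At$, and $\overline p=p-\Psi$. For time-independent data $\varphi$ on $\Gamma_i$, with an extension $\Phi$ to $U$, the pseudo steady state solution is $p_s(x,t)=-At+W(x)$, where $W$ is a classical solution of $-A=\nabla\cdot(K(|\nabla W|)\nabla W)$ in $U$, $W=\varphi$ on $\Gamma_i$, $\partial W/\partial N=0$ on $\Gamma_e$ (that is, $W\in C^2(U)$, with $W$ and $\nabla W$ continuous on $\overline U$); put $\overline p_s=p_s-\Phi$. **Assumption A3-$\beta$** (for a given $\beta\ge2$): $\gamma$ is differentiable on $[1,\infty)$ and there is a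 constant $C$ with $$|\Delta_\gamma'(t)|+|\Delta_Q(t)|+\int_1^\infty\Big(\|\Psi_{tt}(\cdot,\tau)\|_{L^\beta(U)}+\|\nabla\Psi_t(\cdot,\tau)\|_{L^\beta(U)}^2\Big)d\tau\le C\qquad\text{for all } t\ge1 .$$ **Theorem.** Let $\beta\ge 2$ and suppose that the boundary data satisfy Assumption A3-$\beta$. Then, for every pseudo steady state solution $p_s$ as above and all $t>0$, $$\int_U|\overline p_t-\overline p_{s,t}|^\beta\,dx=\int_U|\overline p_t+A|^\beta\,dx ,$$ and for every $t_0>0$ there is a constant $C$ such that, for all $t\ge t_0$, $|\overline p_t+A|^\beta$ is integrable on $U$ and $$\int_U|\overline p_t+A|^\beta\,dx\le C .$$ -/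

import Mathlib

open scoped MeasureTheory

namespace Forchheimer

/-! ### The nonlinearity -/

/-- The generalized polynomial `g(s) = ∑ⱼ aⱼ s ^ αⱼ`. -/
noncomputable def gPoly {k : ℕ} (a α : Fin (k + 1) → ℝ) (s : ℝ) : ℝ :=
  ∑ j, a j * s ^ α j

/-- Admissible data of `g`: `0 = α₀ < α₁ < ⋯ < αₖ` and `a₀, …, aₖ > 0`. -/
structure IsGeneralizedPolynomial {k : ℕ} (a α : Fin (k + 1) → ℝ) : Prop where
  exponent_zero : α 0 = 0
  exponent_strictMono : StrictMono α
  coeff_pos : ∀ j, 0 < a j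

/-- `K(ξ) = 1 / g(G⁻¹(ξ))` for `ξ ≥ 0`, where `G(s) = s g(s)` is regarded as a map of `[0, ∞)`
into itself. -/
noncomputable def conductivity {k : ℕ} (a α : Fin (k + 1) → ℝ) (ξ : ℝ) : ℝ :=
  1 / gPoly a α (Function.invFunOn (fun s : ℝ => s * gPoly a α s) (Set.Ici 0) ξ)

/-! ### Vector calculus on a domain with `C²` boundary -/

/-- `ρ` is a `C²` function near `x` with `∇ρ(x) ≠ 0` and `U = {ρ < 0}` near `x`. -/
structure IsLocalDefiningFunction {n : ℕ} (U : Set (EuclideanSpace ℝ (Fin n)))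
    (x : EuclideanSpace ℝ (Fin n)) (ρ : EuclideanSpace ℝ (Fin n) → ℝ) : Prop where
  contDiffAt : ContDiffAt ℝ 2 ρ x
  gradient_ne_zero : gradient ρ x ≠ 0
  mem_iff : ∀ᶠ y in nhds x, (y ∈ U ↔ ρ y < 0)

open Classical in
/-- The outward unit normal `N(x)` at a boundary point `x` of a set with `C²` boundary, i.e.
`∇ρ(x) / |∇ρ(x)|` for any local defining function `ρ` at `x` (see `outwardNormal_eq` for the
independence of `ρ`). -/
noncomputable def outwardNormal {n : ℕ} (U : Set (EuclideanSpace ℝ (Fin n)))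
    (x : EuclideanSpace ℝ (Fin n)) : EuclideanSpace ℝ (Fin n) :=
  if h : ∃ ρ, IsLocalDefiningFunction U x ρ then
    ‖gradient h.choose x‖⁻¹ • gradient h.choose x
  else 0

/-- The normal does not depend on the choice of the local defining function. -/
theorem outwardNormal_eq {n : ℕ} {U : Set (EuclideanSpace ℝ (Fin n))}
    {x : EuclideanSpace ℝ (Fin n)} (hU : IsOpen U) (hx : x ∈ frontier U)
    {ρ : EuclideanSpace ℝ (Fin n) → ℝ} (hρ : IsLocalDefiningFunction U x ρ) :
    outwardNormal U x = ‖gradient ρ x‖⁻¹ • gradient ρ x := by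
  have key : ∀ σ : EuclideanSpace ℝ (Fin n) → ℝ, IsLocalDefiningFunction U x σ →
      σ x = 0 ∧ ∀ v, HasDerivAt (fun s : ℝ => σ (x + s • v)) (inner ℝ (gradient σ x) v) 0 := by
    intro σ hσ
    have hd : DifferentiableAt ℝ σ x := hσ.contDiffAt.differentiableAt (by norm_num)
    constructor
    · apply le_antisymm
      · have hcl : x ∈ closure U := frontier_subset_closure hx
        rw [mem_closure_iff_frequently] at hcl
        by_contra! hpos
        have h1 : ∀ᶠ y in nhds x, 0 < σ y := hd.continuousAt.eventually (lt_mem_nhds hpos)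
        obtain ⟨y, hyU, hy1, hy2⟩ := (hcl.and_eventually (h1.and hσ.mem_iff)).exists
        linarith [hy2.1 hyU]
      · have hnx : x ∉ U := by
          rw [hU.frontier_eq] at hx
          exact hx.2
        by_contra! hneg
        exact hnx (hσ.mem_iff.self_of_nhds.2 hneg)
    · intro v
      have h1 : HasFDerivAt σ (fderiv ℝ σ x) (x + (0 : ℝ) • v) := by
        simpa using hd.hasFDerivAt
      have h2 : HasDerivAt (fun s : ℝ => x + s • v) v 0 := by
        simpa using ((hasDerivAt_id (0 : ℝ)).smul_const v).const_add x
      have h3 := h1.comp_hasDerivAt (0 : ℝ) h2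
      have h4 : inner ℝ (gradient σ x) v = fderiv ℝ σ x v := by
        simp [gradient, InnerProductSpace.toDual_symm_apply]
      rw [h4]
      exact h3
  have half : ∀ σ τ : EuclideanSpace ℝ (Fin n) → ℝ, IsLocalDefiningFunction U x σ →
      IsLocalDefiningFunction U x τ → ∀ v, inner ℝ (gradient σ x) v < 0 →
      inner ℝ (gradient τ x) v ≤ 0 := by
    intro σ τ hσ hτ v hv
    by_contra! hpos
    have e1 := ((key σ hσ).2 v).hasDerivWithinAt (s := Set.Ioi 0)
    have e2 := ((key τ hτ).2 v).hasDerivWithinAt (s := Set.Ioi 0)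
    rw [hasDerivWithinAt_iff_tendsto_slope' (by simp)] at e1 e2
    have f1 := e1.eventually (gt_mem_nhds hv)
    have f2 := e2.eventually (lt_mem_nhds hpos)
    have hc : Filter.Tendsto (fun s : ℝ => x + s • v) (nhdsWithin 0 (Set.Ioi 0)) (nhds x) := by
      have : Continuous (fun s : ℝ => x + s • v) := by fun_prop
      simpa using (this.tendsto 0).mono_left nhdsWithin_le_nhds
    have f3 := hc.eventually hσ.mem_iff
    have f4 := hc.eventually hτ.mem_iff
    obtain ⟨s, ⟨⟨⟨⟨g1, g2⟩, g3⟩, g4⟩, hs⟩⟩ :=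
      ((((f1.and f2).and f3).and f4).and self_mem_nhdsWithin).exists
    have hs' : (0 : ℝ) < s := hs
    simp only [slope_def_field, sub_zero, zero_smul, add_zero, (key σ hσ).1,
      (key τ hτ).1] at g1 g2
    have k1 : σ (x + s • v) < 0 := by
      rcases div_neg_iff.1 g1 with h | h
      · linarith [h.2]
      · exact h.1
    have k2 := g4.1 (g3.2 k1)
    have k3 := div_neg_of_neg_of_pos k2 hs'
    linarith
  have hex : ∃ σ, IsLocalDefiningFunction U x σ := ⟨ρ, hρ⟩
  rw [outwardNormal, dif_pos hex]
  set b := gradient hex.choose x with hb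
  set c := gradient ρ x with hc
  have hb0 : b ≠ 0 := hex.choose_spec.gradient_ne_zero
  have hc0 : c ≠ 0 := hρ.gradient_ne_zero
  have H := half _ _ hex.choose_spec hρ
  rw [← hb, ← hc] at H
  have nb : 0 < ‖b‖ := norm_pos_iff.2 hb0
  have nc : 0 < ‖c‖ := norm_pos_iff.2 hc0
  -- test the implication on the vectors `‖b‖ c - ‖c‖ b`
  have hge : ‖b‖ * ‖c‖ ≤ inner ℝ b c := by
    by_contra! hlt
    have t1 := H (‖b‖ • c - ‖c‖ • b) (by
      rw [inner_sub_right, inner_smul_right, inner_smul_right, real_inner_self_eq_norm_sq]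
      nlinarith)
    rw [inner_sub_right, inner_smul_right, inner_smul_right, real_inner_self_eq_norm_sq,
      real_inner_comm] at t1
    nlinarith
  have heq : inner ℝ b c = ‖b‖ * ‖c‖ := le_antisymm (real_inner_le_norm b c) hge
  have h5 := inner_eq_norm_mul_iff_real.1 heq
  calc ‖b‖⁻¹ • b = (‖b‖⁻¹ * ‖c‖⁻¹) • (‖c‖ • b) := by
        rw [smul_smul, mul_assoc, inv_mul_cancel₀ nc.ne', mul_one]
    _ = (‖b‖⁻¹ * ‖c‖⁻¹) • (‖b‖ • c) := by rw [h5]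
    _ = ‖c‖⁻¹ • c := by
        rw [smul_smul, mul_comm ‖b‖⁻¹, mul_assoc, inv_mul_cancel₀ nb.ne', mul_one]

/-- The gradient of `f : U → ℝ`, extended by continuity from `U` to the boundary of `U`. -/
noncomputable def gradUpToBoundary {n : ℕ} (U : Set (EuclideanSpace ℝ (Fin n)))
    (f : EuclideanSpace ℝ (Fin n) → ℝ) : EuclideanSpace ℝ (Fin n) → EuclideanSpace ℝ (Fin n) :=
  extendFrom U (gradient f)

/-- The divergence of a vector field. -/
noncomputable def divergence {n : ℕ}
    (V : EuclideanSpace ℝ (Fin n) → EuclideanSpace ℝ (Fin n)) (x : EuclideanSpace ℝ (Fin n)) : ℝ :=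
  ∑ i, (fderiv ℝ V x (EuclideanSpace.single i 1)) i

/-- `∇ · (K(|∇f|) ∇f)`. -/
noncomputable def forchheimerOperator {n : ℕ} (K : ℝ → ℝ) (f : EuclideanSpace ℝ (Fin n) → ℝ)
    (x : EuclideanSpace ℝ (Fin n)) : ℝ :=
  divergence (fun y => K ‖gradient f y‖ • gradient f y) x

/-- A bounded nonempty open set `U` of `ℝⁿ` with `C²` boundary, which is the disjoint union of the
exterior boundary `Γe` and the well boundary `Γi`. -/
structure IsReservoir {n : ℕ} (U Γe Γi : Set (EuclideanSpace ℝ (Fin n))) : Prop where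
  isOpen : IsOpen U
  isBounded : Bornology.IsBounded U
  nonempty : U.Nonempty
  c2_boundary : ∀ x ∈ frontier U, ∃ ρ, IsLocalDefiningFunction U x ρ
  union_eq : Γe ∪ Γi = frontier U
  disjoint : Disjoint Γe Γi
  measurableSet_well : MeasurableSet Γi

/-! ### The initial boundary value problem and the pseudo steady state -/

/-- `p` is a (classical) solution of the initial boundary value problem with total flux `Q` through
the well boundary `Γi`, no flow through `Γe`, initial value `p₀`, and trace `γ(t) + ψ(x,t)` on
`Γi`, where `ψ(·,t)` has mean zero on `Γi`.  Surface integrals are taken with respect to the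
`(n-1)`-dimensional Hausdorff measure in its Euclidean normalization. -/
structure IsSolutionIBVP1 {n : ℕ} (U Γe Γi : Set (EuclideanSpace ℝ (Fin n))) (K : ℝ → ℝ)
    (Q : ℝ → ℝ) (p₀ : EuclideanSpace ℝ (Fin n) → ℝ) (γ : ℝ → ℝ)
    (ψ p : EuclideanSpace ℝ (Fin n) → ℝ → ℝ) : Prop where
  /-- regularity: `p`, `∂p/∂t` and `∇p` are continuous on `closure U × (0, ∞)` -/
  continuousOn : ContinuousOn (fun z : EuclideanSpace ℝ (Fin n) × ℝ => p z.1 z.2)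
    (closure U ×ˢ Set.Ioi 0)
  differentiableAt_time : ∀ x ∈ closure U, ∀ t > 0, DifferentiableAt ℝ (p x) t
  continuousOn_time_deriv : ContinuousOn
    (fun z : EuclideanSpace ℝ (Fin n) × ℝ => deriv (p z.1) z.2) (closure U ×ˢ Set.Ioi 0)
  continuousOn_gradient : ContinuousOn
    (fun z : EuclideanSpace ℝ (Fin n) × ℝ => gradUpToBoundary U (fun y => p y z.2) z.1)
    (closure U ×ˢ Set.Ioi 0)
  /-- regularity: `p(·,t)` is `C²` in `U` -/
  contDiffOn_space : ∀ t > 0, ContDiffOn ℝ 2 (fun x => p x t) U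
  equation : ∀ x ∈ U, ∀ t > 0, deriv (p x) t = forchheimerOperator K (fun y => p y t) x
  total_flux : ∀ t > 0,
    -∫ x in Γi, inner ℝ
        (K ‖gradUpToBoundary U (fun y => p y t) x‖ • gradUpToBoundary U (fun y => p y t) x)
        (outwardNormal U x) ∂(μHE[n - 1]) = Q t
  no_flow : ∀ x ∈ Γe, ∀ t > 0,
    inner ℝ (gradUpToBoundary U (fun y => p y t) x) (outwardNormal U x) = 0
  continuousOn_initial : ContinuousOn (fun z : EuclideanSpace ℝ (Fin n) × ℝ => p z.1 z.2)
    (U ×ˢ Set.Ici 0)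
  initial : ∀ x ∈ U, p x 0 = p₀ x
  trace : ∀ x ∈ Γi, ∀ t > 0, p x t = γ t + ψ x t
  trace_mean_zero : ∀ t > 0, ∫ x in Γi, ψ x t ∂(μHE[n - 1]) = 0

/-- `Ψ` is an extension to `U × (0, ∞)` of the boundary data `ψ` on `Γi`, with `Ψ` and `Ψ_t`
of class `C¹` in `U × (0, ∞)` and continuous on `closure U × (0, ∞)`. -/
structure IsBoundaryDataExtension {n : ℕ} (U Γi : Set (EuclideanSpace ℝ (Fin n)))
    (ψ Ψ : EuclideanSpace ℝ (Fin n) → ℝ → ℝ) : Prop where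
  continuousOn : ContinuousOn (fun z : EuclideanSpace ℝ (Fin n) × ℝ => Ψ z.1 z.2)
    (closure U ×ˢ Set.Ioi 0)
  differentiableAt_time : ∀ x ∈ closure U, ∀ t > 0, DifferentiableAt ℝ (Ψ x) t
  continuousOn_time_deriv : ContinuousOn
    (fun z : EuclideanSpace ℝ (Fin n) × ℝ => deriv (Ψ z.1) z.2) (closure U ×ˢ Set.Ioi 0)
  contDiffOn : ContDiffOn ℝ 1 (fun z : EuclideanSpace ℝ (Fin n) × ℝ => Ψ z.1 z.2)
    (U ×ˢ Set.Ioi 0)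
  contDiffOn_time_deriv : ContDiffOn ℝ 1
    (fun z : EuclideanSpace ℝ (Fin n) × ℝ => deriv (Ψ z.1) z.2) (U ×ˢ Set.Ioi 0)
  trace : ∀ x ∈ Γi, ∀ t > 0, Ψ x t = ψ x t

/-- `A = Qₛ / |U|`. -/
noncomputable def pssRate {n : ℕ} (U : Set (EuclideanSpace ℝ (Fin n))) (Qs : ℝ) : ℝ :=
  Qs / MeasureTheory.volume.real U

/-- `W` is the basic profile for the boundary data `φ` and the flux `Qₛ`:
`∇ · (K(|∇W|) ∇W) = -A` in `U`, `W = φ` on `Γi`, `∂W/∂N = 0` on `Γe`. -/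
structure IsBasicProfile {n : ℕ} (U Γe Γi : Set (EuclideanSpace ℝ (Fin n))) (K : ℝ → ℝ)
    (Qs : ℝ) (φ W : EuclideanSpace ℝ (Fin n) → ℝ) : Prop where
  continuousOn : ContinuousOn W (closure U)
  continuousOn_gradient : ContinuousOn (gradUpToBoundary U W) (closure U)
  contDiffOn : ContDiffOn ℝ 2 W U
  equation : ∀ x ∈ U, -pssRate U Qs = forchheimerOperator K W x
  trace : ∀ x ∈ Γi, W x = φ x
  no_flow : ∀ x ∈ Γe, inner ℝ (gradUpToBoundary U W x) (outwardNormal U x) = 0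

/-- The pseudo steady state solution `pₛ(x,t) = -A t + W(x)`. -/
noncomputable def pssSolution {n : ℕ} (U : Set (EuclideanSpace ℝ (Fin n))) (Qs : ℝ)
    (W : EuclideanSpace ℝ (Fin n) → ℝ) (x : EuclideanSpace ℝ (Fin n)) (t : ℝ) : ℝ :=
  -pssRate U Qs * t + W x

/-- The assumption on the boundary data for the exponent `β`: for some constant `C` and all
`t ≥ 1`,
`|Δ_γ'(t)| + |Δ_Q(t)| + ∫₁^∞ (‖Ψ_tt‖_{L^β(U)} + ‖∇Ψ_t‖²_{L^β(U)}) dτ ≤ C`, where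
`Δ_γ(t) = γ(t) + A t` and `Δ_Q(t) = Q(t) - Qₛ`. -/
def AssumptionA3 {n : ℕ} (U : Set (EuclideanSpace ℝ (Fin n))) (Q γ : ℝ → ℝ) (Qs : ℝ)
    (Ψ : EuclideanSpace ℝ (Fin n) → ℝ → ℝ) (β : ℝ) : Prop :=
  (∀ t ≥ 1, DifferentiableAt ℝ γ t) ∧
  ∃ C : ℝ, ∀ t ≥ 1,
    ENNReal.ofReal (|deriv (fun s => γ s + pssRate U Qs * s) t| + |Q t - Qs|) +
      (∫⁻ τ in Set.Ici (1 : ℝ),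
        (MeasureTheory.eLpNorm (fun x => deriv (fun s => deriv (Ψ x) s) τ) (ENNReal.ofReal β)
            (MeasureTheory.volume.restrict U) +
          MeasureTheory.eLpNorm (fun x => gradient (fun y => deriv (Ψ y) τ) x) (ENNReal.ofReal β)
            (MeasureTheory.volume.restrict U) ^ 2)) ≤ ENNReal.ofReal C

end Forchheimer

/-! Put u = `p_t - Ψ_t + A`. Formally u_t = ∇·(∂_t of the flux) - Ψ_tt, and on the well Γi the
function u equals Δ_γ', which is bounded by some M. Let Φ be a convex C² function that grows like
|s|^β and satisfies Φ' = 0 on [-M, M]. If the equation is tested with Φ'(u), no boundary term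
survives: on Γe there is no flow, on Γi the factor Φ'(u) vanishes. Hence the flux Q plays no role,
and the divergence theorem is needed only for fields with zero normal component, so no surface
integral has to be handled.

The flux ξ ↦ K(|ξ|)ξ is the inverse of y ↦ g(|y|)y, which is strongly monotone with constant a₀
because the term of exponent 0 contributes a₀ y. The flux is therefore cocoercive
(`flux_cocoercive`), and the good term a₀|∂_t flux|² absorbs by Young's inequality the product of
∂_t flux with ∇Ψ_t. What remains is ∫Φ''(u)|∇Ψ_t|² and ∫|Φ'(u)||Ψ_tt|. Since Φ'' ≤ cΦ^((β-2)/β) and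
|Φ'| ≤ cΦ^((β-1)/β), Hölder's inequality gives E' ≤ c m(t)(1 + E) for E = ∫Φ(u), where m = ‖Ψ_tt‖ +
‖∇Ψ_t‖² in L^β(U). As m is integrable on [1,∞), Gronwall bounds E, and E controls ∫|u|^β.

Neither p_tt nor ∇p_t is assumed to exist, so all of this is done for the difference quotient of
step h (`quotient`, `fluxQuotient`), with constants independent of h, and then h → 0. The carrying
lemmas are `IsTangentField.integral_divergence`, `neg_fderiv_quotient_le`,
`integral_deriv_quotient_le`, `one_add_le_of_deriv_le` and `exists_integral_truncation_le`. On [t₀,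
1] the bound is mere compactness. -/

namespace Forchheimer

/-! ### The nonlinear flux -/

section PowerMap

variable {E : Type*} [NormedAddCommGroup E] [InnerProductSpace ℝ E]

/-- The derivative of `y ↦ ‖y‖ ^ r • y`. -/
noncomputable def powMapDeriv (r : ℝ) (y : E) : E →L[ℝ] E :=
  ‖y‖ ^ r • ContinuousLinearMap.id ℝ E + (r * ‖y‖ ^ (r - 2)) • (innerSL ℝ y).smulRight y

theorem powMapDeriv_apply (r : ℝ) (y v : E) :
    powMapDeriv r y v = ‖y‖ ^ r • v + (r * ‖y‖ ^ (r - 2)) • (inner ℝ y v • y) := by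
  simp [powMapDeriv]

theorem inner_powMapDeriv_nonneg {r : ℝ} (hr : 0 ≤ r) (y v : E) :
    ‖y‖ ^ r * ‖v‖ ^ 2 ≤ inner ℝ (powMapDeriv r y v) v := by
  rw [powMapDeriv_apply, inner_add_left, inner_smul_left, inner_smul_left, inner_smul_left,
    real_inner_self_eq_norm_sq]
  have h : 0 ≤ r * ‖y‖ ^ (r - 2) * (inner ℝ y v * inner ℝ y v) :=
    mul_nonneg (mul_nonneg hr (Real.rpow_nonneg (norm_nonneg _) _)) (mul_self_nonneg _)
  simpa using h

/-- For r < 2 the factor ‖y‖^(r-2) is singular at 0. This bound shows that the whole derivative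
still tends to 0 there. -/
theorem norm_powMapDeriv_le {r : ℝ} (hr : 0 < r) (y : E) :
    ‖powMapDeriv r y‖ ≤ (1 + r) * ‖y‖ ^ r := by
  have h0 : 0 ≤ ‖y‖ ^ r := Real.rpow_nonneg (norm_nonneg _) _
  have h1 : ‖y‖ ^ (r - 2) * (‖y‖ * ‖y‖) ≤ ‖y‖ ^ r := by
    rcases (norm_nonneg y).eq_or_lt with h | h
    · rw [← h, Real.zero_rpow hr.ne']; simp
    · rw [Real.rpow_sub h, Real.rpow_two]
      apply le_of_eq
      field_simp
  refine (norm_add_le _ _).trans ?_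
  rw [norm_smul, norm_smul, ContinuousLinearMap.norm_smulRight_apply, innerSL_apply_norm]
  have h2 : ‖(‖y‖ ^ r)‖ * ‖ContinuousLinearMap.id ℝ E‖ ≤ ‖y‖ ^ r := by
    rw [Real.norm_of_nonneg h0]
    exact mul_le_of_le_one_right h0 ContinuousLinearMap.norm_id_le
  have h3 : ‖r * ‖y‖ ^ (r - 2)‖ * (‖y‖ * ‖y‖) ≤ r * ‖y‖ ^ r := by
    rw [Real.norm_of_nonneg (by positivity), mul_assoc]
    gcongr
  linarith

/-- Away from the origin, ‖y‖^r = (‖y‖²)^(r/2) with ‖y‖² smooth. At the origin, for r > 0, the map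
is o(‖y‖); for r = 0 it is the identity. -/
theorem hasFDerivAt_powMap {r : ℝ} (hr : 0 ≤ r) (y : E) :
    HasFDerivAt (fun y : E => ‖y‖ ^ r • y) (powMapDeriv r y) y := by
  rcases hr.eq_or_lt with rfl | hr
  · have h : (powMapDeriv 0 y : E →L[ℝ] E) = ContinuousLinearMap.id ℝ E := by simp [powMapDeriv]
    simp only [h, Real.rpow_zero, one_smul]
    exact hasFDerivAt_id y
  rcases eq_or_ne y 0 with rfl | hy
  · rw [show powMapDeriv r (0 : E) = 0 by
      ext v; simp [powMapDeriv_apply, Real.zero_rpow hr.ne']]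
    rw [hasFDerivAt_iff_isLittleO_nhds_zero]
    have h1 : Filter.Tendsto (fun v : E => ‖v‖ ^ r) (nhds 0) (nhds 0) := by
      have : Continuous (fun v : E => ‖v‖ ^ r) :=
        continuous_norm.rpow_const fun _ => Or.inr hr.le
      simpa [Real.zero_rpow hr.ne'] using this.tendsto 0
    have h2 := ((Asymptotics.isLittleO_one_iff ℝ).2 h1).smul_isBigO
      (Asymptotics.isBigO_refl (fun v : E => v) (nhds 0))
    simpa using h2
  · have hn : ‖y‖ ^ 2 ≠ 0 := by simpa using hy
    have h1 := ((hasStrictFDerivAt_norm_sq y).hasFDerivAt.rpow_const (p := r / 2)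
      (Or.inl hn)).smul (hasFDerivAt_id y)
    have e1 : ∀ (z : E) (s : ℝ), (‖z‖ ^ 2) ^ (s / 2) = ‖z‖ ^ s := by
      intro z s
      rw [← Real.rpow_natCast, ← Real.rpow_mul (norm_nonneg _)]
      congr 1; push_cast; ring
    convert h1 using 1
    · ext z; simp [e1]
    · ext v
      rw [powMapDeriv_apply]
      simp only [id_eq, _root_.add_apply, _root_.smul_apply,
        ContinuousLinearMap.coe_id', ContinuousLinearMap.smulRight_apply,
        innerSL_apply_apply, nsmul_eq_mul, smul_eq_mul, e1,
        show r / 2 - 1 = (r - 2) / 2 by ring]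
      congr 1
      rw [smul_smul]
      congr 1
      push_cast; ring

theorem continuous_powMapDeriv {r : ℝ} (hr : 0 ≤ r) :
    Continuous (powMapDeriv r : E → E →L[ℝ] E) := by
  rcases hr.eq_or_lt with rfl | hr
  · have : (powMapDeriv 0 : E → E →L[ℝ] E) = fun _ => ContinuousLinearMap.id ℝ E := by
      ext y v; simp [powMapDeriv_apply]
    rw [this]; exact continuous_const
  rw [continuous_iff_continuousAt]
  intro y
  have hc : ∀ y : E, ContinuousAt (fun z : E => ‖z‖ ^ r) y := fun y =>
    (continuous_norm.rpow_const fun _ => Or.inr hr.le).continuousAt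
  rcases eq_or_ne y 0 with rfl | hy
  · have h0 : powMapDeriv r (0 : E) = 0 := by
      ext v; simp [powMapDeriv_apply, Real.zero_rpow hr.ne']
    rw [ContinuousAt, h0]
    refine squeeze_zero_norm (fun z => norm_powMapDeriv_le hr z) ?_
    have := ((hc 0).tendsto.const_mul (1 + r))
    simpa [Real.zero_rpow hr.ne'] using this
  · have hn : ‖y‖ ≠ 0 := by simpa using hy
    have h1 : ContinuousAt (fun z : E => ‖z‖ ^ (r - 2)) y :=
      continuous_norm.continuousAt.rpow_const (Or.inl hn)
    have h2 : Continuous fun z : E => (innerSL ℝ z).smulRight z := by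
      fun_prop
    unfold powMapDeriv
    exact ((hc y).smul continuousAt_const).add ((continuousAt_const.mul h1).smul h2.continuousAt)

/-- After expansion, Cauchy–Schwarz for the mixed term reduces the claim to the monotonicity of s ↦
s^r·s on [0,∞). -/
theorem powMap_monotone {r : ℝ} (hr : 0 ≤ r) (y z : E) :
    0 ≤ inner ℝ (‖y‖ ^ r • y - ‖z‖ ^ r • z) (y - z) := by
  have h1 : inner ℝ (‖y‖ ^ r • y - ‖z‖ ^ r • z) (y - z) =
      ‖y‖ ^ r * ‖y‖ ^ 2 + ‖z‖ ^ r * ‖z‖ ^ 2 - (‖y‖ ^ r + ‖z‖ ^ r) * inner ℝ y z := by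
    simp only [inner_sub_left, inner_sub_right, real_inner_smul_left, real_inner_self_eq_norm_sq,
      real_inner_comm y z]
    ring
  have h2 := real_inner_le_norm y z
  have hy := Real.rpow_nonneg (norm_nonneg y) r
  have hz := Real.rpow_nonneg (norm_nonneg z) r
  have h3 : 0 ≤ (‖y‖ ^ r * ‖y‖ - ‖z‖ ^ r * ‖z‖) * (‖y‖ - ‖z‖) := by
    rcases le_total ‖y‖ ‖z‖ with h | h
    · have := mul_le_mul (Real.rpow_le_rpow (norm_nonneg _) h hr) h (norm_nonneg _) hz
      exact mul_nonneg_of_nonpos_of_nonpos (by linarith) (by linarith)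
    · have := mul_le_mul (Real.rpow_le_rpow (norm_nonneg _) h hr) h (norm_nonneg _) hy
      exact mul_nonneg (by linarith) (by linarith)
  have h4 := mul_le_mul_of_nonneg_left h2 (add_nonneg hy hz)
  rw [h1]
  nlinarith

end PowerMap

/-! ### The flux as the inverse of an explicit monotone map. -/

section Flux

variable {n k : ℕ} {a α : Fin (k + 1) → ℝ}

local notation "𝕍" => EuclideanSpace ℝ (Fin n)

theorem IsGeneralizedPolynomial.exponent_nonneg (hg : IsGeneralizedPolynomial a α)
    (j : Fin (k + 1)) : 0 ≤ α j := by
  rw [← hg.exponent_zero]; exact hg.exponent_strictMono.monotone (Fin.zero_le j)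

theorem gPoly_ge (hg : IsGeneralizedPolynomial a α) {s : ℝ} (hs : 0 ≤ s) : a 0 ≤ gPoly a α s := by
  have h : ∀ j ∈ Finset.univ, 0 ≤ a j * s ^ α j := fun j _ =>
    mul_nonneg (hg.coeff_pos j).le (Real.rpow_nonneg hs _)
  have := Finset.single_le_sum h (Finset.mem_univ 0)
  simpa [hg.exponent_zero, gPoly] using this

theorem continuous_gPoly (hg : IsGeneralizedPolynomial a α) : Continuous (gPoly a α) := by
  unfold gPoly
  exact continuous_finsetSum _ fun j _ => continuous_const.mul
    (continuous_id.rpow_const fun _ => Or.inr (hg.exponent_nonneg j))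

theorem surjOn_mul_gPoly (hg : IsGeneralizedPolynomial a α) :
    Set.SurjOn (fun s : ℝ => s * gPoly a α s) (Set.Ici 0) (Set.Ici 0) := by
  intro ξ hξ
  have hξ : 0 ≤ ξ := hξ
  have ha := hg.coeff_pos 0
  have hc : Continuous fun s : ℝ => s * gPoly a α s := continuous_id.mul (continuous_gPoly hg)
  have h0 : 0 ≤ ξ / a 0 := by positivity
  have h1 := intermediate_value_Icc h0 hc.continuousOn
  -- Since g ≥ a₀, the value G(ξ/a₀) is at least ξ, so ξ/a₀ serves as right endpoint for the
  -- intermediate value theorem.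
  obtain ⟨s, hs, hs'⟩ := h1 (show ξ ∈ Set.Icc _ _ from ⟨by simpa using hξ, by
    calc ξ = ξ / a 0 * a 0 := by field_simp
      _ ≤ _ := by gcongr; exact gPoly_ge hg h0⟩)
  exact ⟨s, hs.1, hs'⟩

/-- The flux `K(|ξ|) ξ`. -/
noncomputable def flux (a α : Fin (k + 1) → ℝ) (ξ : 𝕍) : 𝕍 :=
  conductivity a α ‖ξ‖ • ξ

/-- The map `y ↦ g(|y|) y`, the inverse of the flux. -/
noncomputable def fluxInv (a α : Fin (k + 1) → ℝ) (y : 𝕍) : 𝕍 :=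
  gPoly a α ‖y‖ • y

theorem fluxInv_eq_sum (y : 𝕍) : fluxInv a α y = ∑ j, a j • (‖y‖ ^ α j • y) := by
  simp only [fluxInv, gPoly, Finset.sum_smul, smul_smul]

/-- The flux of ξ has norm s = G⁻¹(‖ξ‖), so the factors g(s) and 1/g(s) cancel. From here on
properties of K are read off from g. -/
theorem fluxInv_flux (hg : IsGeneralizedPolynomial a α) (ξ : 𝕍) :
    fluxInv a α (flux a α ξ) = ξ := by
  obtain ⟨hs, hs'⟩ := Function.invFunOn_pos (surjOn_mul_gPoly hg (norm_nonneg ξ))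
  set s := Function.invFunOn (fun s : ℝ => s * gPoly a α s) (Set.Ici 0) ‖ξ‖ with hsdef
  have hs : 0 ≤ s := hs
  have hpos : 0 < gPoly a α s := (hg.coeff_pos 0).trans_le (gPoly_ge hg hs)
  have hK : conductivity a α ‖ξ‖ = 1 / gPoly a α s := rfl
  have hn : ‖flux a α ξ‖ = s := by
    rw [flux, norm_smul, hK, Real.norm_of_nonneg (by positivity), ← hs']
    field_simp
  rw [fluxInv, hn, flux, hK, smul_smul, mul_one_div_cancel hpos.ne', one_smul]

/-- The summand j = 0 has exponent 0 and contributes exactly a₀‖y - z‖²; every other summand is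
monotone and may be dropped. -/
theorem fluxInv_coercive (hg : IsGeneralizedPolynomial a α) (y z : 𝕍) :
    a 0 * ‖y - z‖ ^ 2 ≤ inner ℝ (fluxInv a α y - fluxInv a α z) (y - z) := by
  rw [fluxInv_eq_sum, fluxInv_eq_sum, ← Finset.sum_sub_distrib, sum_inner]
  have h : ∀ j ∈ Finset.univ,
      0 ≤ inner ℝ (a j • (‖y‖ ^ α j • y) - a j • (‖z‖ ^ α j • z)) (y - z) := by
    intro j _
    rw [← smul_sub, real_inner_smul_left]
    exact mul_nonneg (hg.coeff_pos j).le (powMap_monotone (hg.exponent_nonneg j) y z)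
  refine le_trans (le_of_eq ?_) (Finset.single_le_sum h (Finset.mem_univ 0))
  simp [hg.exponent_zero, ← smul_sub, real_inner_smul_left]

theorem fluxInv_injective (hg : IsGeneralizedPolynomial a α) :
    Function.Injective (fluxInv a α : 𝕍 → 𝕍) := by
  intro y z h
  have h1 := fluxInv_coercive hg y z
  rw [h, sub_self, inner_zero_left] at h1
  have h2 : ‖y - z‖ ^ 2 ≤ 0 := nonpos_of_mul_nonpos_right h1 (hg.coeff_pos 0)
  rw [← sub_eq_zero, ← norm_eq_zero]
  exact pow_eq_zero_iff two_ne_zero |>.1 (le_antisymm h2 (sq_nonneg _))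

/-- Cocoercivity of the flux. -/
theorem flux_cocoercive (hg : IsGeneralizedPolynomial a α) (ξ η : 𝕍) :
    a 0 * ‖flux a α ξ - flux a α η‖ ^ 2 ≤ inner ℝ (ξ - η) (flux a α ξ - flux a α η) := by
  have := fluxInv_coercive hg (flux a α ξ) (flux a α η)
  rwa [fluxInv_flux hg, fluxInv_flux hg] at this

theorem continuous_flux (hg : IsGeneralizedPolynomial a α) :
    Continuous (flux a α : 𝕍 → 𝕍) := by
  have ha := hg.coeff_pos 0
  refine (LipschitzWith.of_dist_le_mul (K := ⟨(a 0)⁻¹, by positivity⟩) fun ξ η => ?_).continuous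
  rw [dist_eq_norm, dist_eq_norm]
  have h1 := flux_cocoercive hg ξ η
  have h2 := real_inner_le_norm (ξ - η) (flux a α ξ - flux a α η)
  rcases (norm_nonneg (flux a α ξ - flux a α η)).eq_or_lt with h | h
  · rw [← h]; exact mul_nonneg (NNReal.coe_nonneg _) (norm_nonneg _)
  · have h3 : a 0 * ‖flux a α ξ - flux a α η‖ ≤ ‖ξ - η‖ := by
      refine le_of_mul_le_mul_right ?_ h
      linarith [h1.trans h2, sq ‖flux a α ξ - flux a α η‖]
    change _ ≤ (a 0)⁻¹ * ‖ξ - η‖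
    rwa [le_inv_mul_iff₀ ha]

/-- The map `fluxInv` is C¹ with invertible derivative, because the quadratic form of the derivative
dominates a₀‖v‖². It is also a homeomorphism with inverse `flux`, so the inverse is C¹ everywhere,
the origin included, and K never has to be differentiated. -/
theorem contDiff_flux (hg : IsGeneralizedPolynomial a α) :
    ContDiff ℝ 1 (flux a α : 𝕍 → 𝕍) := by
  let D : 𝕍 → 𝕍 →L[ℝ] 𝕍 := fun y => ∑ j, a j • powMapDeriv (α j) y
  have hD : ∀ y, HasFDerivAt (fluxInv a α : 𝕍 → 𝕍) (D y) y := by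
    intro y
    have : (fluxInv a α : 𝕍 → 𝕍) = fun y => ∑ j, a j • (‖y‖ ^ α j • y) :=
      funext fluxInv_eq_sum
    rw [this]
    exact HasFDerivAt.fun_sum fun j _ =>
      (hasFDerivAt_powMap (hg.exponent_nonneg j) y).const_smul (a j)
  have hDc : Continuous D := continuous_finsetSum _ fun j _ =>
    (continuous_powMapDeriv (hg.exponent_nonneg j)).const_smul (a j)
  have hcd : ContDiff ℝ 1 (fluxInv a α : 𝕍 → 𝕍) := contDiff_one_iff_hasFDerivAt.2 ⟨D, hDc, hD⟩
  have hinj : ∀ y, Function.Injective (D y : 𝕍 →ₗ[ℝ] 𝕍) := by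
    intro y
    rw [injective_iff_map_eq_zero]
    intro v hv
    have hv' : D y v = 0 := hv
    have h : ∀ j ∈ Finset.univ, 0 ≤ inner ℝ ((a j • powMapDeriv (α j) y) v) v := by
      intro j _
      rw [_root_.smul_apply, real_inner_smul_left]
      exact mul_nonneg (hg.coeff_pos j).le (le_trans (by positivity)
        (inner_powMapDeriv_nonneg (hg.exponent_nonneg j) y v))
    have h1 := Finset.single_le_sum h (Finset.mem_univ 0)
    rw [← sum_inner, ← _root_.sum_apply, show (∑ j, a j • powMapDeriv (α j) y) = D y
      from rfl, hv', inner_zero_left, _root_.smul_apply, real_inner_smul_left] at h1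
    have h2 := inner_powMapDeriv_nonneg (hg.exponent_nonneg 0) y v
    rw [hg.exponent_zero, Real.rpow_zero, one_mul] at h2
    rw [hg.exponent_zero] at h1
    have h3 := nonpos_of_mul_nonpos_right h1 (hg.coeff_pos 0)
    have h4 : ‖v‖ ^ 2 = 0 := le_antisymm (h2.trans h3) (sq_nonneg _)
    simpa using h4
  let e : 𝕍 ≃ₜ 𝕍 :=
    { toFun := fluxInv a α
      invFun := flux a α
      left_inv := fun y => fluxInv_injective hg (fluxInv_flux hg _)
      right_inv := fluxInv_flux hg
      continuous_toFun := hcd.continuous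
      continuous_invFun := continuous_flux hg }
  exact e.contDiff_symm (f₀' := fun y =>
    (LinearEquiv.ofInjectiveEndo (D y : 𝕍 →ₗ[ℝ] 𝕍) (hinj y)).toContinuousLinearEquiv)
    (fun y => hD y) hcd

end Flux

end Forchheimer

namespace Forchheimer

/-! ### The divergence theorem for fields tangent to the boundary -/

section Divergence

open MeasureTheory Set Filter Topology Metric

variable {n : ℕ}

local notation "𝕍" => EuclideanSpace ℝ (Fin n)

theorem divergence_congr {V W : 𝕍 → 𝕍} {x : 𝕍} (h : V =ᶠ[𝓝 x] W) :
    divergence V x = divergence W x := by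
  simp only [divergence, h.fderiv_eq]

theorem divergence_of_eventually_zero {V : 𝕍 → 𝕍} {x : 𝕍} (h : ∀ᶠ y in 𝓝 x, V y = 0) :
    divergence V x = 0 := by
  rw [divergence_congr (W := fun _ => 0) h]
  simp [divergence]

theorem divergence_smul {φ : 𝕍 → ℝ} {V : 𝕍 → 𝕍} {x : 𝕍} (hφ : DifferentiableAt ℝ φ x)
    (hV : DifferentiableAt ℝ V x) :
    divergence (fun y => φ y • V y) x = φ x * divergence V x + fderiv ℝ φ x (V x) := by
  have h1 : fderiv ℝ φ x (V x) =
      ∑ i, V x i * fderiv ℝ φ x (EuclideanSpace.single i (1 : ℝ)) := by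
    conv_lhs => rw [← (EuclideanSpace.basisFun (Fin n) ℝ).sum_repr (V x)]
    simp
  rw [h1]
  simp only [divergence, fderiv_fun_smul hφ hV, Finset.mul_sum, ← Finset.sum_add_distrib]
  refine Finset.sum_congr rfl fun i _ => ?_
  simp [mul_comm]

theorem continuousOn_divergence {U : Set 𝕍} (hU : IsOpen U) {V : 𝕍 → 𝕍}
    (hV : ContDiffOn ℝ 1 V U) : ContinuousOn (divergence V) U := by
  have h := hV.continuousOn_fderiv_of_isOpen hU le_rfl
  unfold divergence
  fun_prop

theorem integral_divergence_of_hasCompactSupport {Z : 𝕍 → 𝕍} (hZ : ContDiff ℝ 1 Z)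
    (hc : HasCompactSupport Z) :
    Integrable (divergence Z) ∧ ∫ x, divergence Z x = 0 := by
  have hcont : ∀ v : 𝕍, Continuous fun x => fderiv ℝ Z x v := fun v =>
    (hZ.continuous_fderiv one_ne_zero).clm_apply continuous_const
  have hint : ∀ v : 𝕍, Integrable fun x => fderiv ℝ Z x v := fun v =>
    (hcont v).integrable_of_hasCompactSupport
      ((hc.fderiv (𝕜 := ℝ)).comp_left (g := fun L : 𝕍 →L[ℝ] 𝕍 => L v) rfl)
  have hzero : ∀ v : 𝕍, ∫ x, fderiv ℝ Z x v = 0 := by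
    intro v
    -- Integration by parts against the constant function 1.
    have := integral_smul_fderiv_eq_neg_fderiv_smul_of_integrable (μ := (volume : Measure 𝕍))
      (f := fun _ : 𝕍 => (1 : ℝ)) (g := Z) (v := v) (by simp)
      (by simpa using hint v)
      (by simpa using hZ.continuous.integrable_of_hasCompactSupport hc) (by simp)
      (fun x _ => hZ.differentiable one_ne_zero x)
    simpa using this
  have hi : ∀ i : Fin n, Integrable fun x =>
      (fderiv ℝ Z x (EuclideanSpace.single i (1 : ℝ))) i := fun i =>
    (EuclideanSpace.proj (𝕜 := ℝ) i : 𝕍 →L[ℝ] ℝ).integrable_comp (hint _)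
  refine ⟨integrable_finsetSum _ fun i _ => hi i, ?_⟩
  unfold divergence
  rw [integral_finsetSum _ fun i _ => hi i]
  refine Finset.sum_eq_zero fun i _ => ?_
  have := (EuclideanSpace.proj (𝕜 := ℝ) i : 𝕍 →L[ℝ] ℝ).integral_comp_comm
    (hint (EuclideanSpace.single i (1 : ℝ)))
  rw [hzero] at this
  simpa using this

/-- Extended by zero outside U, the field is C¹ with compact support on the whole space. Nothing is
known about `Z` off U, hence the indicator. -/
theorem setIntegral_divergence_of_compact_subset {U K : Set 𝕍} (hU : IsOpen U)
    (hK : IsCompact K) (hKU : K ⊆ U) {Z : 𝕍 → 𝕍} (hZ : ContDiffOn ℝ 1 Z U)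
    (h0 : ∀ x ∈ U, x ∉ K → Z x = 0) :
    IntegrableOn (divergence Z) U ∧ ∫ x in U, divergence Z x = 0 := by
  set Y : 𝕍 → 𝕍 := U.indicator Z with hY
  have h1 : ∀ x ∈ U, Y =ᶠ[𝓝 x] Z := fun x hx => by
    filter_upwards [hU.mem_nhds hx] with y hy
    exact indicator_of_mem hy _
  have h2 : ∀ x ∉ K, Y x = 0 := fun x hx => by
    by_cases hxU : x ∈ U
    · rw [hY, indicator_of_mem hxU, h0 x hxU hx]
    · exact indicator_of_notMem hxU _
  have h3 : ∀ x ∉ U, ∀ᶠ y in 𝓝 x, Y y = 0 := fun x hx => by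
    filter_upwards [hK.isClosed.isOpen_compl.mem_nhds fun h => hx (hKU h)] with y hy
    exact h2 y hy
  have hYc : ContDiff ℝ 1 Y := by
    rw [contDiff_iff_contDiffAt]
    intro x
    by_cases hx : x ∈ U
    · exact (hZ.contDiffAt (hU.mem_nhds hx)).congr_of_eventuallyEq (h1 x hx)
    · exact (contDiffAt_const (c := (0 : 𝕍))).congr_of_eventuallyEq (h3 x hx)
  have hYs : HasCompactSupport Y := HasCompactSupport.intro hK h2
  obtain ⟨hi, hz⟩ := integral_divergence_of_hasCompactSupport hYc hYs
  have h4 : EqOn (divergence Y) (divergence Z) U := fun x hx => divergence_congr (h1 x hx)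
  refine ⟨hi.integrableOn.congr_fun h4 hU.measurableSet, ?_⟩
  rw [← setIntegral_congr_fun hU.measurableSet h4,
    setIntegral_eq_integral_of_forall_compl_eq_zero fun x hx =>
      divergence_of_eventually_zero (h3 x hx), hz]

/-- A set on which `ρ` takes values in `[-ε, 0)` is thin if `ρ` increases in a fixed direction. -/
theorem volume_layer_le {x₀ e : 𝕍} {R c ε : ℝ} (hc : 0 < c) (hε : 0 < ε) {ρ : 𝕍 → ℝ}
    (hρ : ∀ x ∈ ball x₀ R, DifferentiableAt ℝ ρ x)
    (hρc : ∀ x ∈ ball x₀ R, c ≤ fderiv ℝ ρ x e) {S : Set 𝕍} (hS : MeasurableSet S)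
    (hSR : S ⊆ ball x₀ R) (hSρ : ∀ x ∈ S, -ε ≤ ρ x ∧ ρ x < 0) :
    volume.real S ≤ ε / c * volume.real (ball x₀ (R + ‖e‖)) := by
  have hτ : 0 < ε / c := by positivity
  set τ := ε / c with hτdef
  -- Two points of S on a line parallel to e lie less than τ apart in the parameter, as ρ grows
  -- along it at rate at least c. So the translates S + jτe are disjoint. For j < m the shift is at
  -- most ‖e‖, which keeps them in the larger ball, and m ≥ 1/τ of them are available.
  set m := ⌊1 / τ⌋₊ + 1 with hm
  have key : ∀ x ∈ S, ∀ s : ℝ, τ ≤ s → x + s • e ∉ S := by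
    intro x hx s hs hxs
    have hs0 : 0 < s := hτ.trans_le hs
    have hline : ∀ t ∈ Icc (0 : ℝ) s, x + t • e ∈ ball x₀ R := by
      intro t ht
      have := (convex_ball x₀ R).add_smul_mem (hSR hx) (hSR hxs)
        (t := t / s) ⟨div_nonneg ht.1 hs0.le, (div_le_one hs0).2 ht.2⟩
      rwa [smul_smul, div_mul_cancel₀ _ hs0.ne'] at this
    have hd : ∀ t ∈ Icc (0 : ℝ) s,
        HasDerivAt (fun t : ℝ => ρ (x + t • e)) (fderiv ℝ ρ (x + t • e) e) t := by
      intro t ht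
      have h2 : HasDerivAt (fun s : ℝ => x + s • e) e t := by
        simpa using ((hasDerivAt_id t).smul_const e).const_add x
      exact (hρ _ (hline t ht)).hasFDerivAt.comp_hasDerivAt t h2
    have h3 := (convex_Icc (0 : ℝ) s).mul_sub_le_image_sub_of_le_deriv (C := c)
      (fun t ht => (hd t ht).continuousAt.continuousWithinAt)
      (fun t ht => (hd t (interior_subset ht)).differentiableAt.differentiableWithinAt)
      (fun t ht => by
        rw [(hd t (interior_subset ht)).deriv]
        exact hρc _ (hline t (interior_subset ht)))
      0 (left_mem_Icc.2 hs0.le) s (right_mem_Icc.2 hs0.le) hs0.le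
    simp only [zero_smul, add_zero, sub_zero] at h3
    have h4 : ε ≤ c * s := by
      calc ε = c * τ := by rw [hτdef]; field_simp
        _ ≤ c * s := by gcongr
    linarith [(hSρ x hx).1, (hSρ _ hxs).2]
  let T : ℕ → Set 𝕍 := fun j => (fun x => x + (-((j : ℝ) * τ) • e)) ⁻¹' S
  have hTm : ∀ j, MeasurableSet (T j) := fun j => (measurable_add_const _) hS
  have hTv : ∀ j, volume.real (T j) = volume.real S := fun j => by
    simp only [T, Measure.real, measure_preimage_add_right]
  have hdis : ∀ i j : ℕ, i < j → Disjoint (T i) (T j) := by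
    intro i j hij
    rw [Set.disjoint_left]
    intro x hi hj
    refine key _ hj (((j : ℝ) - i) * τ) ?_ ?_
    · have : (1 : ℝ) ≤ (j : ℝ) - i := by
        have : (i : ℝ) + 1 ≤ j := by exact_mod_cast hij
        linarith
      nlinarith
    · have : x + -((j : ℝ) * τ) • e + (((j : ℝ) - i) * τ) • e = x + -((i : ℝ) * τ) • e := by
        module
      rw [this]; exact hi
  have hpd : ((Finset.range m : Finset ℕ) : Set ℕ).PairwiseDisjoint T := by
    intro i _ j _ hij
    rcases lt_or_gt_of_ne hij with h | h
    · exact hdis i j h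
    · exact (hdis j i h).symm
  have hsub : (⋃ j ∈ Finset.range m, T j) ⊆ ball x₀ (R + ‖e‖) := by
    intro x hx
    simp only [mem_iUnion, Finset.mem_range] at hx
    obtain ⟨j, hj, hx⟩ := hx
    have h1 : x + (-((j : ℝ) * τ) • e) ∈ ball x₀ R := hSR hx
    rw [mem_ball_iff_norm] at h1 ⊢
    have h2 : (j : ℝ) * τ ≤ 1 := by
      have : (j : ℝ) ≤ 1 / τ := by
        refine le_trans ?_ (Nat.floor_le (by positivity))
        exact_mod_cast Nat.lt_succ_iff.1 hj
      calc (j : ℝ) * τ ≤ 1 / τ * τ := by gcongr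
        _ = 1 := by field_simp
    have h3 : x - x₀ = (x + (-((j : ℝ) * τ) • e) - x₀) + ((j : ℝ) * τ) • e := by module
    rw [h3]
    refine (norm_add_le _ _).trans_lt ?_
    rw [norm_smul, Real.norm_of_nonneg (by positivity)]
    nlinarith [norm_nonneg e]
  have hsum : (m : ℝ) * volume.real S ≤ volume.real (ball x₀ (R + ‖e‖)) := by
    have h1 := measureReal_mono (μ := (volume : Measure 𝕍)) hsub measure_ball_lt_top.ne
    rw [measureReal_biUnion_finset hpd (fun j _ => hTm j) (fun j _ => by
      rw [measure_preimage_add_right]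
      exact (measure_mono hSR).trans_lt measure_ball_lt_top |>.ne)] at h1
    simpa [hTv] using h1
  have hm1 : 1 / τ ≤ m := by
    rw [hm]; push_cast; exact (Nat.lt_floor_add_one _).le
  calc volume.real S = τ * (1 / τ * volume.real S) := by field_simp
    _ ≤ τ * (m * volume.real S) := by gcongr
    _ ≤ _ := by gcongr

/-- The transition is constant outside [0, 1], so its derivative is bounded by compactness. -/
theorem exists_norm_deriv_smoothTransition_le :
    ∃ C, 0 ≤ C ∧ ∀ s, |deriv Real.smoothTransition s| ≤ C := by
  have hc : Continuous (deriv Real.smoothTransition) :=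
    (Real.smoothTransition.contDiff (n := 1)).continuous_deriv (by norm_num)
  obtain ⟨C, hC⟩ := (isCompact_Icc (a := (0 : ℝ)) (b := 1)).exists_bound_of_continuousOn
    hc.continuousOn
  have hC0 : 0 ≤ C := (norm_nonneg _).trans (hC 0 (by simp))
  refine ⟨C, hC0, fun s => ?_⟩
  by_cases h0 : s < 0
  · have : Real.smoothTransition =ᶠ[𝓝 s] fun _ => 0 := by
      filter_upwards [gt_mem_nhds h0] with y hy
      exact Real.smoothTransition.zero_of_nonpos hy.le
    rw [this.deriv_eq]; simpa using hC0
  by_cases h1 : 1 < s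
  · have : Real.smoothTransition =ᶠ[𝓝 s] fun _ => 1 := by
      filter_upwards [lt_mem_nhds h1] with y hy
      exact Real.smoothTransition.one_of_one_le hy.le
    rw [this.deriv_eq]; simpa using hC0
  · exact hC s ⟨not_lt.1 h0, not_lt.1 h1⟩

end Divergence

end Forchheimer

namespace Forchheimer

/-! ### Vanishing normal component: the local divergence theorem and its globalization. -/

section DivergenceTheorem

open MeasureTheory Set Filter Topology Metric

variable {n : ℕ}

local notation "𝕍" => EuclideanSpace ℝ (Fin n)

theorem inner_gradient_eq_fderiv (f : 𝕍 → ℝ) (x v : 𝕍) :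
    inner ℝ (gradient f x) v = fderiv ℝ f x v := by
  simp [gradient, InnerProductSpace.toDual_symm_apply]

/-- A vector field of class `C¹` in `U`, continuous up to the boundary and tangent to it, with
integrable divergence. -/
structure IsTangentField (U : Set 𝕍) (V : 𝕍 → 𝕍) : Prop where
  contDiffOn : ContDiffOn ℝ 1 V U
  continuousOn : ContinuousOn V (closure U)
  normal : ∀ x ∈ frontier U, inner ℝ (V x) (outwardNormal U x) = 0
  integrableOn : IntegrableOn (divergence V) U

/-- The divergence theorem for tangent fields supported in the ball of radius `r` about `x₀`. -/
def LocalDivergenceTheorem (U : Set 𝕍) (x₀ : 𝕍) (r : ℝ) : Prop :=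
  ∀ W : 𝕍 → 𝕍, IsTangentField U W → (∀ x ∈ U, x ∉ closedBall x₀ r → W x = 0) →
    ∫ x in U, divergence W x = 0

theorem exists_localDivergenceTheorem_of_mem {U : Set 𝕍} (hU : IsOpen U) {x₀ : 𝕍} (hx : x₀ ∈ U) :
    ∃ r > 0, LocalDivergenceTheorem U x₀ r := by
  obtain ⟨r, hr, hrU⟩ := nhds_basis_closedBall.mem_iff.1 (hU.mem_nhds hx)
  exact ⟨r, hr, fun W hW h0 => (setIntegral_divergence_of_compact_subset hU
    (isCompact_closedBall x₀ r) hrU hW.contDiffOn h0).2⟩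

/-- A local defining function together with a ball where it increases in a fixed direction. -/
theorem exists_ball_localDefiningFunction {U : Set 𝕍} {x₀ : 𝕍}
    (h : ∃ ρ, IsLocalDefiningFunction U x₀ ρ) :
    ∃ (ρ : 𝕍 → ℝ) (R c : ℝ) (e : 𝕍), 0 < R ∧ 0 < c ∧
      (∀ x ∈ ball x₀ R, IsLocalDefiningFunction U x ρ ∧ ContDiffAt ℝ 1 ρ x ∧ (x ∈ U ↔ ρ x < 0) ∧
        c ≤ fderiv ℝ ρ x e) := by
  obtain ⟨ρ, hρ⟩ := h
  set e := gradient ρ x₀ with he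
  have hpos : 0 < ‖e‖ ^ 2 := by have := norm_pos_iff.2 hρ.gradient_ne_zero; positivity
  have h1 : ContDiffAt ℝ 1 ρ x₀ := hρ.contDiffAt.of_le (by norm_num)
  have h2 : ContinuousAt (fun x => fderiv ℝ ρ x e) x₀ :=
    (h1.continuousAt_fderiv one_ne_zero).clm_apply continuousAt_const
  have h3 : ∀ᶠ x in 𝓝 x₀, ‖e‖ ^ 2 / 2 < fderiv ℝ ρ x e := by
    refine h2.eventually (lt_mem_nhds ?_)
    change ‖e‖ ^ 2 / 2 < fderiv ℝ ρ x₀ e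
    rw [← inner_gradient_eq_fderiv, ← he, real_inner_self_eq_norm_sq]
    linarith
  have h4 := hρ.contDiffAt.eventually (by simp)
  obtain ⟨R, hR, hball⟩ := Metric.eventually_nhds_iff_ball.1
    ((h3.and h4).and (hρ.mem_iff.and hρ.mem_iff.eventually_nhds))
  refine ⟨ρ, R, ‖e‖ ^ 2 / 2, e, hR, by positivity, fun x hx => ?_⟩
  obtain ⟨⟨g1, g2⟩, g3, g4⟩ := hball x hx
  refine ⟨⟨g2, fun h => ?_, g4⟩, g2.of_le (by norm_num), g3, g1.le⟩
  rw [← inner_gradient_eq_fderiv, h, inner_zero_left] at g1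
  linarith

/-- The boundary is not flattened. Multiplying W by a cutoff φ of ρ/ε that vanishes near ∂U gives a
field with zero integral of divergence. The error ∫∇φ·W lives in a layer of volume O(ε), where
|∇φ·W| ≤ (C₁/ε)|∇ρ·W|, and ∇ρ·W is small there because W is tangent to the boundary and continuous
up to it. -/
theorem exists_localDivergenceTheorem_of_mem_frontier {U : Set 𝕍} (hU : IsOpen U) {x₀ : 𝕍}
    (hx₀ : ∃ ρ, IsLocalDefiningFunction U x₀ ρ) :
    ∃ r > 0, LocalDivergenceTheorem U x₀ r := by
  obtain ⟨ρ, R, c, e, hR, hc, hball⟩ := exists_ball_localDefiningFunction hx₀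
  obtain ⟨C₁, hC₁0, hC₁⟩ := exists_norm_deriv_smoothTransition_le
  refine ⟨R / 2, by positivity, fun W hW hW0 => ?_⟩
  set r := R / 2 with hr
  have hrR : closedBall x₀ r ⊆ ball x₀ R := closedBall_subset_ball (by linarith)
  have hρc : ContinuousOn ρ (ball x₀ R) := fun x hx =>
    (hball x hx).2.1.continuousAt.continuousWithinAt
  have hDρ : ContinuousOn (fderiv ℝ ρ) (ball x₀ R) := fun x hx =>
    ((hball x hx).2.1.continuousAt_fderiv one_ne_zero).continuousWithinAt
  set T : Set 𝕍 := closure U ∩ closedBall x₀ r with hT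
  have hTc : IsCompact T := (isCompact_closedBall x₀ r).inter_left isClosed_closure
  have hTR : T ⊆ ball x₀ R := inter_subset_right.trans hrR
  set C₂ := volume.real (ball x₀ (R + ‖e‖)) with hC₂
  have hC₂0 : 0 ≤ C₂ := measureReal_nonneg
  have hω : ContinuousOn (fun x => fderiv ℝ ρ x (W x)) T :=
    (hDρ.mono hTR).clm_apply (hW.continuousOn.mono inter_subset_left)
  -- the normal component is small in a thin layer
  have hlayer : ∀ δ > 0, ∃ ε₀ > 0, ∀ x ∈ T, -(2 * ε₀) ≤ ρ x → |fderiv ℝ ρ x (W x)| ≤ δ := by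
    intro δ hδ
    set S : Set 𝕍 := T ∩ (fun x => |fderiv ℝ ρ x (W x)|) ⁻¹' Ici δ with hS
    have hSc : IsCompact S := hTc.of_isClosed_subset
      (hω.abs.preimage_isClosed_of_isClosed hTc.isClosed isClosed_Ici) inter_subset_left
    rcases S.eq_empty_or_nonempty with hSe | hSn
    · refine ⟨1, one_pos, fun x hx _ => ?_⟩
      by_contra! hlt
      exact (eq_empty_iff_forall_notMem.1 hSe x) ⟨hx, hlt.le⟩
    -- The compact set S where the normal component is at least δ misses the boundary, so the
    -- maximum ρ(z) of ρ on S is negative. With ε₀ = -ρ(z)/4, the condition ρ(x) ≥ -2ε₀ = ρ(z)/2 >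
    -- ρ(z) keeps x out of S.
    · obtain ⟨z, hz, hzmax⟩ := hSc.exists_isMaxOn hSn (hρc.mono (inter_subset_left.trans hTR))
      have hzU : z ∈ U := by
        by_contra hzU
        have hzf : z ∈ frontier U := by rw [hU.frontier_eq]; exact ⟨hz.1.1, hzU⟩
        have h1 := hW.normal z hzf
        rw [outwardNormal_eq hU hzf (hball z (hTR hz.1)).1, real_inner_smul_right,
          real_inner_comm, inner_gradient_eq_fderiv] at h1
        have h2 : ‖gradient ρ z‖⁻¹ ≠ 0 :=
          inv_ne_zero (norm_ne_zero_iff.2 (hball z (hTR hz.1)).1.gradient_ne_zero)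
        have h3 := (mul_eq_zero.1 h1).resolve_left h2
        have h4 : δ ≤ |fderiv ℝ ρ z (W z)| := hz.2
        rw [h3, abs_zero] at h4
        linarith
      have hneg : ρ z < 0 := (hball z (hTR hz.1)).2.2.1.1 hzU
      refine ⟨-ρ z / 4, by linarith, fun x hx hρx => ?_⟩
      by_contra! hlt
      have := hzmax (show x ∈ S from ⟨hx, hlt.le⟩)
      simp only [mem_ofPred_eq] at this
      linarith
  -- The shift by 1 makes φ vanish for ρ ≥ -ε, so that φW has compact support in U; φ = 1 for ρ ≤
  -- -2ε.
  let φ : ℝ → 𝕍 → ℝ := fun ε x => Real.smoothTransition (-ρ x / ε - 1)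
  have hφ : ∀ ε, ∀ x ∈ ball x₀ R, ContDiffAt ℝ 1 (φ ε) x := fun ε x hx =>
    (Real.smoothTransition.contDiff (n := 1)).contDiffAt.comp x
      (((hball x hx).2.1.neg.div_const ε).sub contDiffAt_const)
  have hWnear : ∀ x ∈ U, x ∉ closedBall x₀ r → ∀ᶠ y in 𝓝 x, W y = 0 := by
    intro x hx hxr
    filter_upwards [hU.mem_nhds hx, isClosed_closedBall.isOpen_compl.mem_nhds hxr] with y hy hy'
    exact hW0 y hy hy'
  have hdφ : ∀ ε > 0, ∀ x ∈ ball x₀ R, ∃ s, |s| ≤ C₁ / ε ∧ (2 * ε < -ρ x → s = 0) ∧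
      ∀ v, fderiv ℝ (φ ε) x v = s * fderiv ℝ ρ x v := by
    intro ε hε x hx
    have hd : DifferentiableAt ℝ ρ x := (hball x hx).2.1.differentiableAt one_ne_zero
    have h1 : HasFDerivAt (fun y => -ρ y / ε - 1) (-(ε⁻¹) • fderiv ℝ ρ x) x := by
      have := (hd.hasFDerivAt.const_mul (-(ε⁻¹))).sub_const 1
      refine this.congr_of_eventuallyEq (Eventually.of_forall fun y => ?_)
      simp only
      ring
    have h2 := ((Real.smoothTransition.contDiff (n := 1)).differentiable (by norm_num)
      (-ρ x / ε - 1)).hasDerivAt.comp_hasFDerivAt x h1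
    refine ⟨deriv Real.smoothTransition (-ρ x / ε - 1) * -(ε⁻¹), ?_, fun h => ?_, fun v => ?_⟩
    · rw [abs_mul, abs_neg, abs_inv, abs_of_pos hε, div_eq_mul_inv]
      exact mul_le_mul_of_nonneg_right (hC₁ _) (inv_nonneg.2 hε.le)
    · have h3 : 1 < -ρ x / ε - 1 := by
        rw [lt_sub_iff_add_lt, lt_div_iff₀ hε]; linarith
      have : Real.smoothTransition =ᶠ[𝓝 (-ρ x / ε - 1)] fun _ => 1 := by
        filter_upwards [lt_mem_nhds h3] with y hy
        exact Real.smoothTransition.one_of_one_le hy.le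
      rw [this.deriv_eq]; simp
    · rw [show φ ε = Real.smoothTransition ∘ fun y => -ρ y / ε - 1 from rfl, h2.fderiv]
      simp [mul_assoc]
  have hφ0 : ∀ ε x, 0 ≤ φ ε x := fun ε x => Real.smoothTransition.nonneg _
  have hφ1 : ∀ ε x, φ ε x ≤ 1 := fun ε x => Real.smoothTransition.le_one _
  -- the estimate for a fixed width of the layer
  have hest : ∀ δ > 0, ∃ ε₀ > 0, ∀ ε, 0 < ε → ε ≤ ε₀ →
      |∫ x in U, φ ε x * divergence W x| ≤ 2 * C₁ * C₂ / c * δ := by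
    intro δ hδ
    obtain ⟨ε₀, hε₀, hsmall⟩ := hlayer δ hδ
    refine ⟨ε₀, hε₀, fun ε hε hεε => ?_⟩
    have hKc : IsCompact (T ∩ ρ ⁻¹' Iic (-ε)) := hTc.of_isClosed_subset
      ((hρc.mono hTR).preimage_isClosed_of_isClosed hTc.isClosed isClosed_Iic) inter_subset_left
    have hKU : T ∩ ρ ⁻¹' Iic (-ε) ⊆ U := fun x hx =>
      (hball x (hTR hx.1)).2.2.1.2 (lt_of_le_of_lt hx.2 (by linarith))
    have hZ : ContDiffOn ℝ 1 (fun x => φ ε x • W x) U := by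
      intro x hx
      refine ContDiffAt.contDiffWithinAt ?_
      by_cases hxr : x ∈ closedBall x₀ r
      · exact (hφ ε x (hrR hxr)).smul (hW.contDiffOn.contDiffAt (hU.mem_nhds hx))
      · refine (contDiffAt_const (c := (0 : 𝕍))).congr_of_eventuallyEq ?_
        filter_upwards [hWnear x hx hxr] with y hy
        simp [hy]
    have hZ0 : ∀ x ∈ U, x ∉ T ∩ ρ ⁻¹' Iic (-ε) → φ ε x • W x = 0 := by
      intro x hx hxK
      by_cases hxr : x ∈ closedBall x₀ r
      · have h1 : ¬ ρ x ≤ -ε := fun h => hxK ⟨⟨subset_closure hx, hxr⟩, h⟩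
        have h2 : φ ε x = 0 := Real.smoothTransition.zero_of_nonpos (by
          rw [sub_nonpos, div_le_one hε]; linarith)
        rw [h2, zero_smul]
      · rw [hW0 x hx hxr, smul_zero]
    obtain ⟨hZi, hZz⟩ := setIntegral_divergence_of_compact_subset hU hKc hKU hZ hZ0
    -- Within the ball of radius r, the gradient of φ vanishes outside this layer; outside that ball
    -- W itself vanishes.
    set S : Set 𝕍 := (U ∩ closedBall x₀ r) ∩ ρ ⁻¹' Ici (-(2 * ε)) with hS
    have hSR : S ⊆ ball x₀ R := inter_subset_left.trans (inter_subset_right.trans hrR)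
    have hSm : MeasurableSet S := by
      have h1 : S = (U ∩ closedBall x₀ r) ∩ (T ∩ ρ ⁻¹' Ici (-(2 * ε))) := by
        ext x
        exact ⟨fun h => ⟨h.1, ⟨subset_closure h.1.1, h.1.2⟩, h.2⟩, fun h => ⟨h.1, h.2.2⟩⟩
      rw [h1]
      exact (hU.measurableSet.inter isClosed_closedBall.measurableSet).inter
        ((hρc.mono hTR).preimage_isClosed_of_isClosed hTc.isClosed isClosed_Ici).measurableSet
    have hSvol := volume_layer_le (ε := 2 * ε) hc (by positivity)
      (fun x hx => (hball x hx).2.1.differentiableAt one_ne_zero)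
      (fun x hx => (hball x hx).2.2.2) hSm hSR
      (fun x hx => ⟨hx.2, (hball x (hSR hx)).2.2.1.1 hx.1.1⟩)
    have hφW : IntegrableOn (fun x => φ ε x * divergence W x) U := by
      refine Integrable.mono hW.integrableOn ?_ (Eventually.of_forall fun x => ?_)
      · refine ContinuousOn.aestronglyMeasurable (fun x hx => ?_) hU.measurableSet
        refine ContinuousAt.continuousWithinAt ?_
        by_cases hxr : x ∈ closedBall x₀ r
        · exact (hφ ε x (hrR hxr)).continuousAt.mul
            ((continuousOn_divergence hU hW.contDiffOn).continuousAt (hU.mem_nhds hx))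
        · refine (continuousAt_const (y := (0 : ℝ))).congr ?_
          filter_upwards [(hWnear x hx hxr).eventually_nhds] with y hy
          rw [divergence_of_eventually_zero hy, mul_zero]
      · rw [norm_mul, Real.norm_of_nonneg (hφ0 ε x)]
        exact mul_le_of_le_one_left (norm_nonneg _) (hφ1 ε x)
    have hpt : ∀ x ∈ U, ‖divergence (fun y => φ ε y • W y) x - φ ε x * divergence W x‖ ≤
        S.indicator (fun _ => C₁ / ε * δ) x := by
      intro x hx
      by_cases hxr : x ∈ closedBall x₀ r
      · obtain ⟨s, hs1, hs2, hs3⟩ := hdφ ε hε x (hrR hxr)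
        rw [divergence_smul ((hφ ε x (hrR hxr)).differentiableAt one_ne_zero)
          ((hW.contDiffOn.contDiffAt (hU.mem_nhds hx)).differentiableAt one_ne_zero),
          add_sub_cancel_left, hs3, norm_mul]
        by_cases hxS : -(2 * ε) ≤ ρ x
        · rw [indicator_of_mem (show x ∈ S from ⟨⟨hx, hxr⟩, hxS⟩)]
          exact mul_le_mul hs1 (hsmall x ⟨subset_closure hx, hxr⟩ (by linarith)) (norm_nonneg _)
            (by positivity)
        · rw [hs2 (by linarith), norm_zero, zero_mul]
          exact indicator_nonneg (fun _ _ => by positivity) _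
      · rw [divergence_of_eventually_zero (hWnear x hx hxr), divergence_of_eventually_zero
          (by filter_upwards [hWnear x hx hxr] with y hy; simp [hy])]
        simp only [mul_zero, sub_zero, norm_zero]
        exact indicator_nonneg (fun _ _ => by positivity) _
    have hSfin : volume S ≠ ⊤ := ((measure_mono hSR).trans_lt measure_ball_lt_top).ne
    have h1 : ‖∫ x in U, (divergence (fun y => φ ε y • W y) x - φ ε x * divergence W x)‖ ≤
        ∫ x in U, S.indicator (fun _ => C₁ / ε * δ) x := by
      refine norm_integral_le_of_norm_le ?_ ((ae_restrict_iff' hU.measurableSet).2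
        (Eventually.of_forall hpt))
      exact ((integrable_indicator_iff hSm).2 (integrableOn_const hSfin)).integrableOn
    rw [integral_sub hZi hφW, hZz, zero_sub, norm_neg, Real.norm_eq_abs,
      setIntegral_indicator hSm, setIntegral_const, smul_eq_mul] at h1
    refine h1.trans ?_
    have h2 : volume.real (U ∩ S) ≤ 2 * ε / c * C₂ :=
      (measureReal_mono inter_subset_right hSfin).trans hSvol
    calc volume.real (U ∩ S) * (C₁ / ε * δ) ≤ 2 * ε / c * C₂ * (C₁ / ε * δ) := by gcongr
      _ = 2 * C₁ * C₂ / c * δ := by field_simp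
  have hlim : Tendsto (fun m : ℕ => ∫ x in U, φ (1 / ((m : ℝ) + 1)) x * divergence W x) atTop
      (𝓝 (∫ x in U, divergence W x)) := by
    refine tendsto_integral_filter_of_dominated_convergence (fun x => ‖divergence W x‖) ?_ ?_
      hW.integrableOn.norm ?_
    · refine Eventually.of_forall fun m => ContinuousOn.aestronglyMeasurable (fun x hx => ?_)
        hU.measurableSet
      refine ContinuousAt.continuousWithinAt ?_
      by_cases hxr : x ∈ closedBall x₀ r
      · exact (hφ _ x (hrR hxr)).continuousAt.mul
          ((continuousOn_divergence hU hW.contDiffOn).continuousAt (hU.mem_nhds hx))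
      · refine (continuousAt_const (y := (0 : ℝ))).congr ?_
        filter_upwards [(hWnear x hx hxr).eventually_nhds] with y hy
        rw [divergence_of_eventually_zero hy, mul_zero]
    · refine Eventually.of_forall fun m => Eventually.of_forall fun x => ?_
      rw [norm_mul, Real.norm_of_nonneg (hφ0 _ x)]
      exact mul_le_of_le_one_left (norm_nonneg _) (hφ1 _ x)
    · refine (ae_restrict_iff' hU.measurableSet).2 (Eventually.of_forall fun x hx => ?_)
      by_cases hxr : x ∈ closedBall x₀ r
      · have hneg : ρ x < 0 := (hball x (hrR hxr)).2.2.1.1 hx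
        refine tendsto_const_nhds.congr' ?_
        -- For m ≥ 2/(-ρ(x)) the width ε = 1/(m+1) satisfies 2ε ≤ -ρ(x), so the cutoff has already
        -- reached 1 at x.
        have h1 := (tendsto_natCast_atTop_atTop (R := ℝ)).eventually_ge_atTop (2 / -ρ x)
        filter_upwards [h1] with m hm
        have h2 : φ (1 / ((m : ℝ) + 1)) x = 1 := Real.smoothTransition.one_of_one_le (by
          rw [div_le_iff₀ (by linarith)] at hm
          rw [div_div_eq_mul_div, div_one]
          nlinarith)
        rw [h2, one_mul]
      · simp [divergence_of_eventually_zero (hWnear x hx hxr)]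
  have hfin : ∀ δ > 0, |∫ x in U, divergence W x| ≤ 2 * C₁ * C₂ / c * δ := by
    intro δ hδ
    obtain ⟨ε₀, hε₀, h⟩ := hest δ hδ
    refine le_of_tendsto hlim.abs ?_
    have h1 := (tendsto_one_div_add_atTop_nhds_zero_nat (𝕜 := ℝ)).eventually_le_const hε₀
    filter_upwards [h1] with m hm
    exact h _ (by positivity) hm
  rw [← abs_eq_zero]
  refine le_antisymm (le_of_forall_pos_le_add fun η hη => ?_) (abs_nonneg _)
  have h0 : 0 ≤ 2 * C₁ * C₂ / c := by positivity
  refine (hfin (η / (2 * C₁ * C₂ / c + 1)) (by positivity)).trans ?_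
  rw [zero_add, mul_div_assoc', div_le_iff₀ (by positivity)]
  nlinarith

/-- Needed to localize a tangent field by a partition of unity: a scalar factor does not affect
tangency. -/
theorem IsTangentField.smul {U : Set 𝕍} (hU : IsOpen U) (hb : Bornology.IsBounded U)
    {V : 𝕍 → 𝕍} (hV : IsTangentField U V) {f : 𝕍 → ℝ} (hf : ContDiff ℝ 1 f)
    (hf1 : ∀ x, |f x| ≤ 1) :
    IsTangentField U fun x => f x • V x where
  contDiffOn := hf.contDiffOn.smul hV.contDiffOn
  continuousOn := hf.continuous.continuousOn.smul hV.continuousOn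
  normal := fun x hx => by rw [real_inner_smul_left, hV.normal x hx, mul_zero]
  integrableOn := by
    have h1 : EqOn (fun x => f x * divergence V x + fderiv ℝ f x (V x))
        (divergence fun x => f x • V x) U := fun x hx =>
      (divergence_smul (hf.differentiable one_ne_zero x)
        ((hV.contDiffOn.contDiffAt (hU.mem_nhds hx)).differentiableAt one_ne_zero)).symm
    refine IntegrableOn.congr_fun ?_ h1 hU.measurableSet
    refine Integrable.add ?_ ?_
    · exact hV.integrableOn.bdd_mul hf.continuous.aestronglyMeasurable
        (Eventually.of_forall hf1)
    · have hc : ContinuousOn (fun x => fderiv ℝ f x (V x)) (closure U) :=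
        (hf.continuous_fderiv one_ne_zero).continuousOn.clm_apply hV.continuousOn
      exact (hc.integrableOn_compact hb.isCompact_closure).mono_set subset_closure

open scoped Manifold in
/-- The divergence theorem for fields tangent to the boundary of a bounded `C²` domain. -/
theorem IsTangentField.integral_divergence {U : Set 𝕍} (hU : IsOpen U)
    (hb : Bornology.IsBounded U) (hC2 : ∀ x ∈ frontier U, ∃ ρ, IsLocalDefiningFunction U x ρ)
    {V : 𝕍 → 𝕍} (hV : IsTangentField U V) : ∫ x in U, divergence V x = 0 := by
  have hex : ∀ x, ∃ r > 0, x ∈ closure U → LocalDivergenceTheorem U x r := by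
    intro x
    by_cases hx : x ∈ U
    · obtain ⟨r, hr, h⟩ := exists_localDivergenceTheorem_of_mem hU hx
      exact ⟨r, hr, fun _ => h⟩
    by_cases hxc : x ∈ closure U
    · obtain ⟨r, hr, h⟩ := exists_localDivergenceTheorem_of_mem_frontier hU
        (hC2 x (by rw [hU.frontier_eq]; exact ⟨hxc, hx⟩))
      exact ⟨r, hr, fun _ => h⟩
    · exact ⟨1, one_pos, fun h => absurd h hxc⟩
  choose r hr hloc using hex
  obtain ⟨t, htU, hcover⟩ := hb.isCompact_closure.elim_nhds_subcover (fun x => ball x (r x))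
    fun x _ => ball_mem_nhds x (hr x)
  obtain ⟨f, hf⟩ := SmoothPartitionOfUnity.exists_isSubordinate 𝓘(ℝ, 𝕍) (isClosed_closure (s := U))
    (fun i : t => ball (i : 𝕍) (r i)) (fun i => isOpen_ball) (by
      intro x hx
      simpa using hcover hx)
  have hfc : ∀ i, ContDiff ℝ 1 (f i) := fun i =>
    (f i).contMDiff.contDiff.of_le (by exact_mod_cast le_top)
  have hf1 : ∀ i x, |f i x| ≤ 1 := fun i x => by
    rw [abs_of_nonneg (f.nonneg i x)]; exact f.le_one i x
  have hT : ∀ i, IsTangentField U fun x => f i x • V x := fun i => hV.smul hU hb (hfc i) (hf1 i)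
  have hz : ∀ i, ∫ x in U, divergence (fun x => f i x • V x) x = 0 := by
    intro i
    refine hloc i (htU i i.2) _ (hT i) fun x _ hx => ?_
    have : f i x = 0 := by
      by_contra h
      exact hx (ball_subset_closedBall (hf i (subset_tsupport _ h)))
    rw [this, zero_smul]
  have hsum : ∀ x ∈ closure U, ∑ i, f i x = 1 := fun x hx => by
    rw [← finsum_eq_sum_of_fintype]; exact f.sum_eq_one hx
  have hdiv : ∀ x ∈ U, divergence V x = ∑ i, divergence (fun x => f i x • V x) x := by
    intro x hx
    have hVd := (hV.contDiffOn.contDiffAt (hU.mem_nhds hx)).differentiableAt one_ne_zero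
    -- The partition sums to 1 on a whole neighbourhood of a point of U, so the gradient terms of
    -- the product rule cancel.
    have h1 : ∑ i, fderiv ℝ (f i) x = 0 := by
      rw [← fderiv_fun_sum fun i _ => (hfc i).differentiable one_ne_zero x]
      have : (fun y => ∑ i, f i y) =ᶠ[𝓝 x] fun _ => 1 := by
        filter_upwards [hU.mem_nhds hx] with y hy
        exact hsum y (subset_closure hy)
      rw [this.fderiv_eq]; simp
    simp only [fun i => divergence_smul ((hfc i).differentiable one_ne_zero x) hVd,
      Finset.sum_add_distrib, ← Finset.sum_mul, hsum x (subset_closure hx), one_mul,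
      ← _root_.sum_apply, h1]
    simp
  rw [setIntegral_congr_fun hU.measurableSet hdiv, integral_finsetSum _ fun i _ =>
    (hT i).integrableOn]
  exact Finset.sum_eq_zero fun i _ => hz i

end DivergenceTheorem

end Forchheimer

namespace Forchheimer

/-! ### A convex function of growth `β` vanishing to first order on `[-M, M]` -/

section Truncation

open Set

theorem hasDerivAt_max_zero_pow (m : ℕ) (x : ℝ) :
    HasDerivAt (fun x : ℝ => max x 0 ^ (m + 2)) ((m + 2) * max x 0 ^ (m + 1)) x := by
  have hp : ∀ x : ℝ, HasDerivAt (fun x : ℝ => x ^ (m + 2)) ((m + 2) * x ^ (m + 1)) x := fun x => by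
    simpa using hasDerivAt_pow (m + 2) x
  have h1 : ∀ x : ℝ, 0 ≤ x → HasDerivWithinAt (fun x : ℝ => max x 0 ^ (m + 2))
      ((m + 2) * max x 0 ^ (m + 1)) (Ici 0) x := fun x hx => by
    rw [max_eq_left hx]
    refine (hp x).hasDerivWithinAt.congr (fun y hy => ?_) ?_
    · rw [max_eq_left (show (0 : ℝ) ≤ y from hy)]
    · rw [max_eq_left hx]
  have h2 : ∀ x : ℝ, x ≤ 0 → HasDerivWithinAt (fun x : ℝ => max x 0 ^ (m + 2))
      ((m + 2) * max x 0 ^ (m + 1)) (Iic 0) x := fun x hx => by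
    rw [max_eq_right hx, zero_pow (Nat.succ_ne_zero m), mul_zero]
    refine (hasDerivWithinAt_const x _ 0).congr (fun y hy => ?_) ?_
    · rw [max_eq_right (show y ≤ (0 : ℝ) from hy)]; simp
    · rw [max_eq_right hx]; simp
  rcases lt_trichotomy x 0 with h | rfl | h
  · exact (h2 x h.le).hasDerivAt (Iic_mem_nhds h)
  · have := (h2 0 le_rfl).union (h1 0 le_rfl)
    rwa [Iic_union_Ici, hasDerivWithinAt_univ] at this
  · exact (h1 x h.le).hasDerivAt (Ici_mem_nhds h)

/-- The properties of the function `Φ` tested with: it grows like `|s| ^ β`, its derivative `Φ'`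
vanishes on `[-M, M]`, and `Φ'`, `Φ''` are controlled by powers of `Φ`. -/
structure IsTruncation (M β c : ℝ) (Φ Φ' Φ'' : ℝ → ℝ) : Prop where
  hasDerivAt : ∀ s, HasDerivAt Φ (Φ' s) s
  hasDerivAt' : ∀ s, HasDerivAt Φ' (Φ'' s) s
  continuous : Continuous Φ''
  one_le : ∀ s, 1 ≤ Φ s
  nonneg : ∀ s, 0 ≤ Φ'' s
  abs_le : ∀ s, |Φ' s| ≤ c * Φ s ^ ((β - 1) / β)
  le : ∀ s, Φ'' s ≤ c * Φ s ^ ((β - 2) / β)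
  eq_zero : ∀ s, |s| ≤ M → Φ' s = 0
  growth : ∀ s, |s| ^ β ≤ c * Φ s

/-- The obvious candidate (|s| - M)₊^β is not C² for β = 2. Instead take X = 1 + (|s| - M)₊⁴, which
is C² and at least 1, so that its real power Φ = X^(β/4) is again C² and has growth β. -/
theorem exists_isTruncation {M β : ℝ} (hM : 0 ≤ M) (hβ : 2 ≤ β) :
    ∃ (c : ℝ) (Φ Φ' Φ'' : ℝ → ℝ), 0 ≤ c ∧ IsTruncation M β c Φ Φ' Φ'' := by
  -- P and N are the excesses of s above M and below -M. As PN = 0, sums of powers of P and N are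
  -- powers of w = P + N = (|s| - M)₊.
  let P : ℝ → ℝ := fun s => max (s - M) 0
  let N : ℝ → ℝ := fun s => max (-s - M) 0
  have hP0 : ∀ s, 0 ≤ P s := fun s => le_max_right _ _
  have hN0 : ∀ s, 0 ≤ N s := fun s => le_max_right _ _
  have hPN : ∀ s, P s * N s = 0 := fun s => by
    rcases le_total s 0 with h | h
    · simp only [P, max_eq_right (show s - M ≤ 0 by linarith), zero_mul]
    · simp only [N, max_eq_right (show -s - M ≤ 0 by linarith), mul_zero]
  have hPc : Continuous P := by fun_prop
  have hNc : Continuous N := by fun_prop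
  have hPd : ∀ (m : ℕ) s, HasDerivAt (fun s => P s ^ (m + 2)) ((m + 2) * P s ^ (m + 1)) s :=
    fun m s => by
      exact ((hasDerivAt_max_zero_pow m (s - M)).comp s
        ((hasDerivAt_id s).sub_const M)).congr_deriv (mul_one _)
  have hNd : ∀ (m : ℕ) s, HasDerivAt (fun s => N s ^ (m + 2)) (-((m + 2) * N s ^ (m + 1))) s :=
    fun m s => by
      exact ((hasDerivAt_max_zero_pow m (-s - M)).comp s
        ((hasDerivAt_neg s).sub_const M)).congr_deriv (mul_neg_one _)
  let w : ℝ → ℝ := fun s => P s + N s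
  have hw0 : ∀ s, 0 ≤ w s := fun s => add_nonneg (hP0 s) (hN0 s)
  let X : ℝ → ℝ := fun s => 1 + (P s ^ 4 + N s ^ 4)
  let X' : ℝ → ℝ := fun s => 4 * (P s ^ 3 - N s ^ 3)
  let X'' : ℝ → ℝ := fun s => 12 * (P s ^ 2 + N s ^ 2)
  have hX1 : ∀ s, 1 ≤ X s := fun s => le_add_of_nonneg_right
    (add_nonneg (pow_nonneg (hP0 s) _) (pow_nonneg (hN0 s) _))
  have hXpos : ∀ s, 0 < X s := fun s => one_pos.trans_le (hX1 s)
  have hXw : ∀ s, X s = 1 + w s ^ 4 := fun s => by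
    have := hPN s
    simp only [X, w]
    linear_combination -(4 * P s ^ 2 + 6 * P s * N s + 4 * N s ^ 2) * this
  have hwX : ∀ (m : ℕ) s, w s ^ m ≤ X s ^ ((m : ℝ) / 4) := fun m s => by
    have h1 : w s ^ m = (w s ^ 4) ^ ((m : ℝ) / 4) := by
      rw [← Real.rpow_natCast (w s) 4, ← Real.rpow_mul (hw0 s), ← Real.rpow_natCast]
      congr 1; push_cast; ring
    rw [h1]
    refine Real.rpow_le_rpow (pow_nonneg (hw0 s) _) ?_ (by positivity)
    rw [hXw]; linarith
  have hX''0 : ∀ s, 0 ≤ X'' s := fun s => by simp only [X'']; positivity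
  have hX'' : ∀ s, X'' s ≤ 12 * X s ^ ((1 : ℝ) / 2) := fun s => by
    have h1 := hwX 2 s
    have h2 : P s ^ 2 + N s ^ 2 = w s ^ 2 := by
      simp only [w]; linear_combination -2 * hPN s
    have h3 : X'' s = 12 * w s ^ 2 := by rw [← h2]
    rw [h3]
    norm_num at h1 ⊢
    linarith
  have hX' : ∀ s, |X' s| ≤ 4 * X s ^ ((3 : ℝ) / 4) := fun s => by
    have h1 := hwX 3 s
    have h2 : P s ^ 3 + N s ^ 3 = w s ^ 3 := by
      simp only [w]; linear_combination (-3 * P s - 3 * N s) * hPN s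
    have h3 : |P s ^ 3 - N s ^ 3| ≤ P s ^ 3 + N s ^ 3 := by
      have := pow_nonneg (hP0 s) 3
      have := pow_nonneg (hN0 s) 3
      exact abs_le.2 ⟨by linarith, by linarith⟩
    simp only [X', abs_mul]
    norm_num at h1 ⊢
    linarith
  -- For β < 4 the second term of Φ'' is nonpositive. This identity merges both terms into X'' times
  -- a factor that is visibly positive.
  have hrel : ∀ s, X' s * X' s = 4 / 3 * ((X s - 1) * X'' s) := fun s => by
    simp only [X, X', X'']
    linear_combination (-32 * P s ^ 2 * N s ^ 2 - 16 * P s * N s * (P s ^ 2 + N s ^ 2)) * hPN s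
  have hXd : ∀ s, HasDerivAt X (X' s) s := fun s => by
    refine (((hPd 2 s).add (hNd 2 s)).const_add 1).congr_deriv ?_
    simp only [X']; norm_num; ring
  have hXd' : ∀ s, HasDerivAt X' (X'' s) s := fun s => by
    refine (((hPd 1 s).sub (hNd 1 s)).const_mul 4).congr_deriv ?_
    simp only [X'']; norm_num; ring
  have hXc : Continuous X := by fun_prop
  have hXc' : Continuous X' := by fun_prop
  have hXc'' : Continuous X'' := by fun_prop
  have hpc : ∀ q : ℝ, Continuous fun s => X s ^ q := fun q =>
    hXc.rpow_const fun s => Or.inl (hXpos s).ne'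
  have hβ0 : 0 < β := by linarith
  let Φ : ℝ → ℝ := fun s => X s ^ (β / 4)
  let Φ' : ℝ → ℝ := fun s => X' s * (β / 4) * X s ^ (β / 4 - 1)
  let Φ'' : ℝ → ℝ := fun s =>
    X'' s * (β / 4) * X s ^ (β / 4 - 1) +
      X' s * (β / 4) * (X' s * (β / 4 - 1) * X s ^ (β / 4 - 1 - 1))
  have hΦ'' : ∀ s, Φ'' s = β / 4 * X'' s * (1 + (β - 1) / 3 * (X s - 1)) * X s ^ (β / 4 - 2) :=
    fun s => by
      have h1 : X s ^ (β / 4 - 1) = X s * X s ^ (β / 4 - 2) := by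
        rw [show β / 4 - 1 = 1 + (β / 4 - 2) by ring, Real.rpow_add (hXpos s), Real.rpow_one]
      simp only [Φ'', h1, show β / 4 - 1 - 1 = β / 4 - 2 by ring]
      linear_combination (β / 4) * (β / 4 - 1) * X s ^ (β / 4 - 2) * hrel s
  have hc1 : 0 ≤ 3 * β * (1 + β) := by positivity
  have hΦpow : ∀ q s, Φ s ^ (q / β) = X s ^ (q / 4) := fun q s => by
    rw [← Real.rpow_mul (hXpos s).le]
    congr 1; field_simp
  refine ⟨3 * β * (1 + β) + (M + 1) ^ β, Φ, Φ', Φ'', by positivity, ?_⟩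
  have hcM : 0 ≤ (M + 1) ^ β := by positivity
  constructor
  · intro s
    exact (hXd s).rpow_const (Or.inl (hXpos s).ne')
  · intro s
    exact ((hXd' s).mul_const (β / 4)).mul ((hXd s).rpow_const (Or.inl (hXpos s).ne'))
  · have h1 := hpc (β / 4 - 1)
    have h2 := hpc (β / 4 - 1 - 1)
    fun_prop
  · intro s
    exact Real.one_le_rpow (hX1 s) (by positivity)
  · intro s
    rw [hΦ'']
    have h1 := hX1 s
    have h2 : 0 ≤ (β - 1) / 3 * (X s - 1) := mul_nonneg (by linarith) (by linarith)
    exact mul_nonneg (mul_nonneg (mul_nonneg (by positivity) (hX''0 s)) (by linarith))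
      (Real.rpow_nonneg (hXpos s).le _)
  · intro s
    rw [hΦpow]
    simp only [Φ', abs_mul, abs_of_nonneg (show 0 ≤ β / 4 by positivity),
      abs_of_nonneg (Real.rpow_nonneg (hXpos s).le (β / 4 - 1))]
    have h0 : 0 ≤ X s ^ ((β - 1) / 4) := Real.rpow_nonneg (hXpos s).le _
    calc |X' s| * (β / 4) * X s ^ (β / 4 - 1)
        ≤ 4 * X s ^ ((3 : ℝ) / 4) * (β / 4) * X s ^ (β / 4 - 1) := by
          have := Real.rpow_nonneg (hXpos s).le (β / 4 - 1)
          gcongr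
          exact hX' s
      _ = β * X s ^ ((β - 1) / 4) := by
          rw [show (β - 1) / 4 = 3 / 4 + (β / 4 - 1) by ring, Real.rpow_add (hXpos s)]
          ring
      _ ≤ _ := by gcongr; nlinarith
  · intro s
    rw [hΦpow, hΦ'']
    have h0 : 0 ≤ X s ^ ((β - 2) / 4) := Real.rpow_nonneg (hXpos s).le _
    have h1 := hX1 s
    have h3 := Real.rpow_nonneg (hXpos s).le (β / 4 - 2)
    calc β / 4 * X'' s * (1 + (β - 1) / 3 * (X s - 1)) * X s ^ (β / 4 - 2)
        ≤ β / 4 * (12 * X s ^ ((1 : ℝ) / 2)) * ((1 + β) * X s) * X s ^ (β / 4 - 2) := by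
          have := Real.rpow_nonneg (hXpos s).le ((1 : ℝ) / 2)
          have h4 : 0 ≤ (β - 1) / 3 * (X s - 1) := mul_nonneg (by linarith) (by linarith)
          gcongr
          · exact hX'' s
          · nlinarith
      _ = 3 * β * (1 + β) * X s ^ ((β - 2) / 4) := by
          rw [show (β - 2) / 4 = 1 / 2 + (1 + (β / 4 - 2)) by ring, Real.rpow_add (hXpos s),
            Real.rpow_add (hXpos s), Real.rpow_one]
          ring
      _ ≤ _ := by gcongr; linarith
  · intro s hs
    obtain ⟨h1, h2⟩ := abs_le.1 hs
    simp [Φ', X', P, N, max_eq_right (show s - M ≤ 0 by linarith),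
      max_eq_right (show -s - M ≤ 0 by linarith)]
  · intro s
    have h1 := hwX 1 s
    have h2 : 1 ≤ X s ^ (((1 : ℕ) : ℝ) / 4) := Real.one_le_rpow (hX1 s) (by positivity)
    -- |s| ≤ M + w, and X^(1/4) dominates both 1 and w.
    have h3 : |s| ≤ (M + 1) * X s ^ (((1 : ℕ) : ℝ) / 4) := by
      have h4 : |s| ≤ M + w s := by
        have := le_max_left (s - M) 0
        have := le_max_left (-s - M) 0
        have := hP0 s
        have := hN0 s
        simp only [w, P, N] at *
        exact abs_le'.2 ⟨by linarith, by linarith⟩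
      rw [pow_one] at h1
      nlinarith
    calc |s| ^ β ≤ ((M + 1) * X s ^ (((1 : ℕ) : ℝ) / 4)) ^ β :=
          Real.rpow_le_rpow (abs_nonneg s) h3 hβ0.le
      _ = (M + 1) ^ β * Φ s := by
          rw [Real.mul_rpow (by positivity) (by positivity), ← Real.rpow_mul (hXpos s).le]
          congr 2; push_cast; ring
      _ ≤ _ := by
          have := (Real.rpow_nonneg (hXpos s).le (β / 4))
          gcongr
          linarith

end Truncation

end Forchheimer

namespace Forchheimer

/-! ### Averages in time of the boundary data -/

section TimeAverage

open MeasureTheory Set Filter Topology Metric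

/-- Tonelli brings the integral over τ outside, then Hölder in x is applied for almost every τ. -/
theorem lintegral_rpow_mul_lintegral_le {X T : Type*} [MeasurableSpace X] [MeasurableSpace T]
    {μ : Measure X} {ν : Measure T} [SFinite μ] [SFinite ν] {Y : X → ENNReal}
    (hY : AEMeasurable Y μ) {g : X → T → ENNReal}
    (hg : AEMeasurable (Function.uncurry g) (μ.prod ν)) {p q : ℝ} (hp : 0 ≤ p) (hq : 0 ≤ q)
    (hpq : p + q = 1) :
    ∫⁻ x, Y x ^ p * ∫⁻ τ, g x τ ^ q ∂ν ∂μ ≤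
      (∫⁻ x, Y x ∂μ) ^ p * ∫⁻ τ, (∫⁻ x, g x τ ∂μ) ^ q ∂ν := by
  have hYp : AEMeasurable (fun z : X × T => Y z.1) (μ.prod ν) := hY.comp_fst
  calc ∫⁻ x, Y x ^ p * ∫⁻ τ, g x τ ^ q ∂ν ∂μ
      = ∫⁻ x, ∫⁻ τ, Y x ^ p * g x τ ^ q ∂ν ∂μ := by
        have h1 : ∀ᵐ x ∂μ, AEMeasurable (g x) ν := hg.aestronglyMeasurable.prodMk_left.mono fun _ h =>
          h.aemeasurable
        refine lintegral_congr_ae ?_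
        filter_upwards [h1] with x hx
        rw [lintegral_const_mul'' _ (hx.pow_const q)]
    _ = ∫⁻ τ, ∫⁻ x, Y x ^ p * g x τ ^ q ∂μ ∂ν :=
        lintegral_lintegral_swap ((hYp.pow_const p).mul (hg.pow_const q))
    _ ≤ ∫⁻ τ, (∫⁻ x, Y x ∂μ) ^ p * (∫⁻ x, g x τ ∂μ) ^ q ∂ν := by
        have h1 : ∀ᵐ τ ∂ν, AEMeasurable (fun x => g x τ) μ :=
          hg.prod_swap.aestronglyMeasurable.prodMk_left.mono fun _ h => h.aemeasurable
        refine lintegral_mono_ae ?_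
        filter_upwards [h1] with τ hτ
        exact ENNReal.lintegral_mul_norm_pow_le hY hτ hp hq hpq
    _ = _ := by
        rw [lintegral_const_mul'']
        exact (hg.prod_swap.lintegral_prod_right').pow_const q

variable {n : ℕ}

local notation "𝕍" => EuclideanSpace ℝ (Fin n)

/-- The Hölder step of the energy estimate, with Y = Φ(u) and g = ‖b‖^β, for which (∫g)^(j/β) is the
j-th power of the L^β norm. It is used with j = 1 for Ψ_tt and j = 2 for ∇Ψ_t. -/
theorem integrableOn_rpow_mul_integral {G : Type*} [NormedAddCommGroup G] {U : Set 𝕍}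
    (hU : IsOpen U) {b : 𝕍 → ℝ → G}
    (hb : ContinuousOn (fun z : 𝕍 × ℝ => b z.1 z.2) (U ×ˢ Ioi (0 : ℝ))) {β j : ℝ} (hβ : 0 < β)
    (hj : 0 ≤ j) (hjβ : j ≤ β) {t h : ℝ} (ht : 0 < t) (hh : 0 ≤ h)
    (hfin : ∫⁻ τ in Ioc t (t + h), eLpNorm (fun x => b x τ) (ENNReal.ofReal β)
      (volume.restrict U) ^ j ≠ ⊤) {Y : 𝕍 → ℝ} (hY0 : ∀ x, 0 ≤ Y x) (hY : IntegrableOn Y U) :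
    IntegrableOn (fun x => Y x ^ ((β - j) / β) * ∫ τ in t..(t + h), ‖b x τ‖ ^ j) U ∧
    ∫ x in U, Y x ^ ((β - j) / β) * ∫ τ in t..(t + h), ‖b x τ‖ ^ j ≤
      (∫ x in U, Y x) ^ ((β - j) / β) *
        (∫⁻ τ in Ioc t (t + h), eLpNorm (fun x => b x τ) (ENNReal.ofReal β)
          (volume.restrict U) ^ j).toReal := by
  set μ := (volume : Measure 𝕍).restrict U with hμ
  set ν := (volume : Measure ℝ).restrict (Ioc t (t + h)) with hν
  have hsub : U ×ˢ Ioc t (t + h) ⊆ U ×ˢ Ioi (0 : ℝ) := prod_mono le_rfl fun τ hτ => ht.trans hτ.1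
  have hp : 0 ≤ (β - j) / β := div_nonneg (by linarith) hβ.le
  have hq : 0 ≤ j / β := by positivity
  have hpq : (β - j) / β + j / β = 1 := by field_simp; ring
  have hbj : ContinuousOn (fun z : 𝕍 × ℝ => ‖b z.1 z.2‖ ^ j) (U ×ˢ Ioc t (t + h)) :=
    (hb.mono hsub).norm.rpow_const fun _ _ => Or.inr hj
  have hms : MeasurableSet (U ×ˢ Ioc t (t + h)) := hU.measurableSet.prod measurableSet_Ioc
  have hprod : μ.prod ν = (volume.prod volume).restrict (U ×ˢ Ioc t (t + h)) :=
    Measure.prod_restrict _ _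
  have hbm : AEStronglyMeasurable (fun z : 𝕍 × ℝ => ‖b z.1 z.2‖) (μ.prod ν) := by
    rw [hprod]
    exact (hb.mono hsub).norm.aestronglyMeasurable hms
  have hbjm : AEStronglyMeasurable (fun z : 𝕍 × ℝ => ‖b z.1 z.2‖ ^ j) (μ.prod ν) := by
    rw [hprod]
    exact hbj.aestronglyMeasurable hms
  let g : 𝕍 → ℝ → ENNReal := fun x τ => ‖b x τ‖ₑ ^ β
  have hg : AEMeasurable (Function.uncurry g) (μ.prod ν) := by
    have h1 : Function.uncurry g = fun z : 𝕍 × ℝ => ENNReal.ofReal ‖b z.1 z.2‖ ^ β := by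
      ext z; simp [g, Function.uncurry]
    rw [h1]
    exact hbm.aemeasurable.ennreal_ofReal.pow_const β
  have hmain := lintegral_rpow_mul_lintegral_le (Y := fun x => ENNReal.ofReal (Y x))
    hY.aemeasurable.ennreal_ofReal hg hp hq hpq
  have hL : ∀ τ, (∫⁻ x, g x τ ∂μ) ^ (j / β) =
      eLpNorm (fun x => b x τ) (ENNReal.ofReal β) μ ^ j := by
    intro τ
    rw [eLpNorm_eq_lintegral_rpow_enorm_toReal (by simpa using hβ) ENNReal.ofReal_ne_top,
      ENNReal.toReal_ofReal hβ.le, ← ENNReal.rpow_mul]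
    congr 1; ring
  rw [lintegral_congr hL] at hmain
  have hI0 : ∀ x, 0 ≤ ∫ τ in t..(t + h), ‖b x τ‖ ^ j := fun x =>
    intervalIntegral.integral_nonneg (by linarith) fun τ _ => by positivity
  have hinner : ∀ x ∈ U, ∫⁻ τ, g x τ ^ (j / β) ∂ν =
      ENNReal.ofReal (∫ τ in t..(t + h), ‖b x τ‖ ^ j) := by
    intro x hx
    have hcx : ContinuousOn (fun τ => ‖b x τ‖ ^ j) (Icc t (t + h)) := by
      have h1 : ContinuousOn (fun τ : ℝ => b x τ) (Icc t (t + h)) :=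
        hb.comp (f := fun τ : ℝ => (x, τ)) (by fun_prop)
          fun τ hτ => ⟨hx, ht.trans_le hτ.1⟩
      exact h1.norm.rpow_const fun _ _ => Or.inr hj
    rw [intervalIntegral.integral_of_le (by linarith), ofReal_integral_eq_lintegral_ofReal
      (hcx.integrableOn_Icc.mono_set Ioc_subset_Icc_self)
      (Eventually.of_forall fun τ => by positivity)]
    refine lintegral_congr fun τ => ?_
    simp only [g]
    rw [← ENNReal.rpow_mul, mul_div_cancel₀ _ hβ.ne', ← ofReal_norm,
      ENNReal.ofReal_rpow_of_nonneg (norm_nonneg _) hj]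
  have hYI : ∫⁻ x, ENNReal.ofReal (Y x) ∂μ = ENNReal.ofReal (∫ x in U, Y x) :=
    (ofReal_integral_eq_lintegral_ofReal hY (Eventually.of_forall hY0)).symm
  have hYI0 : 0 ≤ ∫ x in U, Y x := integral_nonneg hY0
  have hnn : ∀ x, 0 ≤ Y x ^ ((β - j) / β) * ∫ τ in t..(t + h), ‖b x τ‖ ^ j := fun x =>
    mul_nonneg (Real.rpow_nonneg (hY0 x) _) (hI0 x)
  have hlhs : ∫⁻ x, ENNReal.ofReal (Y x) ^ ((β - j) / β) * ∫⁻ τ, g x τ ^ (j / β) ∂ν ∂μ =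
      ∫⁻ x, ENNReal.ofReal (Y x ^ ((β - j) / β) * ∫ τ in t..(t + h), ‖b x τ‖ ^ j) ∂μ := by
    refine setLIntegral_congr_fun hU.measurableSet fun x hx => ?_
    rw [hinner x hx, ENNReal.ofReal_rpow_of_nonneg (hY0 x) hp,
      ENNReal.ofReal_mul (Real.rpow_nonneg (hY0 x) _)]
  rw [hlhs, hYI, ENNReal.ofReal_rpow_of_nonneg hYI0 hp] at hmain
  have hmeas : AEStronglyMeasurable
      (fun x => Y x ^ ((β - j) / β) * ∫ τ in t..(t + h), ‖b x τ‖ ^ j) μ := by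
    refine (hY.aemeasurable.pow_const _).aestronglyMeasurable.mul ?_
    simp only [intervalIntegral.integral_of_le (show t ≤ t + h by linarith)]
    exact hbjm.integral_prod_right'
  have hRfin : ENNReal.ofReal ((∫ x in U, Y x) ^ ((β - j) / β)) *
      ∫⁻ τ in Ioc t (t + h), eLpNorm (fun x => b x τ) (ENNReal.ofReal β) μ ^ j ≠ ⊤ :=
    ENNReal.mul_ne_top ENNReal.ofReal_ne_top hfin
  constructor
  · refine ⟨hmeas, ?_⟩
    rw [hasFiniteIntegral_iff_ofReal (Eventually.of_forall hnn)]
    exact hmain.trans_lt hRfin.lt_top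
  · rw [integral_eq_lintegral_of_nonneg_ae (Eventually.of_forall hnn) hmeas]
    refine (ENNReal.toReal_mono hRfin hmain).trans ?_
    rw [ENNReal.toReal_mul, ENNReal.toReal_ofReal (Real.rpow_nonneg hYI0 _)]

/-! #### Differentiation of a `C¹` function of space and time -/

variable {U : Set (EuclideanSpace ℝ (Fin n))} {θ : EuclideanSpace ℝ (Fin n) → ℝ → ℝ}

theorem hasFDerivAt_uncurry (hU : IsOpen U)
    (hθ : ContDiffOn ℝ 1 (fun z : 𝕍 × ℝ => θ z.1 z.2) (U ×ˢ Ioi (0 : ℝ))) {x : 𝕍} (hx : x ∈ U)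
    {t : ℝ} (ht : 0 < t) :
    HasFDerivAt (fun z : 𝕍 × ℝ => θ z.1 z.2)
      (fderiv ℝ (fun z : 𝕍 × ℝ => θ z.1 z.2) (x, t)) (x, t) := by
  have h1 : U ×ˢ Ioi (0 : ℝ) ∈ 𝓝 (x, t) := prod_mem_nhds (hU.mem_nhds hx) (Ioi_mem_nhds ht)
  exact ((hθ.contDiffAt h1).differentiableAt one_ne_zero).hasFDerivAt

theorem hasFDerivAt_space (hU : IsOpen U)
    (hθ : ContDiffOn ℝ 1 (fun z : 𝕍 × ℝ => θ z.1 z.2) (U ×ˢ Ioi (0 : ℝ))) {x : 𝕍} (hx : x ∈ U)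
    {t : ℝ} (ht : 0 < t) :
    HasFDerivAt (fun y : 𝕍 => θ y t) (ContinuousLinearMap.comp
      (fderiv ℝ (fun z : 𝕍 × ℝ => θ z.1 z.2) (x, t)) (ContinuousLinearMap.inl ℝ 𝕍 ℝ)) x := by
  have h2 : HasFDerivAt (fun y : 𝕍 => (y, t)) (ContinuousLinearMap.inl ℝ 𝕍 ℝ) x :=
    hasFDerivAt_prodMk_left x t
  exact HasFDerivAt.comp x (hasFDerivAt_uncurry hU hθ hx ht) h2

theorem hasDerivAt_time (hU : IsOpen U)
    (hθ : ContDiffOn ℝ 1 (fun z : 𝕍 × ℝ => θ z.1 z.2) (U ×ˢ Ioi (0 : ℝ))) {x : 𝕍} (hx : x ∈ U)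
    {t : ℝ} (ht : 0 < t) :
    HasDerivAt (θ x) (fderiv ℝ (fun z : 𝕍 × ℝ => θ z.1 z.2) (x, t) (0, 1)) t := by
  have h1 : HasDerivAt (fun s : ℝ => ((x, s) : 𝕍 × ℝ)) (0, 1) t :=
    (hasDerivAt_const t x).prodMk (hasDerivAt_id t)
  exact HasFDerivAt.comp_hasDerivAt t (hasFDerivAt_uncurry hU hθ hx ht) h1

theorem continuousOn_fderiv_uncurry (hU : IsOpen U)
    (hθ : ContDiffOn ℝ 1 (fun z : 𝕍 × ℝ => θ z.1 z.2) (U ×ˢ Ioi (0 : ℝ))) :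
    ContinuousOn (fderiv ℝ (fun z : 𝕍 × ℝ => θ z.1 z.2)) (U ×ˢ Ioi (0 : ℝ)) := by
  have h1 : IsOpen (U ×ˢ Ioi (0 : ℝ)) := hU.prod isOpen_Ioi
  exact hθ.continuousOn_fderiv_of_isOpen h1 le_rfl

theorem continuousOn_fderiv_space (hU : IsOpen U)
    (hθ : ContDiffOn ℝ 1 (fun z : 𝕍 × ℝ => θ z.1 z.2) (U ×ˢ Ioi (0 : ℝ))) :
    ContinuousOn (fun z : 𝕍 × ℝ => fderiv ℝ (fun y => θ y z.2) z.1) (U ×ˢ Ioi (0 : ℝ)) := by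
  have h1 : ContinuousOn (fun z : 𝕍 × ℝ => ContinuousLinearMap.comp
      (fderiv ℝ (fun z : 𝕍 × ℝ => θ z.1 z.2) z) (ContinuousLinearMap.inl ℝ 𝕍 ℝ))
      (U ×ˢ Ioi (0 : ℝ)) := (continuousOn_fderiv_uncurry hU hθ).clm_comp continuousOn_const
  exact h1.congr fun z hz => (hasFDerivAt_space hU hθ hz.1 hz.2).fderiv

theorem continuousOn_deriv_time (hU : IsOpen U)
    (hθ : ContDiffOn ℝ 1 (fun z : 𝕍 × ℝ => θ z.1 z.2) (U ×ˢ Ioi (0 : ℝ))) :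
    ContinuousOn (fun z : 𝕍 × ℝ => deriv (θ z.1) z.2) (U ×ˢ Ioi (0 : ℝ)) := by
  have h1 : ContinuousOn (fun z : 𝕍 × ℝ =>
      fderiv ℝ (fun z : 𝕍 × ℝ => θ z.1 z.2) z ((0, 1) : 𝕍 × ℝ))
      (U ×ˢ Ioi (0 : ℝ)) := (continuousOn_fderiv_uncurry hU hθ).clm_apply continuousOn_const
  exact h1.congr fun z hz => (hasDerivAt_time hU hθ hz.1 hz.2).deriv

theorem continuousOn_gradient_space_time (hU : IsOpen U)
    (hθ : ContDiffOn ℝ 1 (fun z : 𝕍 × ℝ => θ z.1 z.2) (U ×ˢ Ioi (0 : ℝ))) :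
    ContinuousOn (fun z : 𝕍 × ℝ => gradient (fun y => θ y z.2) z.1) (U ×ˢ Ioi (0 : ℝ)) :=
  (InnerProductSpace.toDual ℝ 𝕍).symm.continuous.comp_continuousOn
    (continuousOn_fderiv_space hU hθ)

theorem continuousOn_slice {G : Type*} [TopologicalSpace G] {b : 𝕍 → ℝ → G} {S : Set 𝕍}
    (hb : ContinuousOn (fun z : 𝕍 × ℝ => b z.1 z.2) (S ×ˢ Ioi (0 : ℝ))) {x : 𝕍} (hx : x ∈ S) :
    ContinuousOn (fun τ => b x τ) (Ioi (0 : ℝ)) :=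
  hb.comp (f := fun τ : ℝ => (x, τ)) (by fun_prop) fun _ hτ => ⟨hx, hτ⟩

theorem continuousOn_slice_space {G : Type*} [TopologicalSpace G] {b : 𝕍 → ℝ → G} {S : Set 𝕍}
    (hb : ContinuousOn (fun z : 𝕍 × ℝ => b z.1 z.2) (S ×ˢ Ioi (0 : ℝ))) {t : ℝ} (ht : 0 < t) :
    ContinuousOn (fun x => b x t) S :=
  hb.comp (f := fun x : 𝕍 => (x, t)) (by fun_prop) fun _ hx => ⟨hx, ht⟩

theorem intervalIntegrable_of_continuousOn_Ioi {G : Type*} [NormedAddCommGroup G]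
    {f : ℝ → G} (hf : ContinuousOn f (Ioi (0 : ℝ))) {s t : ℝ} (hs : 0 < s) (ht : 0 < t) :
    IntervalIntegrable f volume s t :=
  (hf.mono fun _ hτ => (lt_min hs ht).trans_le hτ.1).intervalIntegrable

theorem sub_eq_integral_deriv {f : ℝ → ℝ} (hd : ∀ t > 0, DifferentiableAt ℝ f t)
    (hc : ContinuousOn (deriv f) (Ioi (0 : ℝ))) {s t : ℝ} (hs : 0 < s) (ht : 0 < t) :
    f t - f s = ∫ τ in s..t, deriv f τ :=
  (intervalIntegral.integral_eq_sub_of_hasDerivAt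
    (fun τ hτ => (hd τ ((lt_min hs ht).trans_le hτ.1)).hasDerivAt)
    (intervalIntegrable_of_continuousOn_Ioi hc hs ht)).symm

/-- Used with θ = Ψ_t: the spatial gradient of the time increment of Ψ becomes an integral of ∇Ψ_t,
the quantity that the assumption controls. -/
theorem hasFDerivAt_integral_time (hU : IsOpen U)
    (hθ : ContDiffOn ℝ 1 (fun z : 𝕍 × ℝ => θ z.1 z.2) (U ×ˢ Ioi (0 : ℝ))) {x : 𝕍} (hx : x ∈ U)
    {s t : ℝ} (hs : 0 < s) (ht : 0 < t) :
    HasFDerivAt (fun y => ∫ τ in s..t, θ y τ) (∫ τ in s..t, fderiv ℝ (fun y => θ y τ) x) x := by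
  have hDc := (continuousOn_fderiv_space hU hθ)
  have hpos : ∀ τ ∈ uIcc s t, 0 < τ := fun τ hτ => (lt_min hs ht).trans_le hτ.1
  obtain ⟨r, hr, hrU⟩ := nhds_basis_closedBall.mem_iff.1 (hU.mem_nhds hx)
  obtain ⟨C, hC⟩ := ((isCompact_closedBall x r).prod isCompact_uIcc).exists_bound_of_continuousOn
    (hDc.mono (prod_mono hrU hpos))
  have hii : ∀ y ∈ U, IntervalIntegrable (θ y) volume s t := fun y hy =>
    intervalIntegrable_of_continuousOn_Ioi (continuousOn_slice hθ.continuousOn hy) hs ht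
  refine intervalIntegral.hasFDerivAt_integral_of_dominated_of_fderiv_le (𝕜 := ℝ)
    (F' := fun (y : 𝕍) (τ : ℝ) => fderiv ℝ (fun y => θ y τ) y) (bound := fun _ => C)
    (closedBall_mem_nhds x hr) ?_ (hii x hx) ?_ ?_ intervalIntegrable_const ?_
  · filter_upwards [hU.mem_nhds hx] with y hy
    exact (hii y hy).def'.aestronglyMeasurable
  · exact (intervalIntegrable_of_continuousOn_Ioi (continuousOn_slice
      (b := fun (x : 𝕍) (τ : ℝ) => fderiv ℝ (fun y : 𝕍 => θ y τ) x) hDc hx) hs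
      ht).def'.aestronglyMeasurable
  · exact Eventually.of_forall fun τ hτ y hy => hC (y, τ) ⟨hy, uIoc_subset_uIcc hτ⟩
  · refine Eventually.of_forall fun τ hτ y hy => ?_
    exact (hasFDerivAt_space hU hθ (hrU hy) (hpos τ (uIoc_subset_uIcc
      hτ))).differentiableAt.hasFDerivAt

end TimeAverage

end Forchheimer

namespace Forchheimer

/-! ### Difference quotients in time -/

section Quotient

open MeasureTheory Set Filter Topology Metric

variable {n : ℕ}

local notation "𝕍" => EuclideanSpace ℝ (Fin n)

theorem contDiffOn_gradient {U : Set 𝕍} (hU : IsOpen U) {f : 𝕍 → ℝ} (hf : ContDiffOn ℝ 2 f U) :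
    ContDiffOn ℝ 1 (gradient f) U :=
  (InnerProductSpace.toDual ℝ 𝕍).symm.toContinuousLinearEquiv.contDiff.comp_contDiffOn
    (hf.fderiv_of_isOpen hU (by norm_num))

theorem gradUpToBoundary_eqOn {U : Set 𝕍} (hU : IsOpen U) {f : 𝕍 → ℝ}
    (hf : ContDiffOn ℝ 2 f U) : EqOn (gradUpToBoundary U f) (gradient f) U :=
  extendFrom_extends (contDiffOn_gradient hU hf).continuousOn

theorem norm_gradient_eq (f : 𝕍 → ℝ) (x : 𝕍) : ‖gradient f x‖ = ‖fderiv ℝ f x‖ :=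
  LinearIsometryEquiv.norm_map _ _

/-- The flux field `K(|∇f|) ∇f`, up to the boundary. -/
noncomputable def fluxField {k : ℕ} (a α : Fin (k + 1) → ℝ) (U : Set 𝕍) (f : 𝕍 → ℝ) (x : 𝕍) : 𝕍 :=
  flux a α (gradUpToBoundary U f x)

theorem contDiffOn_fluxField {k : ℕ} {a α : Fin (k + 1) → ℝ} (hg : IsGeneralizedPolynomial a α)
    {U : Set 𝕍} (hU : IsOpen U) {f : 𝕍 → ℝ} (hf : ContDiffOn ℝ 2 f U) :
    ContDiffOn ℝ 1 (fluxField a α U f) U := by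
  refine ((contDiff_flux hg).comp_contDiffOn (contDiffOn_gradient hU hf)).congr fun x hx => ?_
  rw [fluxField, gradUpToBoundary_eqOn hU hf hx, Function.comp_apply]

theorem divergence_fluxField {k : ℕ} {a α : Fin (k + 1) → ℝ} {U : Set 𝕍} (hU : IsOpen U)
    {f : 𝕍 → ℝ} (hf : ContDiffOn ℝ 2 f U) {x : 𝕍} (hx : x ∈ U) :
    divergence (fluxField a α U f) x = forchheimerOperator (conductivity a α) f x := by
  refine divergence_congr ?_
  filter_upwards [hU.mem_nhds hx] with y hy
  rw [fluxField, gradUpToBoundary_eqOn hU hf hy, flux]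

theorem divergence_const_smul_sub {V W : 𝕍 → 𝕍} {x : 𝕍} (hV : DifferentiableAt ℝ V x)
    (hW : DifferentiableAt ℝ W x) (c : ℝ) :
    divergence (fun y => c • (V y - W y)) x = c * (divergence V x - divergence W x) := by
  have h : fderiv ℝ (fun y => c • (V y - W y)) x = c • (fderiv ℝ V x - fderiv ℝ W x) :=
    ((hV.hasFDerivAt.sub hW.hasFDerivAt).const_smul c).fderiv
  simp only [divergence, h, ← Finset.sum_sub_distrib, Finset.mul_sum]
  exact Finset.sum_congr rfl fun i _ => by simp

/-- The quantity `((p - Ψ)(x, t + h) - (p - Ψ)(x, t)) / h + A`. -/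
noncomputable def quotient (p Ψ : 𝕍 → ℝ → ℝ) (A h : ℝ) (x : 𝕍) (t : ℝ) : ℝ :=
  h⁻¹ * (p x (t + h) - p x t) - h⁻¹ * (Ψ x (t + h) - Ψ x t) + A

variable {k : ℕ} {U Γe Γi : Set (EuclideanSpace ℝ (Fin n))} {a α : Fin (k + 1) → ℝ}
  {Q γ : ℝ → ℝ} {p₀ : EuclideanSpace ℝ (Fin n) → ℝ} {ψ Ψ p : EuclideanSpace ℝ (Fin n) → ℝ → ℝ}

theorem continuousOn_shift {b : 𝕍 → ℝ → ℝ}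
    (hb : ContinuousOn (fun z : 𝕍 × ℝ => b z.1 z.2) (closure U ×ˢ Ioi (0 : ℝ))) {h : ℝ}
    (hh : 0 < h) :
    ContinuousOn (fun z : 𝕍 × ℝ => b z.1 (z.2 + h)) (closure U ×ˢ Ioi (0 : ℝ)) :=
  hb.comp (f := fun z : 𝕍 × ℝ => (z.1, z.2 + h)) (by fun_prop)
    fun _ hz => ⟨hz.1, add_pos hz.2 hh⟩

theorem continuousOn_quotient {p Ψ : 𝕍 → ℝ → ℝ}
    (hp : ContinuousOn (fun z : 𝕍 × ℝ => p z.1 z.2) (closure U ×ˢ Ioi (0 : ℝ)))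
    (hΨ : ContinuousOn (fun z : 𝕍 × ℝ => Ψ z.1 z.2) (closure U ×ˢ Ioi (0 : ℝ)))
    (A : ℝ) {h : ℝ} (hh : 0 < h) :
    ContinuousOn (fun z : 𝕍 × ℝ => quotient p Ψ A h z.1 z.2) (closure U ×ˢ Ioi (0 : ℝ)) := by
  have h1 := continuousOn_shift hp hh
  have h2 := continuousOn_shift hΨ hh
  exact ((continuousOn_const.mul (h1.sub hp)).sub (continuousOn_const.mul (h2.sub hΨ))).add
    continuousOn_const

/-- The difference quotient of the flux field. -/
noncomputable def fluxQuotient {k : ℕ} (a α : Fin (k + 1) → ℝ) (U : Set 𝕍) (p : 𝕍 → ℝ → ℝ)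
    (h t : ℝ) (x : 𝕍) : 𝕍 :=
  h⁻¹ • (fluxField a α U (fun y => p y (t + h)) x - fluxField a α U (fun y => p y t) x)

theorem IsSolutionIBVP1.continuousOn_fluxField (hg : IsGeneralizedPolynomial a α)
    (hp : IsSolutionIBVP1 U Γe Γi (conductivity a α) Q p₀ γ ψ p) {t : ℝ} (ht : 0 < t) :
    ContinuousOn (fluxField a α U fun y => p y t) (closure U) :=
  (continuous_flux hg).comp_continuousOn (continuousOn_slice_space
    (b := fun (x : 𝕍) t => gradUpToBoundary U (fun y => p y t) x) hp.continuousOn_gradient ht)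

theorem IsSolutionIBVP1.divergence_fluxQuotient (hg : IsGeneralizedPolynomial a α)
    (hU : IsOpen U) (hp : IsSolutionIBVP1 U Γe Γi (conductivity a α) Q p₀ γ ψ p) {t h : ℝ}
    (ht : 0 < t) (hh : 0 < h) {x : 𝕍} (hx : x ∈ U) :
    divergence (fluxQuotient a α U p h t) x = h⁻¹ * (deriv (p x) (t + h) - deriv (p x) t) := by
  have hd : ∀ s > 0, DifferentiableAt ℝ (fluxField a α U fun y => p y s) x := fun s hs =>
    ((contDiffOn_fluxField hg hU (hp.contDiffOn_space s hs)).contDiffAt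
      (hU.mem_nhds hx)).differentiableAt one_ne_zero
  have hth : 0 < t + h := by linarith
  unfold fluxQuotient
  rw [divergence_const_smul_sub (hd _ hth) (hd _ ht),
    divergence_fluxField hU (hp.contDiffOn_space _ hth) hx,
    divergence_fluxField hU (hp.contDiffOn_space _ ht) hx, ← hp.equation x hx _ hth,
    ← hp.equation x hx _ ht]

/-- The derivative in space of the difference quotient. -/
theorem hasFDerivAt_quotient (hU : IsOpen U)
    (hp : IsSolutionIBVP1 U Γe Γi (conductivity a α) Q p₀ γ ψ p)
    (hΨ : IsBoundaryDataExtension U Γi ψ Ψ) (A : ℝ) {t h : ℝ} (ht : 0 < t) (hh : 0 < h)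
    {x : 𝕍} (hx : x ∈ U) :
    HasFDerivAt (fun y => quotient p Ψ A h y t)
      (h⁻¹ • (fderiv ℝ (fun y => p y (t + h)) x - fderiv ℝ (fun y => p y t) x) -
        h⁻¹ • ∫ τ in t..(t + h), fderiv ℝ (fun y => deriv (Ψ y) τ) x) x := by
  have hth : 0 < t + h := by linarith
  have hpd : ∀ s > 0, HasFDerivAt (fun y => p y s) (fderiv ℝ (fun y => p y s) x) x := fun s hs =>
    (((hp.contDiffOn_space s hs).contDiffAt (hU.mem_nhds hx)).differentiableAt
      two_ne_zero).hasFDerivAt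
  have h1 := hasFDerivAt_integral_time (θ := fun y τ => deriv (Ψ y) τ) hU hΨ.contDiffOn_time_deriv
    hx ht hth
  refine (((((hpd _ hth).sub (hpd _ ht)).const_smul h⁻¹).sub
    (h1.const_smul h⁻¹)).add_const A).congr_of_eventuallyEq ?_
  filter_upwards [hU.mem_nhds hx] with y hy
  have h2 : Ψ y (t + h) - Ψ y t = ∫ τ in t..(t + h), deriv (Ψ y) τ :=
    sub_eq_integral_deriv (hΨ.differentiableAt_time y (subset_closure hy))
      (continuousOn_slice (b := fun (x : 𝕍) τ => deriv (Ψ x) τ)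
        hΨ.contDiffOn_time_deriv.continuousOn hy) ht hth
  simp [quotient, h2]

theorem contDiffOn_quotient
    (hp : IsSolutionIBVP1 U Γe Γi (conductivity a α) Q p₀ γ ψ p)
    (hΨ : IsBoundaryDataExtension U Γi ψ Ψ) (A : ℝ) {t h : ℝ} (ht : 0 < t) (hh : 0 < h) :
    ContDiffOn ℝ 1 (fun y => quotient p Ψ A h y t) U := by
  have h1 : ∀ s > 0, ContDiffOn ℝ 1 (fun y => p y s) U := fun s hs =>
    (hp.contDiffOn_space s hs).of_le (by norm_num)
  have h2 : ∀ s > 0, ContDiffOn ℝ 1 (fun y => Ψ y s) U := fun s hs =>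
    hΨ.contDiffOn.comp (f := fun y : 𝕍 => (y, s)) (by fun_prop) fun y hy => ⟨hy, hs⟩
  have hth : 0 < t + h := by linarith
  exact (((contDiffOn_const (c := h⁻¹)).mul ((h1 _ hth).sub (h1 _ ht))).sub
    ((contDiffOn_const (c := h⁻¹)).mul ((h2 _ hth).sub (h2 _ ht)))).add contDiffOn_const

/-- Monotonicity of the flux, up to the contribution of the boundary data. -/
theorem neg_fderiv_quotient_le (hg : IsGeneralizedPolynomial a α) (hU : IsOpen U)
    (hp : IsSolutionIBVP1 U Γe Γi (conductivity a α) Q p₀ γ ψ p)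
    (hΨ : IsBoundaryDataExtension U Γi ψ Ψ) (A : ℝ) {t h : ℝ} (ht : 0 < t) (hh : 0 < h)
    {x : 𝕍} (hx : x ∈ U) :
    -(fderiv ℝ (fun y => quotient p Ψ A h y t) x (fluxQuotient a α U p h t x)) ≤
      (4 * a 0)⁻¹ * (h⁻¹ * ∫ τ in t..(t + h), ‖gradient (fun y => deriv (Ψ y) τ) x‖ ^ (2 : ℝ)) := by
  have ha := hg.coeff_pos 0
  have hth : 0 < t + h := by linarith
  set f := fluxQuotient a α U p h t x with hf
  have hc := continuousOn_fderiv_space (θ := fun y τ => deriv (Ψ y) τ) hU hΨ.contDiffOn_time_deriv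
  have hc1 : ContinuousOn (fun τ => fderiv ℝ (fun y => deriv (Ψ y) τ) x) (Ioi (0 : ℝ)) :=
    continuousOn_slice (b := fun (x : 𝕍) (τ : ℝ) => fderiv ℝ (fun y : 𝕍 => deriv (Ψ y) τ) x) hc hx
  have hii := intervalIntegrable_of_continuousOn_Ioi hc1 ht hth
  have hc2 : ContinuousOn (fun τ => fderiv ℝ (fun y => deriv (Ψ y) τ) x f) (Ioi (0 : ℝ)) :=
    hc1.clm_apply continuousOn_const
  have hc3 : ContinuousOn (fun τ => ‖gradient (fun y => deriv (Ψ y) τ) x‖ ^ (2 : ℝ))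
      (Ioi (0 : ℝ)) := by
    simp only [norm_gradient_eq]
    exact hc1.norm.rpow_const fun _ _ => Or.inr (by norm_num)
  rw [(hasFDerivAt_quotient hU hp hΨ A ht hh hx).fderiv]
  simp only [_root_.sub_apply, _root_.smul_apply, smul_eq_mul]
  rw [ContinuousLinearMap.intervalIntegral_apply hii]
  set g₁ := gradient (fun y => p y (t + h)) x with hg₁
  set g₀ := gradient (fun y => p y t) x with hg₀
  rw [← inner_gradient_eq_fderiv, ← inner_gradient_eq_fderiv, ← inner_sub_left, ← hg₁, ← hg₀]
  have hfeq : f = h⁻¹ • (flux a α g₁ - flux a α g₀) := by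
    rw [hf, fluxQuotient, fluxField, fluxField,
      gradUpToBoundary_eqOn hU (hp.contDiffOn_space _ hth) hx,
      gradUpToBoundary_eqOn hU (hp.contDiffOn_space _ ht) hx]
  -- Cocoercivity divided by h²; this is the good term.
  have h1 : a 0 * ‖f‖ ^ 2 ≤ h⁻¹ * inner ℝ (g₁ - g₀) f := by
    have h2 := flux_cocoercive hg g₁ g₀
    rw [hfeq, norm_smul, real_inner_smul_right, Real.norm_of_nonneg (inv_nonneg.2 hh.le)]
    calc a 0 * (h⁻¹ * ‖flux a α g₁ - flux a α g₀‖) ^ 2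
        = h⁻¹ * h⁻¹ * (a 0 * ‖flux a α g₁ - flux a α g₀‖ ^ 2) := by ring
      _ ≤ h⁻¹ * h⁻¹ * inner ℝ (g₁ - g₀) (flux a α g₁ - flux a α g₀) := by gcongr
      _ = _ := by ring
  -- Young's inequality with weights such that the average over [t, t+h] reproduces exactly a₀‖f‖²,
  -- which then cancels against the good term.
  have h3 : ∀ τ, fderiv ℝ (fun y => deriv (Ψ y) τ) x f ≤
      a 0 * ‖f‖ ^ 2 + (4 * a 0)⁻¹ * ‖gradient (fun y => deriv (Ψ y) τ) x‖ ^ (2 : ℝ) := by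
    intro τ
    rw [← inner_gradient_eq_fderiv, Real.rpow_two]
    set b := gradient (fun y => deriv (Ψ y) τ) x
    refine (real_inner_le_norm b f).trans ?_
    have h4 : a 0 * ‖f‖ ^ 2 + (4 * a 0)⁻¹ * ‖b‖ ^ 2 - ‖b‖ * ‖f‖ =
        (4 * a 0)⁻¹ * (2 * a 0 * ‖f‖ - ‖b‖) ^ 2 := by field_simp; ring
    have h5 : 0 ≤ (4 * a 0)⁻¹ * (2 * a 0 * ‖f‖ - ‖b‖) ^ 2 := by positivity
    linarith
  have hi3 := (intervalIntegrable_of_continuousOn_Ioi hc3 ht hth).const_mul (4 * a 0)⁻¹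
  have h6 := intervalIntegral.integral_mono (by linarith : t ≤ t + h)
    (intervalIntegrable_of_continuousOn_Ioi hc2 ht hth)
    (intervalIntegrable_const.add hi3) h3
  rw [intervalIntegral.integral_add intervalIntegrable_const hi3,
    intervalIntegral.integral_const, intervalIntegral.integral_const_mul, smul_eq_mul,
    add_sub_cancel_left] at h6
  have h7 := mul_le_mul_of_nonneg_left h6 (inv_nonneg.2 hh.le)
  rw [mul_add, inv_mul_cancel_left₀ hh.ne'] at h7
  linarith

/-- ∇Ψ_t need not extend to the boundary, so the gradient of the quotient need not be bounded. This
crude majorant, from ‖v‖ ≤ 1 + ‖v‖², serves only for integrability. -/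
theorem norm_fderiv_quotient_le (hU : IsOpen U)
    (hp : IsSolutionIBVP1 U Γe Γi (conductivity a α) Q p₀ γ ψ p)
    (hΨ : IsBoundaryDataExtension U Γi ψ Ψ) (A : ℝ) {t h : ℝ} (ht : 0 < t) (hh : 0 < h)
    {x : 𝕍} (hx : x ∈ U) :
    ‖fderiv ℝ (fun y => quotient p Ψ A h y t) x‖ ≤
      h⁻¹ * (‖gradUpToBoundary U (fun y => p y (t + h)) x‖ +
        ‖gradUpToBoundary U (fun y => p y t) x‖) +
      h⁻¹ * (h + ∫ τ in t..(t + h), ‖gradient (fun y => deriv (Ψ y) τ) x‖ ^ (2 : ℝ)) := by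
  have hth : 0 < t + h := by linarith
  have hc1 : ContinuousOn (fun τ => fderiv ℝ (fun y => deriv (Ψ y) τ) x) (Ioi (0 : ℝ)) :=
    continuousOn_slice (b := fun (x : 𝕍) (τ : ℝ) => fderiv ℝ (fun y : 𝕍 => deriv (Ψ y) τ) x)
      (continuousOn_fderiv_space (θ := fun y τ => deriv (Ψ y) τ) hU hΨ.contDiffOn_time_deriv) hx
  have hc3 : ContinuousOn (fun τ => ‖gradient (fun y => deriv (Ψ y) τ) x‖ ^ (2 : ℝ))
      (Ioi (0 : ℝ)) := by
    simp only [norm_gradient_eq]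
    exact hc1.norm.rpow_const fun _ _ => Or.inr (by norm_num)
  have hi3 := intervalIntegrable_of_continuousOn_Ioi hc3 ht hth
  rw [(hasFDerivAt_quotient hU hp hΨ A ht hh hx).fderiv,
    gradUpToBoundary_eqOn hU (hp.contDiffOn_space _ hth) hx,
    gradUpToBoundary_eqOn hU (hp.contDiffOn_space _ ht) hx, norm_gradient_eq, norm_gradient_eq]
  refine (norm_sub_le _ _).trans (add_le_add ?_ ?_)
  · rw [norm_smul, Real.norm_of_nonneg (inv_nonneg.2 hh.le)]
    gcongr
    exact norm_sub_le _ _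
  · rw [norm_smul, Real.norm_of_nonneg (inv_nonneg.2 hh.le)]
    gcongr
    refine (intervalIntegral.norm_integral_le_integral_norm (by linarith)).trans ?_
    have h6 := intervalIntegral.integral_mono (by linarith : t ≤ t + h)
      (intervalIntegrable_of_continuousOn_Ioi hc1.norm ht hth)
      ((intervalIntegrable_const (c := (1 : ℝ))).add hi3) (fun τ => by
        simp only [norm_gradient_eq, Real.rpow_two]
        nlinarith [norm_nonneg (fderiv ℝ (fun y => deriv (Ψ y) τ) x),
          sq_nonneg (‖fderiv ℝ (fun y => deriv (Ψ y) τ) x‖ - 1)])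
    rwa [intervalIntegral.integral_add intervalIntegrable_const hi3,
      intervalIntegral.integral_const, smul_eq_mul, add_sub_cancel_left, mul_one] at h6

end Quotient

end Forchheimer

namespace Forchheimer

/-! ### The energy inequality -/

section Energy

open MeasureTheory Set Filter Topology Metric

variable {n : ℕ}

local notation "𝕍" => EuclideanSpace ℝ (Fin n)

/-- `‖Ψ_tt(·, τ)‖ + ‖∇Ψ_t(·, τ)‖²` in `L^β(U)`. -/
noncomputable def dataNorm (U : Set 𝕍) (Ψ : 𝕍 → ℝ → ℝ) (β : ℝ) (τ : ℝ) : ENNReal :=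
  eLpNorm (fun x => deriv (fun s => deriv (Ψ x) s) τ) (ENNReal.ofReal β) (volume.restrict U) +
    eLpNorm (fun x => gradient (fun y => deriv (Ψ y) τ) x) (ENNReal.ofReal β)
      (volume.restrict U) ^ 2

variable {k : ℕ} {U Γe Γi : Set (EuclideanSpace ℝ (Fin n))} {a α : Fin (k + 1) → ℝ}
  {Q γ : ℝ → ℝ} {p₀ : EuclideanSpace ℝ (Fin n) → ℝ} {ψ Ψ p : EuclideanSpace ℝ (Fin n) → ℝ → ℝ}
  {A M β c t h : ℝ} {Φ Φ' Φ'' : ℝ → ℝ}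

theorem integrableOn_of_continuousOn_closure (hb : Bornology.IsBounded U) {f : 𝕍 → ℝ}
    (hf : ContinuousOn f (closure U)) : IntegrableOn f U :=
  (hf.integrableOn_compact hb.isCompact_closure).mono_set subset_closure

theorem IsTruncation.continuous_fun (hΦ : IsTruncation M β c Φ Φ' Φ'') : Continuous Φ :=
  continuous_iff_continuousAt.2 fun s => (hΦ.hasDerivAt s).continuousAt

theorem IsTruncation.continuous_deriv (hΦ : IsTruncation M β c Φ Φ' Φ'') : Continuous Φ' :=
  continuous_iff_continuousAt.2 fun s => (hΦ.hasDerivAt' s).continuousAt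

theorem IsTruncation.contDiff_deriv (hΦ : IsTruncation M β c Φ Φ' Φ'') : ContDiff ℝ 1 Φ' := by
  rw [contDiff_one_iff_deriv]
  refine ⟨fun s => (hΦ.hasDerivAt' s).differentiableAt, ?_⟩
  rw [funext fun s => (hΦ.hasDerivAt' s).deriv]
  exact hΦ.continuous

theorem continuousOn_fluxQuotient (hg : IsGeneralizedPolynomial a α)
    (hp : IsSolutionIBVP1 U Γe Γi (conductivity a α) Q p₀ γ ψ p) (ht : 0 < t) (hh : 0 < h) :
    ContinuousOn (fluxQuotient a α U p h t) (closure U) := by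
  unfold fluxQuotient
  exact ((hp.continuousOn_fluxField hg (add_pos ht hh)).sub
    (hp.continuousOn_fluxField hg ht)).const_smul h⁻¹

theorem contDiffOn_fluxQuotient (hg : IsGeneralizedPolynomial a α) (hU : IsOpen U)
    (hp : IsSolutionIBVP1 U Γe Γi (conductivity a α) Q p₀ γ ψ p) (ht : 0 < t) (hh : 0 < h) :
    ContDiffOn ℝ 1 (fluxQuotient a α U p h t) U := by
  unfold fluxQuotient
  exact ((contDiffOn_fluxField hg hU (hp.contDiffOn_space _ (add_pos ht hh))).sub
    (contDiffOn_fluxField hg hU (hp.contDiffOn_space _ ht))).const_smul h⁻¹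

theorem divergence_test (hR : IsReservoir U Γe Γi) (hg : IsGeneralizedPolynomial a α)
    (hp : IsSolutionIBVP1 U Γe Γi (conductivity a α) Q p₀ γ ψ p)
    (hΨ : IsBoundaryDataExtension U Γi ψ Ψ) (hΦ : IsTruncation M β c Φ Φ' Φ'')
    (ht : 0 < t) (hh : 0 < h) {x : 𝕍} (hx : x ∈ U) :
    divergence (fun y => Φ' (quotient p Ψ A h y t) • fluxQuotient a α U p h t y) x =
      Φ' (quotient p Ψ A h x t) * (h⁻¹ * (deriv (p x) (t + h) - deriv (p x) t)) +
      Φ'' (quotient p Ψ A h x t) *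
        fderiv ℝ (fun y => quotient p Ψ A h y t) x (fluxQuotient a α U p h t x) := by
  have hu : HasFDerivAt (fun y => quotient p Ψ A h y t)
      (fderiv ℝ (fun y => quotient p Ψ A h y t) x) x :=
    (((contDiffOn_quotient hp hΨ A ht hh).contDiffAt (hR.isOpen.mem_nhds hx)).differentiableAt
      one_ne_zero).hasFDerivAt
  have h1 := (hΦ.hasDerivAt' (quotient p Ψ A h x t)).comp_hasFDerivAt x hu
  have h2 : HasFDerivAt (fun y => Φ' (quotient p Ψ A h y t)) _ x := h1
  rw [divergence_smul h2.differentiableAt (((contDiffOn_fluxQuotient hg hR.isOpen hp ht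
    hh).contDiffAt (hR.isOpen.mem_nhds hx)).differentiableAt one_ne_zero),
    hp.divergence_fluxQuotient hg hR.isOpen ht hh hx, h2.fderiv]
  simp

theorem lintegral_dataNorm_ne_top (hfin : ∫⁻ τ in Ici (1 : ℝ), dataNorm U Ψ β τ ≠ ⊤) (ht : 1 ≤ t) :
    ∫⁻ τ in Ioc t (t + h), dataNorm U Ψ β τ ≠ ⊤ :=
  ((lintegral_mono_set fun _ hτ => ht.trans hτ.1.le).trans_lt hfin.lt_top).ne

theorem lintegral_gradient_le (t h : ℝ) :
    ∫⁻ τ in Ioc t (t + h), eLpNorm (fun x => gradient (fun y => deriv (Ψ y) τ) x)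
      (ENNReal.ofReal β) (volume.restrict U) ^ (2 : ℝ) ≤
    ∫⁻ τ in Ioc t (t + h), dataNorm U Ψ β τ :=
  lintegral_mono fun τ => by rw [ENNReal.rpow_two]; exact le_add_self

theorem lintegral_time_deriv_le (t h : ℝ) :
    ∫⁻ τ in Ioc t (t + h), eLpNorm (fun x => deriv (fun s => deriv (Ψ x) s) τ)
      (ENNReal.ofReal β) (volume.restrict U) ^ (1 : ℝ) ≤
    ∫⁻ τ in Ioc t (t + h), dataNorm U Ψ β τ :=
  lintegral_mono fun τ => by rw [ENNReal.rpow_one]; exact le_self_add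

/-- Φ''(u) and the flux quotient are bounded on the closure, so only the gradient of u matters. It
is dominated through the Hölder lemma with Y = 1. -/
theorem integrableOn_test (hR : IsReservoir U Γe Γi) (hg : IsGeneralizedPolynomial a α)
    (hp : IsSolutionIBVP1 U Γe Γi (conductivity a α) Q p₀ γ ψ p)
    (hΨ : IsBoundaryDataExtension U Γi ψ Ψ) (hΦ : IsTruncation M β c Φ Φ' Φ'') (hβ : 2 ≤ β)
    (hfin : ∫⁻ τ in Ici (1 : ℝ), dataNorm U Ψ β τ ≠ ⊤) (ht : 1 ≤ t) (hh : 0 < h) :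
    IntegrableOn (fun x => Φ'' (quotient p Ψ A h x t) *
      fderiv ℝ (fun y => quotient p Ψ A h y t) x (fluxQuotient a α U p h t x)) U := by
  have ht0 : 0 < t := by linarith
  have hU := hR.isOpen
  have hK := hR.isBounded.isCompact_closure
  have hq : ContinuousOn (fun x => quotient p Ψ A h x t) (closure U) :=
    continuousOn_slice_space (continuousOn_quotient hp.continuousOn hΨ.continuousOn A hh) ht0
  have hf := continuousOn_fluxQuotient hg hp ht0 hh
  have hgr : ∀ s > 0, ContinuousOn (gradUpToBoundary U fun y => p y s) (closure U) := fun s hs =>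
    continuousOn_slice_space (b := fun (x : 𝕍) s => gradUpToBoundary U (fun y => p y s) x)
      hp.continuousOn_gradient hs
  have hN := (integrableOn_rpow_mul_integral hU (β := β) (j := 2) (Y := fun _ => 1)
    (b := fun (x : 𝕍) τ => gradient (fun y => deriv (Ψ y) τ) x)
    (continuousOn_gradient_space_time (θ := fun y τ => deriv (Ψ y) τ) hU hΨ.contDiffOn_time_deriv)
    (by linarith) (by norm_num) hβ ht0 hh.le
    ((lintegral_gradient_le t h).trans_lt (lintegral_dataNorm_ne_top hfin ht).lt_top).ne
    (fun _ => zero_le_one)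
    (integrableOn_const hR.isBounded.measure_lt_top.ne)).1
  simp only [Real.one_rpow, one_mul] at hN
  have hS : ContinuousOn (fun x => ‖gradUpToBoundary U (fun y => p y (t + h)) x‖ +
      ‖gradUpToBoundary U (fun y => p y t) x‖) (closure U) :=
    (hgr _ (by linarith)).norm.add (hgr _ ht0).norm
  have hmaj := ((integrableOn_of_continuousOn_closure hR.isBounded hS).const_mul h⁻¹).add
    (((integrableOn_const (C := h) hR.isBounded.measure_lt_top.ne).add hN).const_mul h⁻¹)
  obtain ⟨B, hB⟩ := hK.exists_bound_of_continuousOn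
    ((hΦ.continuous.comp_continuousOn hq).mul hf.norm)
  have hu := contDiffOn_quotient hp hΨ A ht0 hh
  refine Integrable.mono' (hmaj.const_mul B) ?_ ?_
  · refine ContinuousOn.aestronglyMeasurable ?_ hU.measurableSet
    exact (hΦ.continuous.comp_continuousOn hu.continuousOn).mul
      ((hu.continuousOn_fderiv_of_isOpen hU le_rfl).clm_apply (hf.mono subset_closure))
  · refine (ae_restrict_iff' hU.measurableSet).2 (Eventually.of_forall fun x hx => ?_)
    have h1 := norm_fderiv_quotient_le hU hp hΨ A ht0 hh hx
    have h2 : ‖Φ'' (quotient p Ψ A h x t)‖ * ‖fluxQuotient a α U p h t x‖ ≤ B := by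
      simpa using hB x (subset_closure hx)
    rw [norm_mul]
    calc ‖Φ'' (quotient p Ψ A h x t)‖ *
          ‖fderiv ℝ (fun y => quotient p Ψ A h y t) x (fluxQuotient a α U p h t x)‖
        ≤ ‖Φ'' (quotient p Ψ A h x t)‖ * (‖fderiv ℝ (fun y => quotient p Ψ A h y t) x‖ *
            ‖fluxQuotient a α U p h t x‖) := by
          gcongr
          exact ContinuousLinearMap.le_opNorm _ _
      _ = ‖Φ'' (quotient p Ψ A h x t)‖ * ‖fluxQuotient a α U p h t x‖ *
            ‖fderiv ℝ (fun y => quotient p Ψ A h y t) x‖ := by ring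
      _ ≤ _ := mul_le_mul h2 h1 (norm_nonneg _) ((by positivity : (0 : ℝ) ≤ _).trans h2)

theorem quotient_eq_of_mem_well
    (hp : IsSolutionIBVP1 U Γe Γi (conductivity a α) Q p₀ γ ψ p)
    (hΨ : IsBoundaryDataExtension U Γi ψ Ψ) (ht : 0 < t) (hh : 0 < h) {x : 𝕍} (hx : x ∈ Γi) :
    quotient p Ψ A h x t = h⁻¹ * (γ (t + h) - γ t) + A := by
  have hth : 0 < t + h := by linarith
  rw [quotient, hp.trace x hx _ hth, hp.trace x hx _ ht, hΨ.trace x hx _ hth, hΨ.trace x hx _ ht]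
  ring

theorem inner_fluxField_normal
    (hp : IsSolutionIBVP1 U Γe Γi (conductivity a α) Q p₀ γ ψ p) (ht : 0 < t) {x : 𝕍}
    (hx : x ∈ Γe) :
    inner ℝ (fluxField a α U (fun y => p y t) x) (outwardNormal U x) = 0 := by
  rw [fluxField, flux, real_inner_smul_left, hp.no_flow x hx t ht, mul_zero]

theorem continuousOn_time_quotient {b : 𝕍 → ℝ → ℝ}
    (hb : ContinuousOn (fun z : 𝕍 × ℝ => b z.1 z.2) (closure U ×ˢ Ioi (0 : ℝ)))
    (ht : 0 < t) (hh : 0 < h) :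
    ContinuousOn (fun x => h⁻¹ * (b x (t + h) - b x t)) (closure U) :=
  continuousOn_const.mul ((continuousOn_slice_space hb (by linarith)).sub
    (continuousOn_slice_space hb ht))

/-- The tested equation. -/
theorem integral_test_eq (hR : IsReservoir U Γe Γi) (hg : IsGeneralizedPolynomial a α)
    (hp : IsSolutionIBVP1 U Γe Γi (conductivity a α) Q p₀ γ ψ p)
    (hΨ : IsBoundaryDataExtension U Γi ψ Ψ) (hΦ : IsTruncation M β c Φ Φ' Φ'') (hβ : 2 ≤ β)
    (hfin : ∫⁻ τ in Ici (1 : ℝ), dataNorm U Ψ β τ ≠ ⊤) (ht : 1 ≤ t) (hh : 0 < h)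
    (hγ : |h⁻¹ * (γ (t + h) - γ t) + A| ≤ M) :
    ∫ x in U, Φ' (quotient p Ψ A h x t) * (h⁻¹ * (deriv (p x) (t + h) - deriv (p x) t)) =
      -∫ x in U, Φ'' (quotient p Ψ A h x t) *
        fderiv ℝ (fun y => quotient p Ψ A h y t) x (fluxQuotient a α U p h t x) := by
  have ht0 : 0 < t := by linarith
  have hU := hR.isOpen
  have hq : ContinuousOn (fun x => quotient p Ψ A h x t) (closure U) :=
    continuousOn_slice_space (continuousOn_quotient hp.continuousOn hΨ.continuousOn A hh) ht0
  have hi1 : IntegrableOn (fun x => Φ' (quotient p Ψ A h x t) *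
      (h⁻¹ * (deriv (p x) (t + h) - deriv (p x) t))) U :=
    integrableOn_of_continuousOn_closure hR.isBounded
      ((hΦ.continuous_deriv.comp_continuousOn hq).mul
        (continuousOn_time_quotient (b := fun (x : 𝕍) t => deriv (p x) t)
          hp.continuousOn_time_deriv ht0 hh))
  have hi2 := integrableOn_test (A := A) hR hg hp hΨ hΦ hβ hfin ht hh
  have hdiv : EqOn (divergence fun y =>
      Φ' (quotient p Ψ A h y t) • fluxQuotient a α U p h t y) _ U :=
    fun x hx => divergence_test hR hg hp hΨ hΦ ht0 hh hx
  have hT : IsTangentField U fun y =>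
      Φ' (quotient p Ψ A h y t) • fluxQuotient a α U p h t y := by
    constructor
    · exact (hΦ.contDiff_deriv.comp_contDiffOn (contDiffOn_quotient hp hΨ A ht0 hh)).smul
        (contDiffOn_fluxQuotient hg hU hp ht0 hh)
    · exact (hΦ.continuous_deriv.comp_continuousOn hq).smul
        (continuousOn_fluxQuotient hg hp ht0 hh)
    · intro x hx
      -- On Γe the flux is parallel to ∇p and has no normal component; on Γi the quotient lies in
      -- [-M, M], where Φ' vanishes.
      rw [← hR.union_eq] at hx
      rcases hx with hx | hx
      · rw [fluxQuotient, real_inner_smul_left, real_inner_smul_left, inner_sub_left,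
          inner_fluxField_normal hp (by linarith) hx, inner_fluxField_normal hp ht0 hx]
        ring
      · rw [quotient_eq_of_mem_well hp hΨ ht0 hh hx, hΦ.eq_zero _ hγ, zero_smul, inner_zero_left]
    · exact (hi1.add hi2).congr_fun hdiv.symm hU.measurableSet
  have h0 := hT.integral_divergence hU hR.isBounded hR.c2_boundary
  rw [setIntegral_congr_fun hU.measurableSet hdiv, integral_add hi1 hi2] at h0
  linarith

/-- Makes the powers of E produced by Hölder linear, as Gronwall requires. -/
theorem rpow_le_one_add {E q : ℝ} (hE : 0 ≤ E) (hq0 : 0 ≤ q) (hq1 : q ≤ 1) : E ^ q ≤ 1 + E := by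
  rcases le_total E 1 with h | h
  · linarith [Real.rpow_le_one hE h hq0]
  · calc E ^ q ≤ E ^ (1 : ℝ) := Real.rpow_le_rpow_of_exponent_le h hq1
      _ ≤ 1 + E := by rw [Real.rpow_one]; linarith

/-- The differential inequality for `∫ Φ(u)`. -/
theorem integral_deriv_quotient_le (hR : IsReservoir U Γe Γi) (hg : IsGeneralizedPolynomial a α)
    (hp : IsSolutionIBVP1 U Γe Γi (conductivity a α) Q p₀ γ ψ p)
    (hΨ : IsBoundaryDataExtension U Γi ψ Ψ) (hΦ : IsTruncation M β c Φ Φ' Φ'') (hβ : 2 ≤ β)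
    (hc : 0 ≤ c) (hfin : ∫⁻ τ in Ici (1 : ℝ), dataNorm U Ψ β τ ≠ ⊤) (ht : 1 ≤ t) (hh : 0 < h)
    (hγ : |h⁻¹ * (γ (t + h) - γ t) + A| ≤ M) :
    ∫ x in U, Φ' (quotient p Ψ A h x t) * (h⁻¹ * (deriv (p x) (t + h) - deriv (p x) t) -
        h⁻¹ * (deriv (Ψ x) (t + h) - deriv (Ψ x) t)) ≤
      c * (1 + (4 * a 0)⁻¹) * (h⁻¹ * (∫⁻ τ in Ioc t (t + h), dataNorm U Ψ β τ).toReal) *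
        (1 + ∫ x in U, Φ (quotient p Ψ A h x t)) := by
  have ht0 : 0 < t := by linarith
  have hth : 0 < t + h := by linarith
  have hβ0 : 0 < β := by linarith
  have ha := hg.coeff_pos 0
  have hU := hR.isOpen
  have hq : ContinuousOn (fun x => quotient p Ψ A h x t) (closure U) :=
    continuousOn_slice_space (continuousOn_quotient hp.continuousOn hΨ.continuousOn A hh) ht0
  have hΦ'q := hΦ.continuous_deriv.comp_continuousOn hq
  have hi1 : IntegrableOn (fun x => Φ' (quotient p Ψ A h x t) *
      (h⁻¹ * (deriv (p x) (t + h) - deriv (p x) t))) U :=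
    integrableOn_of_continuousOn_closure hR.isBounded (hΦ'q.mul
        (continuousOn_time_quotient (b := fun (x : 𝕍) t => deriv (p x) t)
          hp.continuousOn_time_deriv ht0 hh))
  have hi2 : IntegrableOn (fun x => Φ' (quotient p Ψ A h x t) *
      (h⁻¹ * (deriv (Ψ x) (t + h) - deriv (Ψ x) t))) U :=
    integrableOn_of_continuousOn_closure hR.isBounded (hΦ'q.mul
        (continuousOn_time_quotient (b := fun (x : 𝕍) t => deriv (Ψ x) t)
          hΨ.continuousOn_time_deriv ht0 hh))
  have hi3 := integrableOn_test (A := A) hR hg hp hΨ hΦ hβ hfin ht hh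
  set E := ∫ x in U, Φ (quotient p Ψ A h x t) with hE
  have hΦ0 : ∀ s, 0 ≤ Φ s := fun s => zero_le_one.trans (hΦ.one_le s)
  have hE0 : 0 ≤ E := integral_nonneg fun x => hΦ0 _
  have hΦi : IntegrableOn (fun x => Φ (quotient p Ψ A h x t)) U :=
    integrableOn_of_continuousOn_closure hR.isBounded (hΦ.continuous_fun.comp_continuousOn hq)
  set D := (∫⁻ τ in Ioc t (t + h), dataNorm U Ψ β τ).toReal with hD
  have hD0 : 0 ≤ D := ENNReal.toReal_nonneg
  have hDfin := lintegral_dataNorm_ne_top (h := h) hfin ht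
  have hcts := continuousOn_deriv_time (θ := fun y τ => deriv (Ψ y) τ) hU hΨ.contDiffOn_time_deriv
  obtain ⟨hN2, hN2le⟩ := integrableOn_rpow_mul_integral hU (β := β) (j := 2)
    (b := fun (x : 𝕍) τ => gradient (fun y => deriv (Ψ y) τ) x)
    (continuousOn_gradient_space_time (θ := fun y τ => deriv (Ψ y) τ) hU hΨ.contDiffOn_time_deriv)
    hβ0 (by norm_num) hβ ht0 hh.le
    ((lintegral_gradient_le t h).trans_lt hDfin.lt_top).ne (fun x => hΦ0 _) hΦi
  obtain ⟨hN1, hN1le⟩ := integrableOn_rpow_mul_integral hU (β := β) (j := 1)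
    (b := fun (x : 𝕍) τ => deriv (fun s => deriv (Ψ x) s) τ) hcts
    hβ0 (by norm_num) (by linarith) ht0 hh.le
    ((lintegral_time_deriv_le t h).trans_lt hDfin.lt_top).ne (fun x => hΦ0 _) hΦi
  have hD2 := ENNReal.toReal_mono hDfin (lintegral_gradient_le (U := U) (Ψ := Ψ) (β := β) t h)
  have hD1 := ENNReal.toReal_mono hDfin (lintegral_time_deriv_le (U := U) (Ψ := Ψ) (β := β) t h)
  -- The gradient term: convexity of Φ allows the pointwise flux bound to be multiplied by Φ'', and
  -- Hölder with j = 2 follows.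
  have hfirst : -∫ x in U, Φ'' (quotient p Ψ A h x t) *
        fderiv ℝ (fun y => quotient p Ψ A h y t) x (fluxQuotient a α U p h t x) ≤
      c * (4 * a 0)⁻¹ * h⁻¹ * ((1 + E) * D) := by
    have h1 : ∫ x in U, -(Φ'' (quotient p Ψ A h x t) *
        fderiv ℝ (fun y => quotient p Ψ A h y t) x (fluxQuotient a α U p h t x)) ≤
        ∫ x in U, c * (4 * a 0)⁻¹ * h⁻¹ * (Φ (quotient p Ψ A h x t) ^ ((β - 2) / β) *
          ∫ τ in t..(t + h), ‖gradient (fun y => deriv (Ψ y) τ) x‖ ^ (2 : ℝ)) := by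
      refine setIntegral_mono_on hi3.neg (hN2.const_mul _) hU.measurableSet fun x hx => ?_
      have h2 := neg_fderiv_quotient_le hg hU hp hΨ A ht0 hh hx
      set N := ∫ τ in t..(t + h), ‖gradient (fun y => deriv (Ψ y) τ) x‖ ^ (2 : ℝ) with hN
      have hN0 : 0 ≤ N := intervalIntegral.integral_nonneg (by linarith) fun τ _ => by positivity
      calc -(Φ'' (quotient p Ψ A h x t) *
            fderiv ℝ (fun y => quotient p Ψ A h y t) x (fluxQuotient a α U p h t x))
          = Φ'' (quotient p Ψ A h x t) *
            -(fderiv ℝ (fun y => quotient p Ψ A h y t) x (fluxQuotient a α U p h t x)) := by ring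
        _ ≤ Φ'' (quotient p Ψ A h x t) * ((4 * a 0)⁻¹ * (h⁻¹ * N)) :=
            mul_le_mul_of_nonneg_left h2 (hΦ.nonneg _)
        _ ≤ c * Φ (quotient p Ψ A h x t) ^ ((β - 2) / β) * ((4 * a 0)⁻¹ * (h⁻¹ * N)) :=
            mul_le_mul_of_nonneg_right (hΦ.le _) (by positivity)
        _ = _ := by ring
    rw [integral_neg, integral_const_mul] at h1
    refine h1.trans (mul_le_mul_of_nonneg_left (hN2le.trans ?_) (by positivity))
    exact mul_le_mul (rpow_le_one_add hE0 (div_nonneg (by linarith) hβ0.le)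
      ((div_le_one hβ0).2 (by linarith))) hD2 ENNReal.toReal_nonneg (by linarith)
  -- The source term: the increment of Ψ_t is the time integral of Ψ_tt, and Hölder applies with j =
  -- 1.
  have hsecond : -∫ x in U, Φ' (quotient p Ψ A h x t) *
      (h⁻¹ * (deriv (Ψ x) (t + h) - deriv (Ψ x) t)) ≤ c * h⁻¹ * ((1 + E) * D) := by
    have h1 : ∫ x in U, -(Φ' (quotient p Ψ A h x t) *
        (h⁻¹ * (deriv (Ψ x) (t + h) - deriv (Ψ x) t))) ≤
        ∫ x in U, c * h⁻¹ * (Φ (quotient p Ψ A h x t) ^ ((β - 1) / β) *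
          ∫ τ in t..(t + h), ‖deriv (fun s => deriv (Ψ x) s) τ‖ ^ (1 : ℝ)) := by
      refine setIntegral_mono_on hi2.neg (hN1.const_mul _) hU.measurableSet fun x hx => ?_
      simp only [Real.rpow_one]
      have h2 : deriv (Ψ x) (t + h) - deriv (Ψ x) t =
          ∫ τ in t..(t + h), deriv (fun s => deriv (Ψ x) s) τ :=
        sub_eq_integral_deriv (fun s hs => (hasDerivAt_time (θ := fun y τ => deriv (Ψ y) τ) hU
          hΨ.contDiffOn_time_deriv hx hs).differentiableAt)
          (continuousOn_slice (b := fun (x : 𝕍) τ => deriv (fun s => deriv (Ψ x) s) τ) hcts hx)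
          ht0 hth
      have h3 := intervalIntegral.norm_integral_le_integral_norm (μ := volume)
        (f := fun τ => deriv (fun s => deriv (Ψ x) s) τ) (by linarith : t ≤ t + h)
      rw [← h2] at h3
      set N := ∫ τ in t..(t + h), ‖deriv (fun s => deriv (Ψ x) s) τ‖ with hN
      calc -(Φ' (quotient p Ψ A h x t) * (h⁻¹ * (deriv (Ψ x) (t + h) - deriv (Ψ x) t)))
          ≤ |Φ' (quotient p Ψ A h x t) * (h⁻¹ * (deriv (Ψ x) (t + h) - deriv (Ψ x) t))| :=
            neg_le_abs _
        _ = |Φ' (quotient p Ψ A h x t)| * (h⁻¹ * ‖deriv (Ψ x) (t + h) - deriv (Ψ x) t‖) := by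
            rw [abs_mul, abs_mul, abs_of_pos (inv_pos.2 hh), Real.norm_eq_abs]
        _ ≤ c * Φ (quotient p Ψ A h x t) ^ ((β - 1) / β) * (h⁻¹ * N) :=
            mul_le_mul (hΦ.abs_le _) (mul_le_mul_of_nonneg_left h3 (inv_nonneg.2 hh.le))
              (by positivity) ((abs_nonneg _).trans (hΦ.abs_le _))
        _ = _ := by ring
    rw [integral_neg, integral_const_mul] at h1
    refine h1.trans (mul_le_mul_of_nonneg_left (hN1le.trans ?_) (by positivity))
    exact mul_le_mul (rpow_le_one_add hE0 (div_nonneg (by linarith) hβ0.le)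
      ((div_le_one hβ0).2 (by linarith))) hD1 ENNReal.toReal_nonneg (by linarith)
  have hsplit : ∫ x in U, Φ' (quotient p Ψ A h x t) *
      (h⁻¹ * (deriv (p x) (t + h) - deriv (p x) t) -
        h⁻¹ * (deriv (Ψ x) (t + h) - deriv (Ψ x) t)) =
      (∫ x in U, Φ' (quotient p Ψ A h x t) * (h⁻¹ * (deriv (p x) (t + h) - deriv (p x) t))) -
      ∫ x in U, Φ' (quotient p Ψ A h x t) * (h⁻¹ * (deriv (Ψ x) (t + h) - deriv (Ψ x) t)) := by
    rw [← integral_sub hi1 hi2]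
    simp only [mul_sub]
  rw [hsplit, integral_test_eq hR hg hp hΨ hΦ hβ hfin ht hh hγ]
  calc _ ≤ c * (4 * a 0)⁻¹ * h⁻¹ * ((1 + E) * D) + c * h⁻¹ * ((1 + E) * D) := by linarith
    _ = _ := by ring

end Energy

end Forchheimer

namespace Forchheimer

/-! ### Boundedness of the energy -/

section Gronwall

open MeasureTheory Set Filter Topology Metric

/-- An averaged Gronwall inequality. -/
theorem one_add_le_of_deriv_le {E E' J : ℝ → ℝ} {h c B : ℝ} (hh : 0 < h) (hc : 0 ≤ c)
    (hJ : Continuous J) (hJ0 : ∀ t, 0 ≤ J t) (hJB : ∀ t, J t ≤ B) (hE0 : ∀ t, 0 ≤ E t)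
    (hE : ∀ t ≥ 1, HasDerivAt E (E' t) t)
    (hle : ∀ t ≥ 1, E' t ≤ c * (h⁻¹ * (J (t + h) - J t)) * (1 + E t)) {t : ℝ} (ht : 1 ≤ t) :
    1 + E t ≤ (1 + E 1) * Real.exp (c * B) := by
  -- S is the mean of J over [t, t+h] and a primitive of the coefficient (J(t+h) - J(t))/h. Being a
  -- mean it stays in [0, B], independently of h.
  let S : ℝ → ℝ := fun t => h⁻¹ * ((∫ τ in (0 : ℝ)..(t + h), J τ) - ∫ τ in (0 : ℝ)..t, J τ)
  have hii : ∀ s t, IntervalIntegrable J volume s t := fun s t => hJ.intervalIntegrable s t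
  have hprim : ∀ t, HasDerivAt (fun t => ∫ τ in (0 : ℝ)..t, J τ) (J t) t := fun t =>
    intervalIntegral.integral_hasDerivAt_right (hii _ _)
      hJ.stronglyMeasurable.stronglyMeasurableAtFilter hJ.continuousAt
  have hS : ∀ t, HasDerivAt S (h⁻¹ * (J (t + h) - J t)) t := fun t =>
    (((hprim (t + h)).comp_add_const t h).sub (hprim t)).const_mul h⁻¹
  have hSeq : ∀ t, S t = h⁻¹ * ∫ τ in t..(t + h), J τ := fun t => by
    simp only [S, intervalIntegral.integral_interval_sub_left (hii _ _) (hii _ _)]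
  have hS0 : ∀ t, 0 ≤ S t := fun t => by
    rw [hSeq]
    exact mul_nonneg (inv_nonneg.2 hh.le)
      (intervalIntegral.integral_nonneg (by linarith) fun τ _ => hJ0 τ)
  have hSB : ∀ t, S t ≤ B := fun t => by
    rw [hSeq]
    have h1 := intervalIntegral.integral_mono (by linarith : t ≤ t + h) (hii t (t + h))
      (intervalIntegrable_const (c := B)) hJB
    rw [intervalIntegral.integral_const, smul_eq_mul, add_sub_cancel_left] at h1
    rwa [inv_mul_le_iff₀ hh]
  have hpos : ∀ t, 0 < 1 + E t := fun t => by linarith [hE0 t]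
  have hG : ∀ t ≥ 1, HasDerivAt (fun t => Real.log (1 + E t) - c * S t)
      (E' t / (1 + E t) - c * (h⁻¹ * (J (t + h) - J t))) t := fun t ht =>
    (((hE t ht).const_add 1).log (hpos t).ne').sub ((hS t).const_mul c)
  have hanti : AntitoneOn (fun t => Real.log (1 + E t) - c * S t) (Ici 1) := by
    refine antitoneOn_of_deriv_nonpos (convex_Ici 1)
      (fun t ht => (hG t ht).continuousAt.continuousWithinAt)
      (fun t ht => (hG t (interior_subset ht)).differentiableAt.differentiableWithinAt)
      fun t ht => ?_
    rw [(hG t (interior_subset ht)).deriv, sub_nonpos, div_le_iff₀ (hpos t)]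
    exact hle t (interior_subset ht)
  have h1 := hanti self_mem_Ici (show t ∈ Ici (1 : ℝ) from ht) ht
  simp only at h1
  have h2 : Real.log (1 + E t) ≤ Real.log (1 + E 1) + c * B := by
    have h3 := mul_le_mul_of_nonneg_left (hSB t) hc
    have h4 := mul_nonneg hc (hS0 1)
    linarith
  rw [← Real.exp_log (hpos t), ← Real.exp_log (hpos 1), ← Real.exp_add]
  exact Real.exp_le_exp.2 (by simpa [Real.exp_log (hpos 1)] using h2)

/-- A continuous bounded primitive of a density with finite integral. -/
theorem exists_continuous_primitive {f : ℝ → ENNReal} (hf : ∫⁻ τ in Ici (1 : ℝ), f τ ≠ ⊤) :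
    ∃ (J : ℝ → ℝ) (B : ℝ), Continuous J ∧ (∀ t, 0 ≤ J t) ∧ (∀ t, J t ≤ B) ∧
      ∀ t h, 1 ≤ t → 0 ≤ h → J (t + h) - J t = (∫⁻ τ in Ioc t (t + h), f τ).toReal := by
  set μ := (volume : Measure ℝ).restrict (Ici 1) with hμ
  have hle : ∀ s : Set ℝ, ∫⁻ τ in s, f τ ∂μ ≤ ∫⁻ τ, f τ ∂μ := fun s => setLIntegral_le_lintegral _ _
  have hfs : ∀ s : Set ℝ, ∫⁻ τ in s, f τ ∂μ ≠ ⊤ := fun s => ((hle s).trans_lt hf.lt_top).ne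
  let J : ℝ → ℝ := fun t => (∫⁻ τ in Iic t, f τ ∂μ).toReal
  have hsub : ∀ s t, s ≤ t → J t - J s = (∫⁻ τ in Ioc s t, f τ ∂μ).toReal := by
    intro s t hst
    have h1 : ∫⁻ τ in Iic t, f τ ∂μ = ∫⁻ τ in Iic s, f τ ∂μ + ∫⁻ τ in Ioc s t, f τ ∂μ := by
      rw [← lintegral_union measurableSet_Ioc (Iic_disjoint_Ioc le_rfl), Iic_union_Ioc_eq_Iic hst]
    simp only [J]
    rw [h1, ENNReal.toReal_add (hfs _) (hfs _), add_sub_cancel_left]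
  refine ⟨J, (∫⁻ τ, f τ ∂μ).toReal, ?_, fun t => ENNReal.toReal_nonneg,
    fun t => ENNReal.toReal_mono hf (hle _), fun t h ht hh => ?_⟩
  · rw [continuous_iff_continuousAt]
    intro t
    -- Absolute continuity of the integral; min and max treat both sides of t at once.
    have h1 : Tendsto (fun s => ∫⁻ τ in Ioc (min s t) (max s t), f τ ∂μ) (𝓝 t) (𝓝 0) := by
      refine tendsto_setLIntegral_zero hf ?_
      have h2 : Tendsto (fun s => ENNReal.ofReal (max s t - min s t)) (𝓝 t) (𝓝 0) := by
        have h3 : Continuous fun s : ℝ => ENNReal.ofReal (max s t - min s t) :=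
          ENNReal.continuous_ofReal.comp (by fun_prop)
        simpa using h3.tendsto t
      refine tendsto_of_tendsto_of_tendsto_of_le_of_le tendsto_const_nhds h2 (fun _ => zero_le)
        fun s => ?_
      refine (Measure.restrict_apply_le _ _).trans ?_
      rw [Real.volume_Ioc]
    have h2 := (ENNReal.tendsto_toReal ENNReal.zero_ne_top).comp h1
    rw [ContinuousAt, tendsto_iff_dist_tendsto_zero]
    refine h2.congr fun s => ?_
    simp only [Function.comp_apply]
    rw [← hsub _ _ min_le_max, Real.dist_eq]
    rcases le_total s t with h | h
    · have h3 : J s ≤ J t := by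
        have := hsub s t h
        linarith [ENNReal.toReal_nonneg (a := ∫⁻ τ in Ioc s t, f τ ∂μ)]
      rw [max_eq_right h, min_eq_left h, abs_of_nonpos (by linarith)]
      ring
    · have h3 : J t ≤ J s := by
        have := hsub t s h
        linarith [ENNReal.toReal_nonneg (a := ∫⁻ τ in Ioc t s, f τ ∂μ)]
      rw [max_eq_left h, min_eq_right h, abs_of_nonneg (by linarith)]
  · rw [hsub t (t + h) (by linarith), hμ, Measure.restrict_restrict measurableSet_Ioc,
      inter_eq_self_of_subset_left (show Ioc t (t + h) ⊆ Ici 1 from fun τ hτ => ht.trans hτ.1.le)]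

end Gronwall

/-! ### Estimates uniform in the step, and the limit h → 0. -/

section Bound

open MeasureTheory Set Filter Topology Metric

variable {n : ℕ}

local notation "𝕍" => EuclideanSpace ℝ (Fin n)

variable {k : ℕ} {U Γe Γi : Set (EuclideanSpace ℝ (Fin n))} {a α : Fin (k + 1) → ℝ}
  {Q γ : ℝ → ℝ} {p₀ : EuclideanSpace ℝ (Fin n) → ℝ} {ψ Ψ p : EuclideanSpace ℝ (Fin n) → ℝ → ℝ}
  {A M β c t h : ℝ} {Φ Φ' Φ'' : ℝ → ℝ} {K : ℝ → ℝ}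

theorem hasDerivAt_quotient (hp : IsSolutionIBVP1 U Γe Γi K Q p₀ γ ψ p)
    (hΨ : IsBoundaryDataExtension U Γi ψ Ψ) (ht : 0 < t) (hh : 0 < h) {x : 𝕍}
    (hx : x ∈ closure U) :
    HasDerivAt (quotient p Ψ A h x) (h⁻¹ * (deriv (p x) (t + h) - deriv (p x) t) -
        h⁻¹ * (deriv (Ψ x) (t + h) - deriv (Ψ x) t)) t := by
  have h1 := (hp.differentiableAt_time x hx _ ht).hasDerivAt
  have h2 := ((hp.differentiableAt_time x hx _ (add_pos ht hh)).hasDerivAt).comp_add_const t h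
  have h3 := (hΨ.differentiableAt_time x hx _ ht).hasDerivAt
  have h4 := ((hΨ.differentiableAt_time x hx _ (add_pos ht hh)).hasDerivAt).comp_add_const t h
  exact (((h2.sub h1).const_mul h⁻¹).sub ((h4.sub h3).const_mul h⁻¹)).add_const A

/-- Differentiation under the integral is legitimate because p_t and Ψ_t are continuous up to the
boundary, so that the derivative of the integrand is bounded near t. -/
theorem hasDerivAt_integral_quotient (hR : IsReservoir U Γe Γi)
    (hp : IsSolutionIBVP1 U Γe Γi K Q p₀ γ ψ p) (hΨ : IsBoundaryDataExtension U Γi ψ Ψ)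
    (hΦ : IsTruncation M β c Φ Φ' Φ'') (ht : 0 < t) (hh : 0 < h) :
    HasDerivAt (fun t => ∫ x in U, Φ (quotient p Ψ A h x t))
      (∫ x in U, Φ' (quotient p Ψ A h x t) * (h⁻¹ * (deriv (p x) (t + h) - deriv (p x) t) -
        h⁻¹ * (deriv (Ψ x) (t + h) - deriv (Ψ x) t))) t := by
  have hU := hR.isOpen
  have hq := continuousOn_quotient hp.continuousOn hΨ.continuousOn A hh
  have hpt := continuousOn_shift (b := fun (x : 𝕍) t => deriv (p x) t)
    hp.continuousOn_time_deriv hh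
  have hΨt := continuousOn_shift (b := fun (x : 𝕍) t => deriv (Ψ x) t)
    hΨ.continuousOn_time_deriv hh
  have hF' : ContinuousOn (fun z : 𝕍 × ℝ => Φ' (quotient p Ψ A h z.1 z.2) *
      (h⁻¹ * (deriv (p z.1) (z.2 + h) - deriv (p z.1) z.2) -
        h⁻¹ * (deriv (Ψ z.1) (z.2 + h) - deriv (Ψ z.1) z.2))) (closure U ×ˢ Ioi (0 : ℝ)) :=
    (hΦ.continuous_deriv.comp_continuousOn hq).mul
      ((continuousOn_const.mul (hpt.sub hp.continuousOn_time_deriv)).sub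
        (continuousOn_const.mul (hΨt.sub hΨ.continuousOn_time_deriv)))
  have hF : ContinuousOn (fun z : 𝕍 × ℝ => Φ (quotient p Ψ A h z.1 z.2))
      (closure U ×ˢ Ioi (0 : ℝ)) := hΦ.continuous_fun.comp_continuousOn hq
  have hs : closedBall t (t / 2) ⊆ Ioi (0 : ℝ) := fun s hs => by
    rw [mem_closedBall, Real.dist_eq, abs_le] at hs
    exact show 0 < s by linarith [hs.1]
  obtain ⟨B, hB⟩ := (hR.isBounded.isCompact_closure.prod
    (isCompact_closedBall t (t / 2))).exists_bound_of_continuousOn (hF'.mono (prod_mono le_rfl hs))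
  have hi : ∀ s > 0, IntegrableOn (fun x => Φ (quotient p Ψ A h x s)) U := fun s hs =>
    integrableOn_of_continuousOn_closure hR.isBounded
      (continuousOn_slice_space (b := fun (x : 𝕍) s => Φ (quotient p Ψ A h x s)) hF hs)
  refine (hasDerivAt_integral_of_dominated_loc_of_deriv_le (bound := fun _ => B)
    (F := fun t x => Φ (quotient p Ψ A h x t))
    (F' := fun t x => Φ' (quotient p Ψ A h x t) *
      (h⁻¹ * (deriv (p x) (t + h) - deriv (p x) t) -
        h⁻¹ * (deriv (Ψ x) (t + h) - deriv (Ψ x) t)))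
    (closedBall_mem_nhds t (half_pos ht)) ?_ (hi t ht) ?_ ?_ ?_ ?_).2
  · filter_upwards [Ioi_mem_nhds ht] with s hs
    exact (hi s hs).aestronglyMeasurable
  · exact (integrableOn_of_continuousOn_closure hR.isBounded (continuousOn_slice_space
      (b := fun (x : 𝕍) t => Φ' (quotient p Ψ A h x t) *
      (h⁻¹ * (deriv (p x) (t + h) - deriv (p x) t) -
        h⁻¹ * (deriv (Ψ x) (t + h) - deriv (Ψ x) t))) hF' ht)).aestronglyMeasurable
  · exact (ae_restrict_iff' hU.measurableSet).2 (Eventually.of_forall fun x hx s hs =>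
      hB (x, s) ⟨subset_closure hx, hs⟩)
  · exact integrableOn_const hR.isBounded.measure_lt_top.ne
  · exact (ae_restrict_iff' hU.measurableSet).2 (Eventually.of_forall fun x hx s hst =>
      (hΦ.hasDerivAt _).comp s (hasDerivAt_quotient hp hΨ (hs hst) hh (subset_closure hx)))

/-- The difference quotients are bounded uniformly in the step. -/
theorem exists_abs_quotient_le (hR : IsReservoir U Γe Γi)
    (hp : IsSolutionIBVP1 U Γe Γi K Q p₀ γ ψ p) (hΨ : IsBoundaryDataExtension U Γi ψ Ψ) (A : ℝ)
    (ht : 0 < t) :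
    ∃ B, ∀ x ∈ closure U, ∀ h, 0 < h → h ≤ 1 → |quotient p Ψ A h x t| ≤ B := by
  have hc : ContinuousOn (fun z : 𝕍 × ℝ => deriv (p z.1) z.2 - deriv (Ψ z.1) z.2)
      (closure U ×ˢ Ioi (0 : ℝ)) := hp.continuousOn_time_deriv.sub hΨ.continuousOn_time_deriv
  obtain ⟨B, hB⟩ := (hR.isBounded.isCompact_closure.prod
    (isCompact_Icc (a := t) (b := t + 1))).exists_bound_of_continuousOn
    (hc.mono (prod_mono le_rfl fun s hs => ht.trans_le hs.1))
  refine ⟨B + |A|, fun x hx h hh hh1 => ?_⟩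
  have hd : ∀ s ∈ Icc t (t + h), HasDerivWithinAt (fun s => p x s - Ψ x s)
      (deriv (p x) s - deriv (Ψ x) s) (Icc t (t + h)) s := fun s hs =>
    ((hp.differentiableAt_time x hx s (ht.trans_le hs.1)).hasDerivAt.sub
      (hΨ.differentiableAt_time x hx s (ht.trans_le hs.1)).hasDerivAt).hasDerivWithinAt
  have h1 := (convex_Icc t (t + h)).norm_image_sub_le_of_norm_hasDerivWithin_le hd
    (fun s hs => hB (x, s) ⟨hx, hs.1, hs.2.trans (by linarith)⟩)
    (left_mem_Icc.2 (by linarith)) (right_mem_Icc.2 (by linarith))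
  rw [add_sub_cancel_left, Real.norm_eq_abs, Real.norm_of_nonneg hh.le] at h1
  have h2 : quotient p Ψ A h x t = h⁻¹ * (p x (t + h) - Ψ x (t + h) - (p x t - Ψ x t)) + A := by
    rw [quotient]; ring
  rw [h2]
  refine (abs_add_le _ _).trans (add_le_add ?_ le_rfl)
  rw [abs_mul, abs_of_pos (inv_pos.2 hh), inv_mul_le_iff₀ hh, mul_comm]
  exact h1

theorem tendsto_integral_quotient (hR : IsReservoir U Γe Γi)
    (hp : IsSolutionIBVP1 U Γe Γi K Q p₀ γ ψ p) (hΨ : IsBoundaryDataExtension U Γi ψ Ψ)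
    (hΦ : Continuous Φ) (ht : 0 < t) :
    Tendsto (fun h => ∫ x in U, Φ (quotient p Ψ A h x t)) (𝓝[>] 0)
      (𝓝 (∫ x in U, Φ (deriv (p x) t - deriv (Ψ x) t + A))) := by
  obtain ⟨B, hB⟩ := exists_abs_quotient_le hR hp hΨ A ht
  obtain ⟨C, hC⟩ := (isCompact_Icc (a := -B) (b := B)).exists_bound_of_continuousOn
    hΦ.continuousOn
  have hU := hR.isOpen
  refine tendsto_integral_filter_of_dominated_convergence (fun _ => C) ?_ ?_
    (integrableOn_const hR.isBounded.measure_lt_top.ne) ?_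
  · filter_upwards [self_mem_nhdsWithin] with h hh
    exact (integrableOn_of_continuousOn_closure hR.isBounded (hΦ.comp_continuousOn
      (continuousOn_slice_space (continuousOn_quotient hp.continuousOn hΨ.continuousOn A hh)
        ht))).aestronglyMeasurable
  · filter_upwards [Ioc_mem_nhdsGT (zero_lt_one (α := ℝ))] with h hh
    exact (ae_restrict_iff' hU.measurableSet).2 (Eventually.of_forall fun x hx =>
      hC _ (abs_le.1 (hB x (subset_closure hx) h hh.1 hh.2)))
  · refine (ae_restrict_iff' hU.measurableSet).2 (Eventually.of_forall fun x hx => ?_)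
    have h1 := (hp.differentiableAt_time x (subset_closure hx) t ht).hasDerivAt
    have h2 := (hΨ.differentiableAt_time x (subset_closure hx) t ht).hasDerivAt
    exact (hΦ.tendsto _).comp ((h1.tendsto_slope_zero_right.sub
      h2.tendsto_slope_zero_right).add_const A)

/-- Both the initial energy at t = 1 (mean value bound) and the Gronwall factor are independent of h
∈ (0, 1], so the bound survives h → 0. -/
theorem exists_integral_truncation_le (hR : IsReservoir U Γe Γi)
    (hg : IsGeneralizedPolynomial a α)
    (hp : IsSolutionIBVP1 U Γe Γi (conductivity a α) Q p₀ γ ψ p)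
    (hΨ : IsBoundaryDataExtension U Γi ψ Ψ) (hΦ : IsTruncation M β c Φ Φ' Φ'') (hβ : 2 ≤ β)
    (hc : 0 ≤ c) (hfin : ∫⁻ τ in Ici (1 : ℝ), dataNorm U Ψ β τ ≠ ⊤)
    (hγ : ∀ t h, 1 ≤ t → 0 < h → |h⁻¹ * (γ (t + h) - γ t) + A| ≤ M) :
    ∃ C, ∀ t ≥ 1, ∫ x in U, Φ (deriv (p x) t - deriv (Ψ x) t + A) ≤ C := by
  obtain ⟨J, B, hJ, hJ0, hJB, hJsub⟩ := exists_continuous_primitive hfin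
  have ha := hg.coeff_pos 0
  set c₁ := c * (1 + (4 * a 0)⁻¹) with hc₁
  obtain ⟨B₀, hB₀⟩ := exists_abs_quotient_le hR hp hΨ A one_pos
  obtain ⟨C₀, hC₀⟩ := (isCompact_Icc (a := -B₀) (b := B₀)).exists_bound_of_continuousOn
    hΦ.continuous_fun.continuousOn
  have hinit : ∀ h, 0 < h → h ≤ 1 →
      ∫ x in U, Φ (quotient p Ψ A h x 1) ≤ C₀ * volume.real U := by
    intro h hh hh1
    have h1 := norm_setIntegral_le_of_norm_le_const (μ := (volume : Measure 𝕍)) (s := U)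
      (f := fun x => Φ (quotient p Ψ A h x 1)) hR.isBounded.measure_lt_top
      (fun x hx => hC₀ _ (abs_le.1 (hB₀ x (subset_closure hx) h hh hh1)))
    exact (le_abs_self _).trans h1
  refine ⟨(1 + C₀ * volume.real U) * Real.exp (c₁ * B), fun t ht => ?_⟩
  refine le_of_tendsto (tendsto_integral_quotient (A := A) hR hp hΨ hΦ.continuous_fun
    (by linarith : 0 < t)) ?_
  filter_upwards [Ioc_mem_nhdsGT (zero_lt_one (α := ℝ))] with h hh
  have h1 := one_add_le_of_deriv_le (E := fun t => ∫ x in U, Φ (quotient p Ψ A h x t))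
    (c := c₁) (B := B) hh.1 (by positivity) hJ hJ0 hJB
    (fun t => integral_nonneg fun x => zero_le_one.trans (hΦ.one_le _))
    (fun t ht => hasDerivAt_integral_quotient (A := A) hR hp hΨ hΦ (by linarith : 0 < t) hh.1)
    (fun t ht => by
      rw [hJsub t h ht hh.1.le]
      exact integral_deriv_quotient_le hR hg hp hΨ hΦ hβ hc hfin ht hh.1 (hγ t h ht hh.1)) ht
  have h2 := mul_le_mul_of_nonneg_right (add_le_add_right (hinit h hh.1 hh.2) 1)
    (Real.exp_pos (c₁ * B)).le
  linarith

theorem continuousOn_shifted_deriv (hp : IsSolutionIBVP1 U Γe Γi K Q p₀ γ ψ p)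
    (hΨ : IsBoundaryDataExtension U Γi ψ Ψ) (hβ : 0 ≤ β) (A : ℝ) :
    ContinuousOn (fun z : 𝕍 × ℝ => |deriv (p z.1) z.2 - deriv (Ψ z.1) z.2 + A| ^ β)
      (closure U ×ˢ Ioi (0 : ℝ)) :=
  ((hp.continuousOn_time_deriv.sub hΨ.continuousOn_time_deriv).add
    continuousOn_const).abs.rpow_const fun _ _ => Or.inr hβ

/-- For t ≥ 1 the growth of Φ turns the energy bound into the claim; for t between t₀ and 1 the
integrand is continuous on a compact set. -/
theorem exists_integral_rpow_le (hR : IsReservoir U Γe Γi)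
    (hg : IsGeneralizedPolynomial a α)
    (hp : IsSolutionIBVP1 U Γe Γi (conductivity a α) Q p₀ γ ψ p)
    (hΨ : IsBoundaryDataExtension U Γi ψ Ψ) (hβ : 2 ≤ β) (hM : 0 ≤ M)
    (hfin : ∫⁻ τ in Ici (1 : ℝ), dataNorm U Ψ β τ ≠ ⊤)
    (hγ : ∀ t h, 1 ≤ t → 0 < h → |h⁻¹ * (γ (t + h) - γ t) + A| ≤ M) {t₀ : ℝ} (ht₀ : 0 < t₀) :
    ∃ C, ∀ t ≥ t₀, IntegrableOn (fun x => |deriv (p x) t - deriv (Ψ x) t + A| ^ β) U ∧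
      ∫ x in U, |deriv (p x) t - deriv (Ψ x) t + A| ^ β ≤ C := by
  obtain ⟨c, Φ, Φ', Φ'', hc, hΦ⟩ := exists_isTruncation hM hβ
  obtain ⟨C₁, hC₁⟩ := exists_integral_truncation_le hR hg hp hΨ hΦ hβ hc hfin hγ
  have hcont := continuousOn_shifted_deriv (β := β) hp hΨ (by linarith) A
  obtain ⟨B, hB⟩ := (hR.isBounded.isCompact_closure.prod
    (isCompact_Icc (a := t₀) (b := 1))).exists_bound_of_continuousOn
    (hcont.mono (prod_mono le_rfl fun s hs => ht₀.trans_le hs.1))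
  have hint : ∀ t > 0, IntegrableOn (fun x => |deriv (p x) t - deriv (Ψ x) t + A| ^ β) U :=
    fun t ht => integrableOn_of_continuousOn_closure hR.isBounded (continuousOn_slice_space
      (b := fun (x : 𝕍) t => |deriv (p x) t - deriv (Ψ x) t + A| ^ β) hcont ht)
  refine ⟨max (c * C₁) (B * volume.real U), fun t ht => ⟨hint t (ht₀.trans_le ht), ?_⟩⟩
  have htpos : 0 < t := ht₀.trans_le ht
  rcases le_total 1 t with h | h
  · refine le_trans ?_ (le_max_left _ _)
    have hΦi : IntegrableOn (fun x => Φ (deriv (p x) t - deriv (Ψ x) t + A)) U :=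
      integrableOn_of_continuousOn_closure hR.isBounded (hΦ.continuous_fun.comp_continuousOn
        (((continuousOn_slice_space (b := fun (x : 𝕍) t => deriv (p x) t)
          hp.continuousOn_time_deriv htpos).sub (continuousOn_slice_space
          (b := fun (x : 𝕍) t => deriv (Ψ x) t) hΨ.continuousOn_time_deriv htpos)).add
          continuousOn_const))
    calc ∫ x in U, |deriv (p x) t - deriv (Ψ x) t + A| ^ β
        ≤ ∫ x in U, c * Φ (deriv (p x) t - deriv (Ψ x) t + A) :=
          integral_mono (hint t htpos) (hΦi.const_mul c) fun x => hΦ.growth _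
      _ = c * ∫ x in U, Φ (deriv (p x) t - deriv (Ψ x) t + A) := integral_const_mul _ _
      _ ≤ c * C₁ := mul_le_mul_of_nonneg_left (hC₁ t h) hc
  · refine le_trans ?_ (le_max_right _ _)
    have h1 := norm_setIntegral_le_of_norm_le_const (μ := (volume : Measure 𝕍)) (s := U)
      (f := fun x => |deriv (p x) t - deriv (Ψ x) t + A| ^ β) hR.isBounded.measure_lt_top
      (fun x hx => hB (x, t) ⟨subset_closure hx, ht, h⟩)
    exact (le_abs_self _).trans h1

/-- Difference quotients of the well trace are controlled by the bound on `Δ_γ'`. -/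
theorem abs_slope_trace_le (hd : ∀ t ≥ 1, DifferentiableAt ℝ γ t)
    (hM : ∀ t ≥ 1, |deriv (fun s => γ s + A * s) t| ≤ M) (ht : 1 ≤ t) (hh : 0 < h) :
    |h⁻¹ * (γ (t + h) - γ t) + A| ≤ M := by
  have hdiff : ∀ s ∈ Icc t (t + h), DifferentiableAt ℝ (fun s => γ s + A * s) s := fun s hs =>
    (hd s (ht.trans hs.1)).add (differentiableAt_id.const_mul A)
  have h1 := (convex_Icc t (t + h)).norm_image_sub_le_of_norm_deriv_le hdiff
    (fun s hs => hM s (ht.trans hs.1)) (left_mem_Icc.2 (by linarith))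
    (right_mem_Icc.2 (by linarith))
  rw [add_sub_cancel_left, Real.norm_of_nonneg hh.le, Real.norm_eq_abs] at h1
  have h2 : h⁻¹ * (γ (t + h) - γ t) + A = h⁻¹ * (γ (t + h) + A * (t + h) - (γ t + A * t)) := by
    field_simp
    ring
  rw [h2, abs_mul, abs_of_pos (inv_pos.2 hh), inv_mul_le_iff₀ hh]
  exact h1.trans_eq (mul_comm _ _)

end Bound

end Forchheimer

theorem mainTheorem8 {n : ℕ} (hn : 2 ≤ n)
    {U Γe Γi : Set (EuclideanSpace ℝ (Fin n))} (hU : Forchheimer.IsReservoir U Γe Γi)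
    {k : ℕ} {a α : Fin (k + 1) → ℝ} (hg : Forchheimer.IsGeneralizedPolynomial a α)
    {Q γ : ℝ → ℝ} {Qs : ℝ} {p₀ : EuclideanSpace ℝ (Fin n) → ℝ}
    {ψ Ψ p : EuclideanSpace ℝ (Fin n) → ℝ → ℝ}
    (hp : Forchheimer.IsSolutionIBVP1 U Γe Γi (Forchheimer.conductivity a α) Q p₀ γ ψ p)
    (hΨ : Forchheimer.IsBoundaryDataExtension U Γi ψ Ψ)
    {β : ℝ} (hβ : 2 ≤ β) (hA3 : Forchheimer.AssumptionA3 U Q γ Qs Ψ β) :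
    (∀ φ Φ W : EuclideanSpace ℝ (Fin n) → ℝ, (∀ x ∈ Γi, Φ x = φ x) →
      Forchheimer.IsBasicProfile U Γe Γi (Forchheimer.conductivity a α) Qs φ W →
      ∀ t > 0,
        ∫ x in U, |deriv (fun s => p x s - Ψ x s) t -
            deriv (fun s => Forchheimer.pssSolution U Qs W x s - Φ x) t| ^ β =
          ∫ x in U, |deriv (fun s => p x s - Ψ x s) t + Forchheimer.pssRate U Qs| ^ β) ∧
    ∀ t₀ > 0, ∃ C : ℝ, ∀ t ≥ t₀,
      MeasureTheory.IntegrableOn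
        (fun x => |deriv (fun s => p x s - Ψ x s) t + Forchheimer.pssRate U Qs| ^ β) U ∧
      ∫ x in U, |deriv (fun s => p x s - Ψ x s) t + Forchheimer.pssRate U Qs| ^ β ≤ C := by
  constructor
  · intro φ Φ W _ _ t _
    -- W and Φ do not depend on time, so only the drift -At contributes.
    have h1 : ∀ x, deriv (fun s => Forchheimer.pssSolution U Qs W x s - Φ x) t =
        -Forchheimer.pssRate U Qs := fun x => by
      have : HasDerivAt (fun s => Forchheimer.pssSolution U Qs W x s - Φ x)
          (-Forchheimer.pssRate U Qs * 1) t :=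
        (((hasDerivAt_id t).const_mul _).add_const (W x)).sub_const (Φ x)
      rw [this.deriv, mul_one]
    simp only [h1, sub_neg_eq_add]
  · intro t₀ ht₀
    obtain ⟨hγd, C₀, hC₀⟩ := hA3
    have hfin : ∫⁻ τ in Set.Ici (1 : ℝ), Forchheimer.dataNorm U Ψ β τ ≠ ⊤ :=
      ((le_add_self.trans (hC₀ 1 le_rfl)).trans_lt ENNReal.ofReal_lt_top).ne
    -- The maximum with 0 appears because `ENNReal.ofReal` truncates a negative constant to 0; it
    -- also supplies the nonnegative M of the truncation.
    have hM : ∀ t ≥ 1, |deriv (fun s => γ s + Forchheimer.pssRate U Qs * s) t| ≤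
        max C₀ 0 := fun t ht => by
      have h1 := ENNReal.toReal_mono ENNReal.ofReal_ne_top (le_self_add.trans (hC₀ t ht))
      rw [ENNReal.toReal_ofReal (by positivity), ENNReal.toReal_ofReal'] at h1
      linarith [abs_nonneg (Q t - Qs)]
    obtain ⟨C, hC⟩ := Forchheimer.exists_integral_rpow_le hU hg hp hΨ hβ (le_max_right C₀ 0) hfin
      (fun t h ht hh => Forchheimer.abs_slope_trace_le hγd hM ht hh) ht₀
    have hderiv : ∀ t ≥ t₀, ∀ x ∈ U,
        |deriv (p x) t - deriv (Ψ x) t + Forchheimer.pssRate U Qs| ^ β =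
        |deriv (fun s => p x s - Ψ x s) t + Forchheimer.pssRate U Qs| ^ β := fun t ht x hx => by
      have ht0 : 0 < t := lt_of_lt_of_le ht₀ ht
      rw [deriv_fun_sub (hp.differentiableAt_time x (subset_closure hx) t ht0)
        (hΨ.differentiableAt_time x (subset_closure hx) t ht0)]
    refine ⟨C, fun t ht => ⟨(hC t ht).1.congr_fun (hderiv t ht) hU.isOpen.measurableSet, ?_⟩⟩
    rw [← MeasureTheory.setIntegral_congr_fun hU.isOpen.measurableSet (hderiv t ht)]
    exact (hC t ht).2
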